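/- **Setting.** Identify $S^3\subset\mathbb C^2$ with the unit sphere, and let $\mathfrak P:S^3\to S^2$, $\mathfrak P(\alpha,\beta)=(|\alpha|^2-|\beta|^2,-2\,\mathrm{Im}(\bar\alpha\beta),-2\,\mathrm{Re}(\bar\alpha\beta))$ be the Hopf fibration, equivariant for the double cover $P:\mathrm{SU}(2)\to\mathrm{SO}(3)$. Let $\lambda$ be the restriction to $S^3$ of $\sum_k (x_k\,dy_k-y_k\,dx_k)$, so that its Reeb flow is the Hopf action $z\mapsto e^{it}z$. Let $\mathbb P\subset \mathrm{SO}(3)$ be the rotation group of a regular tetrahedron, octahedron or icosahedron inscribed in $S^2$, and let $G=P^{-1}(\mathbb P)\subset\mathrm{SU}(2)$ be the binary polyhedral group; thus $G$ is any conjugate of $\mathbb T^*$, $\mathbb O^*$ or $\mathbb I^*$. Let $I_V=3,4,5$ in the three cases (the order of the isotropy group in $\mathbb P$ of a vertex). Let $f:S^2\to\mathbb R$ be a smooth $\mathbb P$-invariant function whose critical points are exactly the vertices, the radial projections of the edge midpoints, and the radial projections of the face barycenters, and such that near each such point $f$ has, in suitable stereographic coordinates centered there, the form $\tfrac{x^2+y^2}{2}-1$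 (vertices), $\tfrac{x^2-y^2}{2}$ (edges), $1-\tfrac{x^2+y^2}{2}$ (faces). For $\varepsilon>0$ let $\lambda_{G,\varepsilon}$ be the 1-form on $S^3/G$ induced by $(1+\varepsilon\, f\circ\mathfrak P)\lambda$, and let $\mathfrak p:S^3/G\to S^2/\mathbb P$ be the map induced by $\mathfrak P$. A Reeb orbit is a closed integral curve $\mathbb R/T\mathbb Z\to S^3/G$ of the Reeb field, up to reparametrization; its action is $T$; $\gamma^k$ denotes the $k$-fold iterate ($k\ge1$). It is nondegenerate if $1$ is not an eigenvalue of its linearized return map on the contact plane; it is negative hyperbolic if both eigenvalues are negative reals; it is bad if it is an even iterate of a negative hyperbolic orbit, and good otherwise. Its Conley–Zehnder index $\mu_{\mathrm{CZ}}$ is computed in the global trivialization of the contact structure induced by the left-invariant frame $V_1(\alpha,\beta)=(-\bar\beta,\bar\alpha)$, $V_2=iV_1$, and its degree is $|\gamma|=\mu_{\mathrm{CZ}}(\gamma)-1$. **Lemma.** Let $m=|\mathrm{Conj}(G)|$ be the number of conjugacy classes of $G$. Then $m=I_V+2+3-1$, i.e. $m=7,8,9$ for $\mathbb T^*,\mathbb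 O^*,\mathbb I^*$. Fix an integer $N\ge1$ and put $L_N=2\pi N-\pi/10$. There is $\varepsilon_N>0$ such that for all $\varepsilon\in(0,\varepsilon_N]$ the form $\lambda_{G,\varepsilon}$ is a contact form and: 1. Every Reeb orbit of action $<L_N$ is nondegenerate and projects under $\mathfrak p$ to the image in $S^2/\mathbb P$ of a critical point of $f$. 2. There are embedded Reeb orbits $\mathcal V,\mathcal E,\mathcal F$ projecting to the vertex, edge and face point of $S^2/\mathbb P$, respectively, such that the Reeb orbits of action $<L_N$ are exactly $\mathcal V^k$ $(1\le k<2NI_V)$, $\mathcal E^k$ $(1\le k<4N)$ and $\mathcal F^k$ $(1\le k<6N)$. Their actions are $\mathcal A(\mathcal V^k)=k\pi(1-\varepsilon)/I_V$, $\mathcal A(\mathcal E^k)=k\pi/2$, $\mathcal A(\mathcal F^k)=k\pi(1+\varepsilon)/3$, and for $k$ in these ranges $$\mu_{\mathrm{CZ}}(\mathcal V^k)=2\lceil k/I_V\rceil-1,\qquad \mu_{\mathrm{CZ}}(\mathcal E^k)=k,\qquad \mu_{\mathrm{CZ}}(\mathcal F^k)=2\lfloor k/3\rfloor+1.$$ 3.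 Let $c_i$ be the number of Reeb orbits of action $<L_N$ and degree $i\in\mathbb Z$. Then $c_i=0$ if $i<0$ or $i>4N-2$; $c_0=c_{4N-2}=m-1$, all contributions being good orbits; $c_i=m$ for even $i$ with $0<i<4N-2$, all contributions being good orbits; and $c_i=1$ for odd $i$ with $0<i<4N-2$, the contribution being a bad orbit. -/

import Mathlib

open scoped Manifold ContDiff Pointwise Matrix Topology

noncomputable section

namespace PolyhedralReeb

/-! ### Spheres, `SU(2)`, `SO(3)` -/

/-- `ℂ²` with its Hermitian inner product (antilinear in the first variable). -/
abbrev C2 := EuclideanSpace ℂ (Fin 2)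

/-- Euclidean `ℝ³`. -/
abbrev E3 := EuclideanSpace ℝ (Fin 3)

/-- The unit sphere of `ℂ²`. -/
abbrev S3 := Metric.sphere (0 : C2) 1

/-- The unit sphere of `ℝ³`. -/
abbrev S2 := Metric.sphere (0 : E3) 1

abbrev SU2 := Matrix.specialUnitaryGroup (Fin 2) ℂ

abbrev SO3 := Matrix.specialOrthogonalGroup (Fin 3) ℝ

theorem norm_mulVec {𝕜 n : Type*} [RCLike 𝕜] [Fintype n] [DecidableEq n]
    (A : Matrix.specialUnitaryGroup n 𝕜) (x : EuclideanSpace 𝕜 n) :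
    ‖(WithLp.toLp 2 (A.1 *ᵥ x.ofLp) : EuclideanSpace 𝕜 n)‖ = ‖x‖ := by
  have hA : star A.1 * A.1 = 1 :=
    (Matrix.mem_unitaryGroup_iff').1 (Matrix.mem_specialUnitaryGroup_iff.1 A.2).1
  have h : inner 𝕜 (WithLp.toLp 2 (A.1 *ᵥ x.ofLp) : EuclideanSpace 𝕜 n)
      (WithLp.toLp 2 (A.1 *ᵥ x.ofLp)) = inner 𝕜 x x := by
    rw [EuclideanSpace.inner_eq_star_dotProduct, EuclideanSpace.inner_eq_star_dotProduct]
    simp only [Matrix.star_mulVec]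
    rw [dotProduct_comm, ← Matrix.dotProduct_mulVec, Matrix.mulVec_mulVec,
      ← Matrix.star_eq_conjTranspose, hA, Matrix.one_mulVec, dotProduct_comm]
  rw [inner_self_eq_norm_sq_to_K, inner_self_eq_norm_sq_to_K] at h
  have h2 : ‖(WithLp.toLp 2 (A.1 *ᵥ x.ofLp) : EuclideanSpace 𝕜 n)‖ ^ 2 = ‖x‖ ^ 2 := by
    exact_mod_cast h
  exact (sq_eq_sq₀ (norm_nonneg _) (norm_nonneg _)).1 h2

/-- The linear action of `SU(n)` (for `𝕜 = ℂ`) and of `SO(n)` (for `𝕜 = ℝ`) on the unit sphere. -/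
instance sphereAction {𝕜 n : Type*} [RCLike 𝕜] [Fintype n] [DecidableEq n] :
    MulAction (Matrix.specialUnitaryGroup n 𝕜)
      (Metric.sphere (0 : EuclideanSpace 𝕜 n) 1) where
  smul A x := ⟨WithLp.toLp 2 (A.1 *ᵥ x.1.ofLp), by
    rw [mem_sphere_zero_iff_norm, norm_mulVec]; exact mem_sphere_zero_iff_norm.1 x.2⟩
  one_smul x := by
    apply Subtype.ext
    change WithLp.toLp 2 ((1 : Matrix n n 𝕜) *ᵥ x.1.ofLp) = x.1
    rw [Matrix.one_mulVec]
  mul_smul A B x := by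
    apply Subtype.ext
    change WithLp.toLp 2 ((A.1 * B.1) *ᵥ x.1.ofLp) = WithLp.toLp 2 (A.1 *ᵥ (B.1 *ᵥ x.1.ofLp))
    rw [Matrix.mulVec_mulVec]

theorem SU2.entries (A : SU2) :
    A.1 0 1 = -star (A.1 1 0) ∧ A.1 1 1 = star (A.1 0 0) := by
  obtain ⟨h1, h2⟩ := Matrix.mem_specialUnitaryGroup_iff.1 A.2
  have h3 : A.1 * star A.1 = 1 := Matrix.mem_unitaryGroup_iff.1 h1
  have h4 : A.1.adjugate = star A.1 := by
    have := congrArg (fun X => A.1.adjugate * X) h3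
    simpa [← Matrix.mul_assoc, Matrix.adjugate_mul, h2] using this.symm
  rw [Matrix.adjugate_fin_two] at h4
  constructor
  · have := congrFun (congrFun h4 0) 1
    simp [Matrix.star_apply] at this
    simp [← this]
  · have := congrFun (congrFun h4 0) 0
    simpa [Matrix.star_apply] using this

theorem SU2.normSq_add (A : SU2) :
    (A.1 0 0).re ^ 2 + (A.1 0 0).im ^ 2 + (A.1 1 0).re ^ 2 + (A.1 1 0).im ^ 2 = 1 := by
  have h2 := (Matrix.mem_specialUnitaryGroup_iff.1 A.2).2
  rw [Matrix.det_fin_two, (SU2.entries A).1, (SU2.entries A).2] at h2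
  have h := congrArg Complex.re h2
  simp [Complex.mul_re] at h
  linarith

/-- The matrix of the rotation covered by the element of `SU(2)` with first column `(α, β)`. -/
def coverMatrix (α β : ℂ) : Matrix (Fin 3) (Fin 3) ℝ :=
  !![Complex.normSq α - Complex.normSq β, 2 * (α * β).im, 2 * (α * β).re;
     -2 * (star α * β).im, (α ^ 2 + β ^ 2).re, -(α ^ 2 + β ^ 2).im;
     -2 * (star α * β).re, (α ^ 2 - β ^ 2).im, (α ^ 2 - β ^ 2).re]

theorem coverMatrix_mul (α β γ δ : ℂ) :
    coverMatrix (α * γ - star β * δ) (β * γ + star α * δ)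
      = coverMatrix α β * coverMatrix γ δ := by
  ext i j
  fin_cases i <;> fin_cases j <;>
    simp [coverMatrix, Matrix.mul_apply, Fin.sum_univ_three,
      Complex.normSq_apply, pow_two] <;> ring

theorem coverMatrix_mem (A : SU2) :
    coverMatrix (A.1 0 0) (A.1 1 0) ∈ Matrix.specialOrthogonalGroup (Fin 3) ℝ := by
  have h := SU2.normSq_add A
  rw [Matrix.mem_specialOrthogonalGroup_iff, Matrix.mem_orthogonalGroup_iff]
  generalize A.1 0 0 = α at *
  generalize A.1 1 0 = β at *
  obtain ⟨a, b⟩ := α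
  obtain ⟨c, d⟩ := β
  simp only at h
  constructor
  · ext i j
    fin_cases i <;> fin_cases j <;>
      simp [coverMatrix, Matrix.mul_apply, Fin.sum_univ_three,
        Complex.normSq_apply, pow_two] <;>
      first
        | ring1
        | linear_combination (a ^ 2 + b ^ 2 + c ^ 2 + d ^ 2 + 1) * h
  · simp [coverMatrix, Matrix.det_fin_three,
        Complex.normSq_apply, pow_two]
    linear_combination ((a ^ 2 + b ^ 2 + c ^ 2 + d ^ 2) ^ 2
      + (a ^ 2 + b ^ 2 + c ^ 2 + d ^ 2) + 1) * h

/-- The double cover `P : SU(2) → SO(3)`. -/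
def cover : SU2 →* SO3 where
  toFun A := ⟨coverMatrix (A.1 0 0) (A.1 1 0), coverMatrix_mem A⟩
  map_one' := by
    apply Subtype.ext
    ext i j
    fin_cases i <;> fin_cases j <;> simp [coverMatrix]
  map_mul' A B := by
    apply Subtype.ext
    change coverMatrix ((A.1 * B.1) 0 0) ((A.1 * B.1) 1 0) = _ * _
    rw [← coverMatrix_mul]
    simp only [Matrix.mul_apply, Fin.sum_univ_two, (SU2.entries A).1, (SU2.entries A).2]
    congr 1 <;> ring

/-! ### The Hopf fibration and the Seifert fibration -/

theorem hopf_mem (z : S3) :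
    (!₂[Complex.normSq (z.1 0) - Complex.normSq (z.1 1), -2 * (star (z.1 0) * z.1 1).im,
      -2 * (star (z.1 0) * z.1 1).re] : E3) ∈ Metric.sphere (0 : E3) 1 := by
  have h : ‖z.1‖ ^ 2 = 1 := by rw [mem_sphere_zero_iff_norm.1 z.2]; norm_num
  rw [EuclideanSpace.norm_sq_eq] at h
  rw [mem_sphere_zero_iff_norm, ← sq_eq_sq₀ (norm_nonneg _) zero_le_one,
    EuclideanSpace.norm_sq_eq]
  simp [Fin.sum_univ_three, Fin.sum_univ_two, ← Complex.normSq_eq_norm_sq,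
    Complex.normSq_apply] at h ⊢
  generalize z.1 0 = α at *
  generalize z.1 1 = β at *
  obtain ⟨a, b⟩ := α
  obtain ⟨c, d⟩ := β
  simp only at h ⊢
  linear_combination (a * a + b * b + (c * c + d * d) + 1) * h

/-- The Hopf fibration `S³ → S²`. -/
def hopf (z : S3) : S2 := ⟨_, hopf_mem z⟩

theorem hopf_smul (A : SU2) (z : S3) : hopf (A • z) = cover A • hopf z := by
  apply Subtype.ext
  have h0 : (A • z).1 0 = A.1 0 0 * z.1 0 - star (A.1 1 0) * z.1 1 := by
    change (A.1 *ᵥ z.1.ofLp) 0 = _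
    simp [Matrix.mulVec, dotProduct, Fin.sum_univ_two, (SU2.entries A).1, sub_eq_add_neg]
  have h1 : (A • z).1 1 = A.1 1 0 * z.1 0 + star (A.1 0 0) * z.1 1 := by
    change (A.1 *ᵥ z.1.ofLp) 1 = _
    simp [Matrix.mulVec, dotProduct, Fin.sum_univ_two, (SU2.entries A).2]
  have key := coverMatrix_mul (A.1 0 0) (A.1 1 0) (z.1 0) (z.1 1)
  ext i
  change (hopf (A • z)).1 i = (coverMatrix (A.1 0 0) (A.1 1 0) *ᵥ (hopf z).1.ofLp) i
  have hc : ∀ w : S3, ∀ i, (hopf w).1 i = coverMatrix (w.1 0) (w.1 1) i 0 := by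
    intro w i
    fin_cases i <;> simp [hopf, coverMatrix]
  rw [hc, h0, h1, key, Matrix.mul_apply, Matrix.mulVec, dotProduct]
  exact Finset.sum_congr rfl fun j _ => by rw [← hc]

/-- The quotient `S³/G` for a subgroup `G` of `SU(2)`. -/
abbrev SphereQuotient (G : Subgroup SU2) := MulAction.orbitRel.Quotient G S3

/-- The quotient `S²/H`, where `H = P(G) ⊆ SO(3)`. -/
abbrev BaseQuotient (G : Subgroup SU2) := MulAction.orbitRel.Quotient (G.map cover) S2

/-- The covering map `S³ → S³/G`. -/
def proj (G : Subgroup SU2) (z : S3) : SphereQuotient G := Quotient.mk'' z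

/-- The orbifold covering map `S² → S²/H`. -/
def baseProj (G : Subgroup SU2) (p : S2) : BaseQuotient G := Quotient.mk'' p

/-- The Seifert fibration `S³/G → S²/H` induced by the Hopf fibration. -/
def seifert (G : Subgroup SU2) : SphereQuotient G → BaseQuotient G :=
  Quotient.map hopf (by
    rintro x y ⟨A, rfl⟩
    exact ⟨⟨cover A.1, Subgroup.mem_map_of_mem cover A.2⟩, (hopf_smul A.1 y).symm⟩)

/-! ### The perturbed contact form and its Reeb field -/

/-- The extension of a function on the unit sphere that is constant along rays (value `0` at the
origin). It is used to differentiate functions on the sphere in directions tangent to the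
sphere, where it computes the intrinsic derivative. -/
def radialExtension {E F : Type*} [NormedAddCommGroup E] [NormedSpace ℝ E] [Zero F]
    (g : Metric.sphere (0 : E) 1 → F) (x : E) : F :=
  open Classical in
  if hx : x ≠ 0 then g ⟨‖x‖⁻¹ • x, by simp [norm_smul, hx]⟩ else 0

/-- The tangent space of `S³` at `z`, as a subset of `ℂ²`. -/
def tangent (z : S3) : Set C2 := {v | (inner ℂ z.1 v).re = 0}

/-- The form `λ = ∑ (x_k dy_k - y_k dx_k)` on `ℂ²`: `λ_z(v) = Im ⟨z, v⟩`. On `S³` its Reeb flow is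
`z ↦ e^{it} z`. -/
def stdForm (z : C2) : C2 →L[ℝ] ℝ :=
  Complex.imCLM.comp ((innerSL ℂ z).restrictScalars ℝ)

/-- The form `λ_ε = (1 + ε f∘𝔓) λ`, extended to `ℂ² ∖ {0}`. -/
def perturbedForm (f : S2 → ℝ) (ε : ℝ) (z : C2) : C2 →L[ℝ] ℝ :=
  radialExtension (fun y : S3 => 1 + ε * f (hopf y)) z • stdForm z

/-- The exterior derivative of `λ_ε`. -/
def dPerturbedForm (f : S2 → ℝ) (ε : ℝ) (z : C2) : C2 [⋀^Fin 2]→L[ℝ] ℝ :=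
  extDeriv (fun x => ContinuousAlternatingMap.ofSubsingleton ℝ C2 ℝ (0 : Fin 1)
    (perturbedForm f ε x)) z

/-- The restriction of `λ_ε` to `S³` (equivalently, when `f` is invariant under `P(G)`, the
induced form `λ_{G,ε}` on `S³/G`) is a contact form: it vanishes nowhere, and its exterior
derivative is nondegenerate on its kernel. -/
def IsContactForm (f : S2 → ℝ) (ε : ℝ) : Prop :=
  ∀ z : S3, (∃ v ∈ tangent z, perturbedForm f ε z v ≠ 0) ∧
    ∀ v ∈ tangent z, perturbedForm f ε z v = 0 →
      (∀ w ∈ tangent z, perturbedForm f ε z w = 0 → dPerturbedForm f ε z ![v, w] = 0) → v = 0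

/-- `v` is the value at `z` of the Reeb vector field of `λ_ε|_{S³}`. -/
def IsReebVector (f : S2 → ℝ) (ε : ℝ) (z : S3) (v : C2) : Prop :=
  v ∈ tangent z ∧ perturbedForm f ε z v = 1 ∧
    ∀ w ∈ tangent z, dPerturbedForm f ε z ![v, w] = 0

/-- `c : ℝ → S³` is an integral curve of the Reeb vector field of `λ_ε`. -/
def IsReebTrajectory (f : S2 → ℝ) (ε : ℝ) (c : ℝ → S3) : Prop :=
  ∀ t, ∃ v, HasDerivAt (fun s => (c s : C2)) v t ∧ IsReebVector f ε (c t) v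

open Classical in
/-- The Reeb flow `φ^t` of `λ_ε` on `S³`. -/
def reebFlow (f : S2 → ℝ) (ε : ℝ) (t : ℝ) (z : S3) : S3 :=
  if h : ∃ c, IsReebTrajectory f ε c ∧ c 0 = z then h.choose t else z

/-- The linearized flow `dφ^t` at `z ∈ S³`, for vectors tangent to `S³`. -/
def linearizedFlow (f : S2 → ℝ) (ε : ℝ) (t : ℝ) (z : S3) : C2 →L[ℝ] C2 :=
  fderiv ℝ (radialExtension fun y : S3 => (reebFlow f ε t y : C2)) z

/-- The left-invariant frame `V₁, V₂ = i V₁` of the contact planes on `S³`: at `(α, β)`,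
`V₁ = (-conj β, conj α)`. It is orthonormal and `SU(2)`-invariant, so it descends to `S³/G`. -/
def frame (z : S3) : Fin 2 → C2 :=
  ![!₂[-star (z.1 1), star (z.1 0)], Complex.I • !₂[-star (z.1 1), star (z.1 0)]]

/-- The matrix of `dφ^t : ξ_z → ξ_{φ^t(z)}` in the frame `(V₁, V₂)`. -/
def flowMatrix (f : S2 → ℝ) (ε : ℝ) (z : S3) (t : ℝ) : Matrix (Fin 2) (Fin 2) ℝ :=
  Matrix.of fun i j =>
    (inner ℂ (frame (reebFlow f ε t z) i) (linearizedFlow f ε t z (frame z j))).re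

/-! ### The Conley-Zehnder index of a path in `Sp(2)` -/

/-- The set of winding numbers (in full turns, counterclockwise) of the curves `t ↦ M t v`,
`0 ≤ t ≤ T`, for `v ≠ 0`. -/
def windingSet (M : ℝ → Matrix (Fin 2) (Fin 2) ℝ) (T : ℝ) : Set ℝ :=
  {δ | ∃ v : Fin 2 → ℝ, v ≠ 0 ∧ ∃ θ : ℝ → ℝ, ContinuousOn θ (Set.Icc 0 T) ∧
    (∀ t ∈ Set.Icc 0 T, ∃ r : ℝ, 0 < r ∧ M t *ᵥ v = r • ![Real.cos (θ t), Real.sin (θ t)]) ∧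
    δ = (θ T - θ 0) / (2 * Real.pi)}

open Classical in
/-- The Conley-Zehnder index of a path `M : [0, T] → Sp(2)` with `M 0 = 1` and
`det (M T - 1) ≠ 0`, in its geometric description. The winding numbers form a compact interval `I`
of length less than `1/2` whose endpoints are not integers; the index is `2k` if `I` contains the
integer `k`, and `2k + 1` if `I ⊆ (k, k + 1)`. -/
def czIndex (M : ℝ → Matrix (Fin 2) (Fin 2) ℝ) (T : ℝ) : ℤ :=
  if h : ∃ k : ℤ, (k : ℝ) ∈ windingSet M T then 2 * h.choose
  else 2 * ⌊sInf (windingSet M T)⌋ + 1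

/-! ### Reeb orbits of `S³/G` -/

/-- A parametrized closed Reeb orbit of `λ_{G,ε}`: a period `T > 0` and a `T`-periodic integral
curve of the Reeb field in `S³/G`. As `S³ → S³/G` is a covering under which `λ_{G,ε}` pulls back to
`λ_ε`, the integral curves in `S³/G` are the projections of the integral curves in `S³`. -/
structure ReebLoop (G : Subgroup SU2) (f : S2 → ℝ) (ε : ℝ) where
  period : ℝ
  period_pos : 0 < period
  toFun : ℝ → SphereQuotient G
  periodic : Function.Periodic toFun period
  exists_lift : ∃ c : ℝ → S3, IsReebTrajectory f ε c ∧ ∀ t, toFun t = proj G (c t)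

variable {G : Subgroup SU2} {f : S2 → ℝ} {ε : ℝ}

/-- Two parametrized orbits agree up to reparametrization of `ℝ/Tℤ` (by a translation). -/
instance ReebLoop.setoid (G : Subgroup SU2) (f : S2 → ℝ) (ε : ℝ) : Setoid (ReebLoop G f ε) where
  r γ γ' := γ.period = γ'.period ∧ ∃ s, ∀ t, γ'.toFun t = γ.toFun (t + s)
  iseqv :=
    { refl := fun γ => ⟨rfl, 0, fun t => by rw [add_zero]⟩
      symm := by
        rintro γ γ' ⟨h, s, hs⟩
        exact ⟨h.symm, -s, fun t => by rw [hs, neg_add_cancel_right]⟩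
      trans := by
        rintro γ γ' γ'' ⟨h, s, hs⟩ ⟨h', s', hs'⟩
        exact ⟨h.trans h', s' + s, fun t => by rw [hs', hs, add_assoc]⟩ }

/-- The `k`-fold iterate. -/
def ReebLoop.iterate (γ : ReebLoop G f ε) (k : ℕ+) : ReebLoop G f ε where
  period := (k : ℕ) * γ.period
  period_pos := mul_pos (by exact_mod_cast k.pos) γ.period_pos
  toFun := γ.toFun
  periodic := γ.periodic.nat_mul k
  exists_lift := γ.exists_lift

/-- The set `𝒫(λ_{G,ε})` of Reeb orbits of `λ_{G,ε}`, up to reparametrization. -/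
def ReebOrbit (G : Subgroup SU2) (f : S2 → ℝ) (ε : ℝ) := Quotient (ReebLoop.setoid G f ε)

namespace ReebOrbit

/-- The loop `l` is a parametrization of the orbit `γ`. -/
def IsParam (γ : ReebOrbit G f ε) (l : ReebLoop G f ε) : Prop := Quotient.mk _ l = γ

/-- The action `∫_γ λ_{G,ε}` of an orbit, which is its period. -/
def action (γ : ReebOrbit G f ε) : ℝ :=
  Quotient.lift ReebLoop.period (fun _ _ (h : _ ∧ _) => h.1) γ

/-- The `k`-fold iterate `γ^k`. -/
def iterate (γ : ReebOrbit G f ε) (k : ℕ+) : ReebOrbit G f ε :=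
  Quotient.map (fun l => l.iterate k)
    (fun _ _ (h : _ ∧ _) => ⟨congrArg (((k : ℕ) : ℝ) * ·) h.1, h.2⟩) γ

/-- `γ : ℝ/Tℤ → S³/G` is injective. -/
def IsEmbedded (γ : ReebOrbit G f ε) : Prop :=
  ∀ l, γ.IsParam l → ∀ s t, l.toFun s = l.toFun t → ∃ n : ℤ, s - t = n * l.period

/-- `γ` projects to the point `q` of `S²/H`. -/
def ProjectsTo (γ : ReebOrbit G f ε) (q : BaseQuotient G) : Prop :=
  ∀ l, γ.IsParam l → ∀ t, seifert G (l.toFun t) = q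

/-- `γ` is nondegenerate: `1` is not an eigenvalue of the linearized return map. -/
def IsNondegenerate (γ : ReebOrbit G f ε) : Prop :=
  ∀ l, γ.IsParam l → ∀ z, proj G z = l.toFun 0 →
    (1 : ℝ) ∉ spectrum ℝ (flowMatrix f ε z l.period)

/-- `γ` is negative hyperbolic: the eigenvalues of the linearized return map are negative reals. -/
def IsNegativeHyperbolic (γ : ReebOrbit G f ε) : Prop :=
  ∀ l, γ.IsParam l → ∀ z, proj G z = l.toFun 0 →
    ∀ μ ∈ spectrum ℂ ((flowMatrix f ε z l.period).map (fun x : ℝ => (x : ℂ))),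
      ∃ r : ℝ, r < 0 ∧ μ = r

/-- `γ` is bad: it is an even iterate of a negative hyperbolic orbit. -/
def IsBad (γ : ReebOrbit G f ε) : Prop :=
  ∃ (β : ReebOrbit G f ε) (k : ℕ+), β.IsNegativeHyperbolic ∧ γ = β.iterate (2 * k)

/-- `γ` is good: it is not bad. -/
def IsGood (γ : ReebOrbit G f ε) : Prop := ¬ γ.IsBad

/-- The Conley-Zehnder index of `γ` with respect to the global frame is `μ` (whichever
parametrization, and whichever lift of the starting point to `S³`, it is computed from). -/
def HasCZIndex (γ : ReebOrbit G f ε) (μ : ℤ) : Prop :=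
  ∀ l, γ.IsParam l → ∀ z, proj G z = l.toFun 0 → czIndex (flowMatrix f ε z) l.period = μ

/-- The degree `|γ| = μ_CZ(γ) - 1` equals `i`. -/
def HasDegree (γ : ReebOrbit G f ε) (i : ℤ) : Prop := γ.HasCZIndex (i + 1)

end ReebOrbit

/-- The Reeb orbits of action less than `L` and degree `i`. -/
def orbitsOfDegree (G : Subgroup SU2) (f : S2 → ℝ) (ε L : ℝ) (i : ℤ) : Set (ReebOrbit G f ε) :=
  {γ | γ.action < L ∧ γ.HasDegree i}

/-! ### Polyhedra and binary polyhedral groups -/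

inductive Polyhedron
  | tetrahedron
  | octahedron
  | icosahedron

/-- Vertices of a regular tetrahedron, octahedron, icosahedron centered at the origin. -/
def Polyhedron.vertices : Polyhedron → Set E3
  | .tetrahedron => {!₂[1, 1, 1], !₂[1, -1, -1], !₂[-1, 1, -1], !₂[-1, -1, 1]}
  | .octahedron => {!₂[1, 0, 0], !₂[-1, 0, 0], !₂[0, 1, 0], !₂[0, -1, 0], !₂[0, 0, 1], !₂[0, 0, -1]}
  | .icosahedron => {v | ∃ a b : ℝ, a ^ 2 = 1 ∧ b ^ 2 = 1 ∧
      (v = !₂[0, a, b * Real.goldenRatio] ∨ v = !₂[a, b * Real.goldenRatio, 0] ∨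
        v = !₂[b * Real.goldenRatio, 0, a])}

/-- Two vertices span an edge when they are distinct and at minimal distance. -/
def Polyhedron.Adj (Q : Polyhedron) (v w : E3) : Prop :=
  v ∈ Q.vertices ∧ w ∈ Q.vertices ∧ v ≠ w ∧
    ∀ v' ∈ Q.vertices, ∀ w' ∈ Q.vertices, v' ≠ w' → dist v w ≤ dist v' w'

/-- Midpoints of the edges. -/
def Polyhedron.edgeMidpoints (Q : Polyhedron) : Set E3 :=
  {x | ∃ v w, Q.Adj v w ∧ x = (2 : ℝ)⁻¹ • (v + w)}

/-- Barycenters of the (triangular) faces. -/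
def Polyhedron.faceBarycenters (Q : Polyhedron) : Set E3 :=
  {x | ∃ u v w, Q.Adj u v ∧ Q.Adj v w ∧ Q.Adj u w ∧ x = (3 : ℝ)⁻¹ • (u + v + w)}

/-- The image of a set under the radial projection `ℝ³ ∖ {0} → S²`. -/
def radialImage (X : Set E3) : Set S2 := {p | ∃ r : ℝ, 0 < r ∧ r • (p : E3) ∈ X}

/-- Vertex points of the polyhedron, inscribed in `S²` and rotated by `ρ`. -/
def vertexPoints (Q : Polyhedron) (ρ : SO3) : Set S2 := ρ • radialImage Q.vertices

/-- Edge points of the inscribed polyhedron rotated by `ρ`. -/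
def edgePoints (Q : Polyhedron) (ρ : SO3) : Set S2 := ρ • radialImage Q.edgeMidpoints

/-- Face points of the inscribed polyhedron rotated by `ρ`. -/
def facePoints (Q : Polyhedron) (ρ : SO3) : Set S2 := ρ • radialImage Q.faceBarycenters

/-- The group of rotational symmetries of the inscribed polyhedron rotated by `ρ`. -/
def rotationGroup (Q : Polyhedron) (ρ : SO3) : Subgroup SO3 :=
  MulAction.stabilizer SO3 (vertexPoints Q ρ)

/-- The binary polyhedral group: the preimage in `SU(2)` of the rotation group. For fixed `Q` and
varying `ρ` these are exactly the conjugates of `T*`, `O*`, `I*` respectively. -/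
def binaryGroup (Q : Polyhedron) (ρ : SO3) : Subgroup SU2 := (rotationGroup Q ρ).comap cover

/-- The order of the isotropy group of a vertex in the rotation group. -/
def Polyhedron.vertexOrder : Polyhedron → ℕ
  | .tetrahedron => 3
  | .octahedron => 4
  | .icosahedron => 5

/-! ### The Morse function -/

theorem stereo_mem (x y : ℝ) :
    ((1 + x ^ 2 + y ^ 2)⁻¹ • !₂[2 * x, 2 * y, 1 - x ^ 2 - y ^ 2] : E3)
      ∈ Metric.sphere (0 : E3) 1 := by
  have h : 0 < 1 + x ^ 2 + y ^ 2 := by positivity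
  rw [mem_sphere_zero_iff_norm, ← sq_eq_sq₀ (norm_nonneg _) zero_le_one,
    EuclideanSpace.norm_sq_eq]
  simp only [Fin.sum_univ_three, Real.norm_eq_abs, sq_abs, PiLp.smul_apply, smul_eq_mul]
  simp
  field_simp
  ring

/-- Stereographic coordinates at the north pole `(0,0,1)`. -/
def stereo (x y : ℝ) : S2 := ⟨_, stereo_mem x y⟩

/-- In suitable stereographic coordinates at `p` (those at the north pole, followed by a rotation
taking the north pole to `p`) the function `f` equals `q` near the origin. -/
def HasLocalForm (f : S2 → ℝ) (p : S2) (q : ℝ → ℝ → ℝ) : Prop :=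
  ∃ R : SO3, R • stereo 0 0 = p ∧
    ∀ᶠ u : ℝ × ℝ in 𝓝 (0, 0), f (R • stereo u.1 u.2) = q u.1 u.2

/-- The critical points of a function on `S²`. -/
def criticalPoints (f : S2 → ℝ) : Set S2 := {p | mfderiv (𝓡 2) 𝓘(ℝ, ℝ) f p = 0}

/-- `f` is a smooth function on `S²`, invariant under the rotation group of the polyhedron, whose
critical points are the vertex, edge and face points, and which has the standard forms of a minimum
of value `-1`, a saddle of value `0`, a maximum of value `1` at these points. (Its critical points
are nondegenerate, and all saddles lie at one level, so `f` is Morse-Smale.) -/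
structure IsPolyhedralMorse (Q : Polyhedron) (ρ : SO3) (f : S2 → ℝ) : Prop where
  smooth : ContMDiff (𝓡 2) 𝓘(ℝ, ℝ) ∞ f
  invariant : ∀ h ∈ rotationGroup Q ρ, ∀ p, f (h • p) = f p
  critical : criticalPoints f = vertexPoints Q ρ ∪ edgePoints Q ρ ∪ facePoints Q ρ
  vertex : ∀ p ∈ vertexPoints Q ρ, HasLocalForm f p fun x y => (x ^ 2 + y ^ 2) / 2 - 1
  edge : ∀ p ∈ edgePoints Q ρ, HasLocalForm f p fun x y => (x ^ 2 - y ^ 2) / 2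
  face : ∀ p ∈ facePoints Q ρ, HasLocalForm f p fun x y => 1 - (x ^ 2 + y ^ 2) / 2

end PolyhedralReeb

end

open PolyhedralReeb

noncomputable section

namespace PolyhedralReeb

/-! ### The polarised Hopf map and Clifford multiplication -/

/-! Write g = 1 + ε f∘𝔓. On S³ the Reeb field of gλ is i(g⁻¹ z − ε g⁻² ∇f·z), where ℝ³ acts on ℂ² by
traceless Hermitian matrices (`pauliMul`): a Hopf rotation at speed 1/g plus a term of size ε that
projects to a Hamiltonian field of f on S². It extends to a compactly supported field on ℂ², so the
flow is global; it conserves f∘𝔓 and commutes with G.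

Localisation. A closed orbit of period T in S³/G lifts to a curve with c(t + T) = A c(t) for some A
in G, so its image in S² closes up after time |G|T. That image follows a multiple of size ε of one
fixed Lipschitz field, and a Lipschitz field has no nonconstant closed orbit of small period
(`eq_zero_of_periodic_of_small`). Hence for small ε every orbit of action below L lies over a
critical point. Conversely, Hopf fibres over critical points are Reeb orbits. If the isotropy group
in ℙ has order n, its preimage in G acts on the fibre as the 2n-th roots of unity
(`exists_smul_eq_phase_iff`), so the simple orbit has action πg/n (`exists_isSimpleOrbitOver`). The
polyhedra enter only through `polyhedron_orbits`: vertices, edges and faces are single ℙ-orbits with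
isotropy orders I_V, 2 and 3.

Indices. After multiplication by e^{-it/g} a point over a critical point becomes an equilibrium, and
the linearised flow becomes exp(tB) with B read off from the Hessian
(`hasFDerivWithinAt_flow_of_equilibrium`). The frame V₁, V₂ turns against the Hopf flow, so in this
frame the linearised flow is a rotation by 2t/g composed with exp(tB). At an extremum this is again
a rotation, of slightly less (minimum) or slightly more (maximum) than k/n turns for the k-th
iterate, whence the ceiling and the floor. At a saddle exp(tB) is hyperbolic with positive
eigenvalues and the rotation makes k half-turns, which gives index k.

Counting. Conjugacy classes are counted through commuting pairs: an element of G other than ±1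
covers a rotation with exactly two fixed points. These are critical points of f, and the stabilizer
of each is the centralizer of the element. In degree 2j one finds I_V iterates of 𝒱, one of ℰ and
three of ℱ, except that the bottom degree misses the absent 0-th iterate of ℱ and the top degree
misses the 2N·I_V-th iterate of 𝒱; odd degrees contain one even iterate of ℰ. -/

/-- The symmetric real bilinear map whose diagonal is the Hopf map. -/
def hopfBilin : C2 →L[ℝ] C2 →L[ℝ] E3 :=
  LinearMap.toContinuousBilinearMap <|
    LinearMap.mk₂ ℝ (fun z w => (!₂[(star (z 0) * w 0).re - (star (z 1) * w 1).re,
      -(star (z 0) * w 1).im - (star (w 0) * z 1).im,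
      -(star (z 0) * w 1).re - (star (w 0) * z 1).re] : E3))
    (by intros; ext i; fin_cases i <;> simp <;> ring)
    (by intros; ext i; fin_cases i <;> simp <;> ring)
    (by intros; ext i; fin_cases i <;> simp <;> ring)
    (by intros; ext i; fin_cases i <;> simp <;> ring)

/-- The action of `ℝ³`, as the traceless Hermitian matrices, on `ℂ²`. -/
def pauliMul : E3 →L[ℝ] C2 →L[ℝ] C2 :=
  LinearMap.toContinuousBilinearMap <|
    LinearMap.mk₂ ℝ (fun y z => (!₂[(y 0 : ℂ) * z 0 + (Complex.I * y 1 - y 2) * z 1,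
      (-Complex.I * y 1 - y 2) * z 0 - y 0 * z 1] : C2))
    (by intros; ext i; fin_cases i <;> simp <;> ring)
    (by intros; ext i; fin_cases i <;> simp <;> ring)
    (by intros; ext i; fin_cases i <;> simp <;> ring)
    (by intros; ext i; fin_cases i <;> simp <;> ring)

theorem hopfBilin_apply (z w : C2) :
    hopfBilin z w = !₂[(star (z 0) * w 0).re - (star (z 1) * w 1).re,
      -(star (z 0) * w 1).im - (star (w 0) * z 1).im,
      -(star (z 0) * w 1).re - (star (w 0) * z 1).re] := rfl

theorem pauliMul_apply (y : E3) (z : C2) :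
    pauliMul y z = !₂[(y 0 : ℂ) * z 0 + (Complex.I * y 1 - y 2) * z 1,
      (-Complex.I * y 1 - y 2) * z 0 - y 0 * z 1] := rfl

theorem inner_C2 (z w : C2) : inner ℂ z w = star (z 0) * w 0 + star (z 1) * w 1 := by
  simp [PiLp.inner_apply, Fin.sum_univ_two, mul_comm]

theorem inner_E3 (x y : E3) : inner ℝ x y = x 0 * y 0 + x 1 * y 1 + x 2 * y 2 := by
  simp [PiLp.inner_apply, Fin.sum_univ_three, mul_comm]

theorem hopfBilin_symm (z w : C2) : hopfBilin z w = hopfBilin w z := by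
  rw [hopfBilin_apply, hopfBilin_apply]
  ext i
  fin_cases i <;> simp <;> ring

theorem hopf_eq_hopfBilin (z : S3) : (hopf z : E3) = hopfBilin z z := by
  rw [hopfBilin_apply]
  ext i
  fin_cases i <;> simp [hopf, Complex.normSq_apply] <;> ring

theorem norm_hopfBilin_self (z : C2) : ‖hopfBilin z z‖ = ‖z‖ ^ 2 := by
  rw [← sq_eq_sq₀ (norm_nonneg _) (by positivity), EuclideanSpace.norm_sq_eq,
    EuclideanSpace.norm_sq_eq, hopfBilin_apply]
  simp [Fin.sum_univ_three, Fin.sum_univ_two, ← Complex.normSq_eq_norm_sq, Complex.normSq_apply]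
  ring

/-- The function z ↦ ⟨hopf z, y⟩ has derivative 2⟨`hopfBilin z v`, y⟩, so `pauliMul y z` is half its
gradient. This adjointness turns gradients on S² into vectors of ℂ². -/
theorem inner_hopfBilin (z v : C2) (y : E3) :
    inner ℝ (hopfBilin z v) y = (inner ℂ v (pauliMul y z)).re := by
  rw [inner_E3, inner_C2, hopfBilin_apply, pauliMul_apply]
  simp
  ring

theorem inner_pauliMul_self (z : C2) (y : E3) :
    inner ℂ z (pauliMul y z) = ((inner ℝ (hopfBilin z z) y : ℝ) : ℂ) := by
  rw [inner_E3, inner_C2, hopfBilin_apply, pauliMul_apply]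
  apply Complex.ext
  · simp
    ring
  · simp
    ring

/-- The cross product of `ℝ³`. -/
def cross (x y : E3) : E3 := WithLp.toLp 2 (x.ofLp ⨯₃ y.ofLp)

theorem cross_apply' (x y : E3) :
    cross x y = !₂[x 1 * y 2 - x 2 * y 1, x 2 * y 0 - x 0 * y 2, x 0 * y 1 - x 1 * y 0] := by
  rw [cross, cross_apply]

/-- Since i times a traceless Hermitian matrix lies in 𝔰𝔲(2), this is the infinitesimal equivariance
of the Hopf map. The cross product in the Hamiltonian field on S² comes from here. -/
theorem hopfBilin_I_pauliMul (z : C2) (y : E3) :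
    hopfBilin z (Complex.I • pauliMul y z) = cross y (hopfBilin z z) := by
  rw [cross_apply', hopfBilin_apply, hopfBilin_apply, pauliMul_apply]
  ext i
  fin_cases i <;> simp <;> ring

theorem hopfBilin_smul_smul (c d : ℂ) (z w : C2) :
    hopfBilin (c • z) (d • w) = hopfBilin z ((star c * d) • w) := by
  rw [hopfBilin_apply, hopfBilin_apply]
  ext i
  fin_cases i <;> simp <;> ring

theorem hopfBilin_I_smul_self (z : C2) : hopfBilin z (Complex.I • z) = 0 := by
  rw [hopfBilin_apply]
  ext i
  fin_cases i <;> simp <;> ring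

theorem pauliMul_smul (y : E3) (c : ℂ) (z : C2) : pauliMul y (c • z) = c • pauliMul y z := by
  rw [pauliMul_apply, pauliMul_apply]
  ext i
  fin_cases i <;> simp <;> ring

theorem hasFDerivAt_hopfBilin_self (z : C2) :
    HasFDerivAt (fun x => hopfBilin x x) ((2 : ℝ) • hopfBilin z) z := by
  have h := hopfBilin.hasFDerivAt_of_bilinear (hasFDerivAt_id z) (hasFDerivAt_id z)
  refine h.congr_fderiv ?_
  ext1 v
  simp [two_smul, hopfBilin_symm v z]

theorem contDiff_hopfBilin_self {n : WithTop ℕ∞} : ContDiff ℝ n fun z => hopfBilin z z := by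
  fun_prop

/-! ### Stars, norms and the frame on the sphere -/

theorem norm_S3 (z : S3) : ‖(z : C2)‖ = 1 := mem_sphere_zero_iff_norm.1 z.2

theorem norm_S2 (p : S2) : ‖(p : E3)‖ = 1 := mem_sphere_zero_iff_norm.1 p.2

theorem inner_self_S3 (z : S3) : inner ℂ (z : C2) z = 1 := by
  rw [inner_self_eq_norm_sq_to_K, norm_S3]; simp

theorem S3_star_mul (z : S3) : star (z.1 0) * z.1 0 + star (z.1 1) * z.1 1 = 1 := by
  rw [← inner_C2, inner_self_S3]

theorem frame_zero (z : S3) : frame z 0 = !₂[-star (z.1 1), star (z.1 0)] := rfl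

theorem frame_one (z : S3) : frame z 1 = Complex.I • frame z 0 := rfl

theorem inner_frame_zero (z : S3) : inner ℂ (frame z 0) (frame z 0) = 1 := by
  rw [inner_C2, frame_zero, ← S3_star_mul z]
  simp
  ring

theorem inner_self_frame_zero (z : S3) : inner ℂ (z : C2) (frame z 0) = 0 := by
  rw [inner_C2, frame_zero]
  simp
  ring

theorem inner_frame_zero_self (z : S3) : inner ℂ (frame z 0) (z : C2) = 0 := by
  rw [← inner_conj_symm, inner_self_frame_zero, map_zero]

theorem frame_decomposition (z : S3) (v : C2) :
    v = inner ℂ (z : C2) v • (z : C2) + inner ℂ (frame z 0) v • frame z 0 := by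
  rw [inner_C2, inner_C2, frame_zero]
  have h := S3_star_mul z
  simp at h
  ext i
  fin_cases i
  · simp
    linear_combination (-v 0) * h
  · simp
    linear_combination (-v 1) * h

/-- The tangent vectors `hopfBilin z (frame z j)` of `S²`, an orthonormal frame of the tangent
plane at `hopf z`. -/
def baseFrame (z : S3) (j : Fin 2) : E3 := hopfBilin z (frame z j)

theorem inner_baseFrame (z : S3) (j : Fin 2) (y : E3) :
    inner ℝ (baseFrame z j) y = (inner ℂ (frame z j) (pauliMul y z)).re :=
  inner_hopfBilin _ _ _

/-- Tangency of `y` at `hopf z` makes the Hermitian product of `z` with y·z vanish, so y·z lies in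
the contact plane; adjointness identifies its coordinates. -/
theorem pauliMul_eq_frame (z : S3) (y : E3) (hy : inner ℝ (hopf z : E3) y = 0) :
    pauliMul y z = inner ℝ (baseFrame z 0) y • frame z 0 + inner ℝ (baseFrame z 1) y • frame z 1 := by
  have h := frame_decomposition z (pauliMul y z)
  rw [inner_pauliMul_self, ← hopf_eq_hopfBilin, hy] at h
  rw [inner_baseFrame, inner_baseFrame, frame_one, inner_smul_left]
  rw [h]
  simp only [inner_add_right, inner_smul_right, inner_frame_zero_self, inner_frame_zero]
  set w := inner ℂ (frame z 0) (pauliMul y z)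
  have h2 : ∀ (a : ℝ) (v : C2), a • v = (a : ℂ) • v := fun a v => by
    ext i; simp
  rw [h2, h2, smul_smul, ← add_smul]
  simp only [Complex.ofReal_zero, zero_smul, zero_add, mul_zero, mul_one]
  congr 1
  apply Complex.ext <;> simp

/-! ### The linear actions of `SU(2)` and `SO(3)` -/

section Linear
variable {𝕜 n : Type*} [RCLike 𝕜] [Fintype n] [DecidableEq n]

/-- The linear map given by an element of `SU(n)` or `SO(n)`. -/
def toLin (A : Matrix.specialUnitaryGroup n 𝕜) : EuclideanSpace 𝕜 n →L[𝕜] EuclideanSpace 𝕜 n :=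
  Matrix.toEuclideanCLM (𝕜 := 𝕜) A.1

theorem toLin_apply (A : Matrix.specialUnitaryGroup n 𝕜) (x : EuclideanSpace 𝕜 n) :
    toLin A x = WithLp.toLp 2 (A.1 *ᵥ x.ofLp) := rfl

theorem coe_smul_sphere (A : Matrix.specialUnitaryGroup n 𝕜)
    (x : Metric.sphere (0 : EuclideanSpace 𝕜 n) 1) :
    ((A • x : Metric.sphere (0 : EuclideanSpace 𝕜 n) 1) : EuclideanSpace 𝕜 n) = toLin A x := rfl

theorem toLin_mul (A B : Matrix.specialUnitaryGroup n 𝕜) (x : EuclideanSpace 𝕜 n) :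
    toLin (A * B) x = toLin A (toLin B x) := by
  simp [toLin_apply, Matrix.mulVec_mulVec]

theorem toLin_one (x : EuclideanSpace 𝕜 n) :
    toLin (1 : Matrix.specialUnitaryGroup n 𝕜) x = x := by
  simp [toLin_apply]

theorem toLin_inv_apply (A : Matrix.specialUnitaryGroup n 𝕜) (x : EuclideanSpace 𝕜 n) :
    toLin A⁻¹ (toLin A x) = x := by
  rw [← toLin_mul, inv_mul_cancel, toLin_one]

theorem toLin_apply_inv (A : Matrix.specialUnitaryGroup n 𝕜) (x : EuclideanSpace 𝕜 n) :
    toLin A (toLin A⁻¹ x) = x := by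
  rw [← toLin_mul, mul_inv_cancel, toLin_one]

theorem norm_toLin (A : Matrix.specialUnitaryGroup n 𝕜) (x : EuclideanSpace 𝕜 n) :
    ‖toLin A x‖ = ‖x‖ := norm_mulVec A x

/-- The linear isometry given by an element of `SU(n)` or `SO(n)`. -/
def toIsom (A : Matrix.specialUnitaryGroup n 𝕜) : EuclideanSpace 𝕜 n →ₗᵢ[𝕜] EuclideanSpace 𝕜 n :=
  ⟨(toLin A).toLinearMap, norm_toLin A⟩

theorem inner_toLin (A : Matrix.specialUnitaryGroup n 𝕜) (x y : EuclideanSpace 𝕜 n) :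
    inner 𝕜 (toLin A x) (toLin A y) = inner 𝕜 x y := (toIsom A).inner_map_map x y

end Linear

theorem toLin_SU2 (A : SU2) (v : C2) :
    toLin A v = !₂[A.1 0 0 * v 0 - star (A.1 1 0) * v 1, A.1 1 0 * v 0 + star (A.1 0 0) * v 1] := by
  rw [toLin_apply]
  ext i
  fin_cases i <;>
    simp [Matrix.mulVec, dotProduct, Fin.sum_univ_two, (SU2.entries A).1, (SU2.entries A).2,
      sub_eq_add_neg]

theorem hopfBilin_toLin (A : SU2) (z v : C2) :
    hopfBilin (toLin A z) (toLin A v) = toLin (cover A) (hopfBilin z v) := by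
  rw [toLin_SU2, toLin_SU2, toLin_apply, hopfBilin_apply, hopfBilin_apply]
  change _ = WithLp.toLp 2 (coverMatrix (A.1 0 0) (A.1 1 0) *ᵥ _)
  ext i
  fin_cases i <;>
    simp [coverMatrix, Matrix.mulVec, dotProduct, Fin.sum_univ_three, Complex.normSq_apply,
      pow_two] <;> ring

/-- The element of `SU(2)` with first column `z`. -/
def toSU2 (z : S3) : SU2 :=
  ⟨!![z.1 0, -star (z.1 1); z.1 1, star (z.1 0)], by
    have h := S3_star_mul z
    rw [Matrix.mem_specialUnitaryGroup_iff, Matrix.mem_unitaryGroup_iff]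
    simp at h
    constructor
    · ext i j
      fin_cases i <;> fin_cases j <;> simp [Matrix.mul_apply, Fin.sum_univ_two] <;>
        first
          | linear_combination h
          | ring
    · rw [Matrix.det_fin_two]
      simp
      linear_combination h⟩

/-- The point `(1, 0)` of `S³`. -/
def baseS3 : S3 := ⟨!₂[1, 0], by simp [EuclideanSpace.norm_eq]⟩

theorem toSU2_smul (z : S3) : toSU2 z • baseS3 = z := by
  apply Subtype.ext
  rw [coe_smul_sphere, toLin_SU2]
  ext i
  fin_cases i <;> simp [toSU2, baseS3]

theorem eq_one_of_smul_baseS3 (A : SU2) (h : A • baseS3 = baseS3) : A = 1 := by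
  have h1 := congrArg Subtype.val h
  rw [coe_smul_sphere, toLin_SU2] at h1
  have h0 := congrArg (fun v : C2 => v 0) h1
  have h2 := congrArg (fun v : C2 => v 1) h1
  simp [baseS3] at h0 h2
  apply Subtype.ext
  ext i j
  fin_cases i <;> fin_cases j <;> simp [(SU2.entries A).1, (SU2.entries A).2, h0, h2]

theorem eq_one_of_smul_S3 (A : SU2) (z : S3) (h : A • z = z) : A = 1 := by
  rw [← toSU2_smul z, ← mul_smul, ← inv_smul_eq_iff, ← mul_smul] at h
  have := eq_one_of_smul_baseS3 _ h
  rw [← mul_assoc] at this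
  have h2 : A * toSU2 z = toSU2 z := by
    rw [mul_assoc] at this
    exact (inv_mul_eq_one.1 this).symm
  exact mul_eq_right.1 h2

/-! ### The Hopf action -/

/-- The Hopf action `z ↦ e^{iθ} z`. -/
def phase (θ : ℝ) (z : S3) : S3 :=
  ⟨Complex.exp (θ * Complex.I) • (z : C2), by
    rw [mem_sphere_zero_iff_norm, norm_smul, Complex.norm_exp_ofReal_mul_I, norm_S3, one_mul]⟩

theorem coe_phase (θ : ℝ) (z : S3) : (phase θ z : C2) = Complex.exp (θ * Complex.I) • (z : C2) :=
  rfl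

theorem phase_add (θ φ : ℝ) (z : S3) : phase (θ + φ) z = phase θ (phase φ z) := by
  apply Subtype.ext
  rw [coe_phase, coe_phase, coe_phase, smul_smul, ← Complex.exp_add]
  push_cast
  rw [add_mul]

theorem phase_zero (z : S3) : phase 0 z = z := by
  apply Subtype.ext
  simp [coe_phase]

theorem phase_smul (A : SU2) (θ : ℝ) (z : S3) : A • phase θ z = phase θ (A • z) := by
  apply Subtype.ext
  rw [coe_smul_sphere, coe_phase, map_smul, coe_phase, coe_smul_sphere]

theorem hopf_phase (θ : ℝ) (z : S3) : hopf (phase θ z) = hopf z := by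
  apply Subtype.ext
  rw [hopf_eq_hopfBilin, hopf_eq_hopfBilin, coe_phase, hopfBilin_smul_smul]
  have : star (Complex.exp (θ * Complex.I)) * Complex.exp (θ * Complex.I) = 1 := by
    have h := Complex.norm_exp_ofReal_mul_I θ
    have := Complex.conj_mul' (Complex.exp (θ * Complex.I))
    rw [h] at this
    simpa using this
  rw [this, one_smul]

theorem phase_eq_self_iff (θ : ℝ) (z : S3) : phase θ z = z ↔ Complex.exp (θ * Complex.I) = 1 := by
  constructor
  · intro h
    have h1 := congrArg (fun w : S3 => inner ℂ (z : C2) (w : C2)) h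
    simpa [coe_phase, inner_smul_right, inner_self_S3, norm_S3] using h1
  · intro h
    apply Subtype.ext
    rw [coe_phase, h, one_smul]

/-- The identity 2|⟨`frame z 0`, w⟩|² = |z|²|w|² − ⟨hopf z, hopf w⟩ measures how far `w` is from the
complex line of `z`; equal images make it zero. -/
theorem exists_phase_of_hopf_eq (z w : S3) (h : hopf w = hopf z) : ∃ θ, w = phase θ z := by
  have h1 : inner ℂ (frame z 0) (w : C2) = 0 := by
    have e : 2 * Complex.normSq (inner ℂ (frame z 0) (w : C2))
        = ‖(z : C2)‖ ^ 2 * ‖(w : C2)‖ ^ 2 - inner ℝ (hopf z : E3) (hopf w) := by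
      rw [hopf_eq_hopfBilin, hopf_eq_hopfBilin, inner_E3, inner_C2, frame_zero,
        EuclideanSpace.norm_sq_eq, EuclideanSpace.norm_sq_eq, hopfBilin_apply, hopfBilin_apply]
      simp [Fin.sum_univ_two, ← Complex.normSq_eq_norm_sq, Complex.normSq_apply]
      ring
    rw [h, real_inner_self_eq_norm_sq, norm_S2, norm_S3, norm_S3] at e
    have : Complex.normSq (inner ℂ (frame z 0) (w : C2)) = 0 := by linarith
    exact Complex.normSq_eq_zero.1 this
  have h2 := frame_decomposition z (w : C2)
  rw [h1, zero_smul, add_zero] at h2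
  have h3 : ‖inner ℂ (z : C2) (w : C2)‖ = 1 := by
    have := congrArg norm h2
    rw [norm_smul, norm_S3, norm_S3, mul_one] at this
    exact this.symm
  refine ⟨Complex.arg (inner ℂ (z : C2) (w : C2)), Subtype.ext ?_⟩
  rw [coe_phase]
  nth_rw 1 [h2]
  congr 1
  have := Complex.norm_mul_exp_arg_mul_I (inner ℂ (z : C2) (w : C2))
  rw [h3] at this
  simpa using this.symm

theorem hopf_eq_iff (z w : S3) : hopf w = hopf z ↔ ∃ θ, w = phase θ z :=
  ⟨exists_phase_of_hopf_eq z w, by rintro ⟨θ, rfl⟩; exact hopf_phase θ z⟩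

theorem hopf_surjective : Function.Surjective hopf := by
  rintro ⟨p, hp⟩
  have h : ‖p‖ ^ 2 = 1 := by rw [mem_sphere_zero_iff_norm.1 hp]; norm_num
  rw [EuclideanSpace.norm_sq_eq] at h
  simp [Fin.sum_univ_three] at h
  by_cases hx : p 0 = -1
  · have h1 : p 1 = 0 := by nlinarith [sq_nonneg (p 1), sq_nonneg (p 2)]
    have h2 : p 2 = 0 := by nlinarith [sq_nonneg (p 1), sq_nonneg (p 2)]
    refine ⟨⟨!₂[0, 1], by simp [EuclideanSpace.norm_eq]⟩, Subtype.ext ?_⟩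
    ext i
    fin_cases i <;> simp [hopf, hx, h1, h2]
  -- Away from (-1, 0, 0), normalise the phase so that α = a > 0: then |α|² = (1 + p₀)/2, and β is
  -- forced by p₁ and p₂.
  · have hx1 : 0 < 1 + p 0 := by
      have : -1 ≤ p 0 := by nlinarith [sq_nonneg (p 1), sq_nonneg (p 2)]
      rcases this.lt_or_eq with h | h
      · linarith
      · exact absurd h.symm hx
    set a := Real.sqrt ((1 + p 0) / 2) with ha
    have ha2 : a ^ 2 = (1 + p 0) / 2 := Real.sq_sqrt (by positivity)
    have ha0 : 0 < a := Real.sqrt_pos.2 (by positivity)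
    have hm : (!₂[(a : ℂ), (⟨-p 2 / (2 * a), -p 1 / (2 * a)⟩ : ℂ)] : C2)
        ∈ Metric.sphere (0 : C2) 1 := by
      rw [mem_sphere_zero_iff_norm, ← sq_eq_sq₀ (norm_nonneg _) zero_le_one,
        EuclideanSpace.norm_sq_eq]
      simp [Fin.sum_univ_two, ← Complex.normSq_eq_norm_sq, Complex.normSq_apply]
      field_simp
      nlinarith [h, ha2]
    refine ⟨⟨_, hm⟩, Subtype.ext ?_⟩
    ext i
    fin_cases i
    · simp [hopf, Complex.normSq_apply]
      field_simp
      nlinarith [h, ha2]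
    · simp [hopf]
      field_simp
    · simp [hopf]
      field_simp

theorem cover_smul_hopf_eq_iff (A : SU2) (z : S3) :
    cover A • hopf z = hopf z ↔ ∃ θ, A • z = phase θ z := by
  rw [← hopf_smul, hopf_eq_iff]

/-! ### The double cover is onto -/

/-- Every 3×3 matrix satisfies Mᵀ(Mx × My) = det M · (x × y); for a rotation Mᵀ is the inverse and
the determinant is 1. -/
theorem toLin_cross (R : SO3) (x y : E3) : toLin R (cross x y) = cross (toLin R x) (toLin R y) := by
  obtain ⟨h1, h2⟩ := Matrix.mem_specialOrthogonalGroup_iff.1 R.2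
  have h3 : R.1 * star R.1 = 1 := Matrix.mem_unitaryGroup_iff.1 h1
  have key : (star R.1) *ᵥ ((R.1 *ᵥ x.ofLp) ⨯₃ (R.1 *ᵥ y.ofLp)) = R.1.det • (x.ofLp ⨯₃ y.ofLp) := by
    rw [cross_apply, cross_apply, Matrix.det_fin_three]
    ext i
    fin_cases i <;>
      simp [Matrix.mulVec, dotProduct, Fin.sum_univ_three, Matrix.star_apply] <;> ring
  have := congrArg (fun v => R.1 *ᵥ v) key
  simp only [Matrix.mulVec_mulVec, h3, Matrix.one_mulVec, h2, one_smul] at this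
  rw [cross, cross, toLin_apply, ← this]
  rfl

/-- A rotation fixing x and y fixes x × y too, hence a basis: the matrix with these columns has
determinant |x × y|². -/
theorem eq_one_of_fixes (R : SO3) (x y : E3) (hx : toLin R x = x) (hy : toLin R y = y)
    (h : cross x y ≠ 0) : R = 1 := by
  have hz : toLin R (cross x y) = cross x y := by rw [toLin_cross, hx, hy]
  let N : Matrix (Fin 3) (Fin 3) ℝ := Matrix.of fun i j => ![x, y, cross x y] j i
  have hdet : N.det ≠ 0 := by
    have e : N.det = (cross x y 0) ^ 2 + (cross x y 1) ^ 2 + (cross x y 2) ^ 2 := by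
      rw [Matrix.det_fin_three, cross_apply']
      simp [N, cross_apply']
      ring
    rw [e]
    intro h0
    apply h
    have h1 : cross x y 0 = 0 := by
      nlinarith [sq_nonneg (cross x y 0), sq_nonneg (cross x y 1), sq_nonneg (cross x y 2)]
    have h2 : cross x y 1 = 0 := by
      nlinarith [sq_nonneg (cross x y 0), sq_nonneg (cross x y 1), sq_nonneg (cross x y 2)]
    have h3 : cross x y 2 = 0 := by
      nlinarith [sq_nonneg (cross x y 0), sq_nonneg (cross x y 1), sq_nonneg (cross x y 2)]
    ext i
    fin_cases i
    · exact h1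
    · exact h2
    · exact h3
  have hN : R.1 * N = N := by
    have hcol : ∀ v : E3, toLin R v = v → ∀ i, ∑ k, R.1 i k * v k = v i := by
      intro v hv i
      exact congrArg (fun w : E3 => w i) hv
    ext i j
    rw [Matrix.mul_apply]
    fin_cases j
    · exact hcol x hx i
    · exact hcol y hy i
    · exact hcol _ hz i
  apply Subtype.ext
  have hu : IsUnit N.det := isUnit_iff_ne_zero.2 hdet
  calc R.1 = R.1 * (N * N⁻¹) := by rw [Matrix.mul_nonsing_inv _ hu, mul_one]
    _ = N * N⁻¹ := by rw [← mul_assoc, hN]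
    _ = 1 := Matrix.mul_nonsing_inv _ hu

theorem hopf_baseS3 : (hopf baseS3 : E3) = !₂[1, 0, 0] := by
  ext i
  fin_cases i <;> simp [hopf, baseS3]

/-- Transitivity of SU(2) on S³ reduces to a rotation R' about the first axis. The diagonal matrix
with entries α and its conjugate covers the rotation whose cosine and sine are the real and
imaginary parts of α², so α is taken to be a square root. -/
theorem cover_surjective : Function.Surjective cover := by
  intro R
  obtain ⟨z, hz⟩ := hopf_surjective (R • hopf baseS3)
  set R' := (cover (toSU2 z))⁻¹ * R with hR'
  suffices h : ∃ A, cover A = R' by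
    obtain ⟨A, hA⟩ := h
    exact ⟨toSU2 z * A, by rw [map_mul, hA, hR', mul_inv_cancel_left]⟩
  have hfix : R' • hopf baseS3 = hopf baseS3 := by
    rw [hR', mul_smul, ← hz, inv_smul_eq_iff, ← hopf_smul, toSU2_smul]
  have hfix' : toLin R' !₂[1, 0, 0] = !₂[1, 0, 0] := by
    rw [← hopf_baseS3, ← coe_smul_sphere, hfix]
  have hentry : ∀ i, R'.1 i 0 = (!₂[1, 0, 0] : E3) i := by
    intro i
    have := congrArg (fun v : E3 => v i) hfix'
    simpa [toLin_apply, Matrix.mulVec, dotProduct, Fin.sum_univ_three] using this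
  have h00 : R'.1 0 0 = 1 := by simpa using hentry 0
  have h10 : R'.1 1 0 = 0 := by simpa using hentry 1
  have h20 : R'.1 2 0 = 0 := by simpa using hentry 2
  clear_value R'
  obtain ⟨h1, h2⟩ := Matrix.mem_specialOrthogonalGroup_iff.1 R'.2
  have h3 : R'.1 * star R'.1 = 1 := Matrix.mem_unitaryGroup_iff.1 h1
  have h4 : star R'.1 * R'.1 = 1 := Matrix.mem_unitaryGroup_iff'.1 h1
  -- Adjugate equal to transpose gives R₂₂ = R₁₁ and R₁₂ = −R₂₁: the remaining 2×2 block is a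
  -- rotation, not a reflection.
  have hadj : R'.1.adjugate = star R'.1 := by
    have := congrArg (fun X => R'.1.adjugate * X) h3
    simpa [← Matrix.mul_assoc, Matrix.adjugate_mul, h2] using this.symm
  have r00 := congrFun (congrFun h3 0) 0
  simp [Matrix.mul_apply, Fin.sum_univ_three, Matrix.star_apply, h00] at r00
  have h01 : R'.1 0 1 = 0 := by nlinarith [sq_nonneg (R'.1 0 1), sq_nonneg (R'.1 0 2)]
  have h02 : R'.1 0 2 = 0 := by nlinarith [sq_nonneg (R'.1 0 1), sq_nonneg (R'.1 0 2)]
  have c1 := congrFun (congrFun hadj 1) 1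
  have c2 := congrFun (congrFun hadj 1) 2
  simp [Matrix.adjugate_fin_three, Matrix.star_apply, h00, h01, h02, h10, h20] at c1 c2
  have r11 := congrFun (congrFun h3 1) 1
  simp [Matrix.mul_apply, Fin.sum_univ_three, Matrix.star_apply, h10] at r11
  obtain ⟨α, hα⟩ := IsAlgClosed.exists_pow_nat_eq (⟨R'.1 1 1, R'.1 2 1⟩ : ℂ) (n := 2) two_pos
  have hre := congrArg Complex.re hα
  have him := congrArg Complex.im hα
  simp only at hre him
  have hα1 : Complex.normSq α = 1 := by
    have e := congrArg Complex.normSq hα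
    rw [map_pow] at e
    have e2 : Complex.normSq (⟨R'.1 1 1, R'.1 2 1⟩ : ℂ) = 1 := by
      rw [Complex.normSq_mk, ← c2]
      linear_combination r11
    rw [e2] at e
    nlinarith [Complex.normSq_nonneg α]
  have hm : (!₂[α, 0] : C2) ∈ Metric.sphere (0 : C2) 1 := by
    rw [mem_sphere_zero_iff_norm, ← sq_eq_sq₀ (norm_nonneg _) zero_le_one,
      EuclideanSpace.norm_sq_eq]
    simp [Fin.sum_univ_two, ← Complex.normSq_eq_norm_sq, hα1]
  refine ⟨toSU2 ⟨_, hm⟩, Subtype.ext ?_⟩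
  change coverMatrix ((toSU2 ⟨_, hm⟩).1 0 0) ((toSU2 ⟨_, hm⟩).1 1 0) = R'.1
  ext i j
  fin_cases i <;> fin_cases j <;>
    simp [toSU2, coverMatrix, hα1, h00, h10, h20, h01, h02, hre, him] <;> linarith

theorem cover_eq_one_iff (A : SU2) : cover A = 1 ↔ ∀ z : S3, ∃ θ, A • z = phase θ z := by
  constructor
  · intro h z
    rw [← cover_smul_hopf_eq_iff, h, one_smul]
  · intro h
    have hp : ∀ p : S2, toLin (cover A) (p : E3) = p := by
      intro p
      obtain ⟨z, rfl⟩ := hopf_surjective p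
      rw [← coe_smul_sphere, (cover_smul_hopf_eq_iff A z).2 (h z)]
    refine eq_one_of_fixes _ (!₂[1, 0, 0]) (!₂[0, 1, 0])
      (hp ⟨_, by simp [EuclideanSpace.norm_eq, Fin.sum_univ_three]⟩)
      (hp ⟨_, by simp [EuclideanSpace.norm_eq, Fin.sum_univ_three]⟩) ?_
    intro h0
    have := congrArg (fun v : E3 => v 2) h0
    simp [cross_apply'] at this

/-! ### Functions on `S²` as functions on `ℝ³` -/

instance factFinrankE3 : Fact (Module.finrank ℝ E3 = 2 + 1) := ⟨by simp⟩

theorem radialExtension_of_ne {E F : Type*} [NormedAddCommGroup E] [NormedSpace ℝ E] [Zero F]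
    (g : Metric.sphere (0 : E) 1 → F) {x : E} (hx : x ≠ 0) :
    radialExtension g x = g ⟨‖x‖⁻¹ • x, by simp [norm_smul, hx]⟩ := by
  rw [radialExtension, dif_pos hx]

theorem radialExtension_coe {E F : Type*} [NormedAddCommGroup E] [NormedSpace ℝ E] [Zero F]
    (g : Metric.sphere (0 : E) 1 → F) (p : Metric.sphere (0 : E) 1) :
    radialExtension g (p : E) = g p := by
  have h : ‖(p : E)‖ = 1 := mem_sphere_zero_iff_norm.1 p.2
  have h0 : (p : E) ≠ 0 := by
    intro h0
    rw [h0, norm_zero] at h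
    exact zero_ne_one h
  rw [radialExtension_of_ne g h0]
  congr 1
  apply Subtype.ext
  simp [h]

/-- Radial projection is singular at the origin. Normalising x₀ + φ(x)(x − x₀), with φ a bump
supported within ‖x₀‖/2 of x₀, gives a map smooth on all of ℝ³ that agrees with it near x₀.
Composition with it carries smoothness of `f` on the manifold over to the extension of `f`. -/
theorem exists_smooth_retraction {x₀ : E3} (hx₀ : x₀ ≠ 0) :
    ∃ S : E3 → S2, ContMDiff 𝓘(ℝ, E3) (𝓡 2) ∞ S ∧
      ∀ᶠ x in 𝓝 x₀, x ≠ 0 ∧ (S x : E3) = ‖x‖⁻¹ • x := by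
  have hn : 0 < ‖x₀‖ := norm_pos_iff.2 hx₀
  let φ : ContDiffBump x₀ := ⟨‖x₀‖ / 4, ‖x₀‖ / 2, by positivity, by linarith⟩
  let u : E3 → E3 := fun x => x₀ + φ x • (x - x₀)
  have hu0 : ∀ x, u x ≠ 0 := by
    intro x h0
    have h1 : ‖φ x • (x - x₀)‖ = ‖x₀‖ := by
      rw [← norm_neg, ← eq_neg_of_add_eq_zero_left h0]
    rw [norm_smul, Real.norm_of_nonneg φ.nonneg] at h1
    by_cases hx : ‖x - x₀‖ < ‖x₀‖ / 2
    · have := mul_le_of_le_one_left (norm_nonneg (x - x₀)) (φ.le_one (x := x))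
      linarith
    · have : φ x = 0 := φ.zero_of_le_dist (by rw [dist_eq_norm]; exact not_lt.1 hx)
      rw [this, zero_mul] at h1
      exact hn.ne h1
  have hus : ContDiff ℝ ∞ u := by
    have : ContDiff ℝ ∞ φ := φ.contDiff
    fun_prop
  have hv : ContDiff ℝ ∞ fun x => ‖u x‖⁻¹ • u x := by
    have hnorm : ContDiff ℝ ∞ fun x => ‖u x‖ :=
      contDiff_iff_contDiffAt.2 fun x => (hus.contDiffAt).norm ℝ (hu0 x)
    exact (hnorm.inv fun x => norm_ne_zero_iff.2 (hu0 x)).smul hus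
  have hmem : ∀ x, ‖u x‖⁻¹ • u x ∈ Metric.sphere (0 : E3) 1 := fun x => by
    simp [norm_smul, hu0 x]
  refine ⟨_, hv.contMDiff.codRestrict_sphere hmem, ?_⟩
  have hφ : ∀ᶠ x in 𝓝 x₀, φ x = 1 := φ.eventuallyEq_one
  filter_upwards [hφ, isOpen_ne.mem_nhds hx₀] with x hx hx0
  have : u x = x := by simp only [u, hx, one_smul, add_sub_cancel]
  exact ⟨hx0, by rw [Set.val_codRestrict_apply, this]⟩

theorem radialExtension_eventuallyEq_comp (f : S2 → ℝ) {x₀ : E3} {S : E3 → S2}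
    (hS : ∀ᶠ x in 𝓝 x₀, x ≠ 0 ∧ (S x : E3) = ‖x‖⁻¹ • x) :
    radialExtension f =ᶠ[𝓝 x₀] f ∘ S := by
  filter_upwards [hS] with x hx
  rw [radialExtension_of_ne f hx.1, Function.comp]
  congr 1
  exact Subtype.ext hx.2.symm

theorem contDiffAt_radialExtension {f : S2 → ℝ} (hf : ContMDiff (𝓡 2) 𝓘(ℝ, ℝ) ∞ f) {x₀ : E3}
    (hx₀ : x₀ ≠ 0) : ContDiffAt ℝ ∞ (radialExtension f) x₀ := by
  obtain ⟨S, hS, hS'⟩ := exists_smooth_retraction hx₀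
  exact (hf.comp hS).contDiff.contDiffAt.congr_of_eventuallyEq
    (radialExtension_eventuallyEq_comp f hS')

/-- A cutoff function near the unit sphere, as a function of the square of the radius. -/
def sphereBump : ContDiffBump (1 : ℝ) := ⟨1 / 4, 1 / 2, by norm_num, by norm_num⟩

/-- A smooth compactly supported extension of `f` that is constant along rays near `S²`. -/
def smoothExt (f : S2 → ℝ) (x : E3) : ℝ := sphereBump (‖x‖ ^ 2) * radialExtension f x

theorem sphereBump_norm_sq_eq_zero {E : Type*} [NormedAddCommGroup E] {x : E}
    (hx : ‖x‖ ^ 2 ≤ 1 / 2 ∨ 3 / 2 ≤ ‖x‖ ^ 2) : sphereBump (‖x‖ ^ 2) = 0 := by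
  apply sphereBump.zero_of_le_dist
  change 1 / 2 ≤ _
  rw [Real.dist_eq]
  rcases hx with h | h
  · rw [abs_sub_comm]
    exact le_trans (by linarith) (le_abs_self _)
  · exact le_trans (by linarith) (le_abs_self _)

theorem sphereBump_eventually_eq_one {E : Type*} [NormedAddCommGroup E] {x : E} (hx : ‖x‖ = 1) :
    ∀ᶠ y in 𝓝 x, sphereBump (‖y‖ ^ 2) = 1 := by
  have h : Filter.Tendsto (fun y : E => ‖y‖ ^ 2) (𝓝 x) (𝓝 1) := by
    have : ContinuousAt (fun y : E => ‖y‖ ^ 2) x := by fun_prop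
    simpa [ContinuousAt, hx] using this
  exact h.eventually sphereBump.eventuallyEq_one

theorem hasCompactSupport_of_bump {E F : Type*} [NormedAddCommGroup E] [ProperSpace E]
    [NormedAddCommGroup F] {g : E → F} (h : ∀ x, 3 / 2 ≤ ‖x‖ ^ 2 → g x = 0) :
    HasCompactSupport g := by
  refine HasCompactSupport.of_support_subset_isCompact (isCompact_closedBall (0 : E) 2) ?_
  intro x hx
  by_contra hx2
  apply hx
  apply h
  rw [mem_closedBall_zero_iff, not_le] at hx2
  nlinarith

section

variable {f : S2 → ℝ}

theorem contDiff_smoothExt (hf : ContMDiff (𝓡 2) 𝓘(ℝ, ℝ) ∞ f) : ContDiff ℝ ∞ (smoothExt f) := by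
  rw [contDiff_iff_contDiffAt]
  intro x
  by_cases hx : x = 0
  · have : smoothExt f =ᶠ[𝓝 x] fun _ => 0 := by
      have h : ∀ᶠ y in 𝓝 x, ‖y‖ ^ 2 < 1 / 2 := by
        have : ContinuousAt (fun y : E3 => ‖y‖ ^ 2) x := by fun_prop
        exact this.eventually_lt continuousAt_const (by simp [hx])
      filter_upwards [h] with y hy
      rw [smoothExt, sphereBump_norm_sq_eq_zero (Or.inl hy.le), zero_mul]
    exact contDiffAt_const.congr_of_eventuallyEq this
  · have h1 : ContDiff ℝ ∞ fun y : E3 => sphereBump (‖y‖ ^ 2) :=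
      sphereBump.contDiff.comp (contDiff_norm_sq ℝ)
    exact h1.contDiffAt.mul (contDiffAt_radialExtension hf hx)

theorem hasCompactSupport_smoothExt (f : S2 → ℝ) : HasCompactSupport (smoothExt f) :=
  hasCompactSupport_of_bump fun x hx => by
    rw [smoothExt, sphereBump_norm_sq_eq_zero (Or.inr hx), zero_mul]

theorem smoothExt_eventuallyEq (f : S2 → ℝ) (p : S2) :
    smoothExt f =ᶠ[𝓝 (p : E3)] radialExtension f := by
  filter_upwards [sphereBump_eventually_eq_one (norm_S2 p)] with y hy
  rw [smoothExt, hy, one_mul]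

theorem smoothExt_coe (f : S2 → ℝ) (p : S2) : smoothExt f p = f p := by
  rw [(smoothExt_eventuallyEq f p).eq_of_nhds, radialExtension_coe]

theorem S2_ne_zero (p : S2) : (p : E3) ≠ 0 := by
  intro h
  have := norm_S2 p
  rw [h, norm_zero] at this
  exact zero_ne_one this

theorem differentiable_smoothExt (hf : ContMDiff (𝓡 2) 𝓘(ℝ, ℝ) ∞ f) :
    Differentiable ℝ (smoothExt f) :=
  (contDiff_smoothExt hf).differentiable (by simp)

theorem radialExtension_smul (f : S2 → ℝ) {t : ℝ} (ht : 0 < t) (x : E3) :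
    radialExtension f (t • x) = radialExtension f x := by
  by_cases hx : x = 0
  · rw [hx, smul_zero]
  · rw [radialExtension_of_ne f hx, radialExtension_of_ne f (smul_ne_zero ht.ne' hx)]
    congr 1
    apply Subtype.ext
    simp only [norm_smul, Real.norm_of_nonneg ht.le, mul_inv, smul_smul]
    rw [mul_right_comm, inv_mul_cancel₀ ht.ne', one_mul]

theorem fderiv_smoothExt_self (hf : ContMDiff (𝓡 2) 𝓘(ℝ, ℝ) ∞ f) (p : S2) :
    fderiv ℝ (smoothExt f) p (p : E3) = 0 := by
  have h1 : HasDerivAt (fun t : ℝ => t • (p : E3)) (p : E3) 1 := by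
    simpa using (hasDerivAt_id (1 : ℝ)).smul_const (p : E3)
  have h2 : HasFDerivAt (smoothExt f) (fderiv ℝ (smoothExt f) p) ((1 : ℝ) • (p : E3)) := by
    rw [one_smul]
    exact (differentiable_smoothExt hf _).hasFDerivAt
  have h3 := h2.comp_hasDerivAt 1 h1
  have h4 : (smoothExt f ∘ fun t : ℝ => t • (p : E3)) =ᶠ[𝓝 1] fun _ => f p := by
    have hc : Filter.Tendsto (fun t : ℝ => t • (p : E3)) (𝓝 1) (𝓝 (p : E3)) := by
      simpa using h1.continuousAt.tendsto
    filter_upwards [hc.eventually (smoothExt_eventuallyEq f p), lt_mem_nhds zero_lt_one] with t ht h0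
    rw [Function.comp, ht, radialExtension_smul f h0, radialExtension_coe]
  exact h3.unique ((hasDerivAt_const _ _).congr_of_eventuallyEq h4)

/-- Near `p` the extension is `f` composed with a smooth retraction, and `f` is the extension
composed with the inclusion; the chain rule passes the vanishing of the derivative in both
directions. -/
theorem mem_criticalPoints_iff (hf : ContMDiff (𝓡 2) 𝓘(ℝ, ℝ) ∞ f) (p : S2) :
    p ∈ criticalPoints f ↔ fderiv ℝ (smoothExt f) p = 0 := by
  have hF := (contDiff_smoothExt hf).contMDiff.mdifferentiable (by simp)
  have hfd := hf.mdifferentiable (by simp)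
  have hcoe : MDifferentiable (𝓡 2) 𝓘(ℝ, E3) ((↑) : S2 → E3) :=
    (contMDiff_coe_sphere (m := ∞)).mdifferentiable (by simp)
  have e1 : f = smoothExt f ∘ ((↑) : S2 → E3) := funext fun q => (smoothExt_coe f q).symm
  rw [criticalPoints, Set.mem_ofPred_eq]
  constructor
  · intro h
    obtain ⟨S, hS, hS'⟩ := exists_smooth_retraction (S2_ne_zero p)
    have hp : S p = p := Subtype.ext (by rw [hS'.self_of_nhds.2, norm_S2, inv_one, one_smul])
    rw [((smoothExt_eventuallyEq f p).trans
      (radialExtension_eventuallyEq_comp f hS')).fderiv_eq, ← mfderiv_eq_fderiv,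
      mfderiv_comp (p : E3) (hfd _) (hS.mdifferentiable (by simp) _), hp, h]
    rfl
  · intro h
    rw [e1, mfderiv_comp p (hF _) (hcoe p), mfderiv_eq_fderiv, h]
    rfl

theorem smoothExt_toLin {R : SO3} (h : ∀ p, f (R • p) = f p) (x : E3) :
    smoothExt f (toLin R x) = smoothExt f x := by
  rw [smoothExt, smoothExt, norm_toLin]
  congr 1
  by_cases hx : x = 0
  · rw [hx, map_zero]
  · have hx' : toLin R x ≠ 0 := by rwa [← norm_ne_zero_iff, norm_toLin, norm_ne_zero_iff]
    rw [radialExtension_of_ne f hx, radialExtension_of_ne f hx',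
      ← h ⟨‖x‖⁻¹ • x, by simp [norm_smul, hx]⟩]
    congr 1
    apply Subtype.ext
    rw [coe_smul_sphere]
    change ‖toLin R x‖⁻¹ • toLin R x = toLin R (‖x‖⁻¹ • x)
    rw [norm_toLin, map_smul]

theorem fderiv_smoothExt_toLin (hf : ContMDiff (𝓡 2) 𝓘(ℝ, ℝ) ∞ f) {R : SO3}
    (h : ∀ p, f (R • p) = f p) (x y : E3) :
    fderiv ℝ (smoothExt f) (toLin R x) (toLin R y) = fderiv ℝ (smoothExt f) x y := by
  have e : smoothExt f = smoothExt f ∘ toLin R := funext fun x => (smoothExt_toLin h x).symm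
  conv_rhs => rw [e, fderiv_comp x (differentiable_smoothExt hf _) (toLin R).differentiableAt]
  simp

/-- The gradient of a function on `ℝ³`. -/
def gradCLM : (E3 →L[ℝ] ℝ) →L[ℝ] E3 :=
  LinearMap.toContinuousLinearMap
    { toFun := fun φ => WithLp.toLp 2 fun i => φ (EuclideanSpace.single i 1)
      map_add' := fun φ ψ => by ext i; simp
      map_smul' := fun c φ => by ext i; simp }

theorem inner_gradCLM (φ : E3 →L[ℝ] ℝ) (y : E3) : inner ℝ (gradCLM φ) y = φ y := by
  have hy : y = ∑ i, y i • EuclideanSpace.single i (1 : ℝ) := by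
    ext i
    fin_cases i <;> simp [Fin.sum_univ_three]
  conv_rhs => rw [hy]
  rw [map_sum, PiLp.inner_apply]
  refine Finset.sum_congr rfl fun i _ => ?_
  rw [map_smul, smul_eq_mul]
  simp [gradCLM]

theorem gradCLM_eq_zero_iff (φ : E3 →L[ℝ] ℝ) : gradCLM φ = 0 ↔ φ = 0 := by
  constructor
  · intro h
    ext1 y
    rw [← inner_gradCLM, h, inner_zero_left]
    rfl
  · rintro rfl
    exact map_zero _

theorem gradCLM_innerSL (c : E3) : gradCLM (innerSL ℝ c) = c := by
  refine ext_inner_right ℝ fun y => ?_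
  rw [inner_gradCLM, innerSL_apply_apply]

/-- The gradient of the smooth extension of `f`. -/
def gradExt (f : S2 → ℝ) (x : E3) : E3 := gradCLM (fderiv ℝ (smoothExt f) x)

theorem inner_gradExt (f : S2 → ℝ) (x y : E3) :
    inner ℝ (gradExt f x) y = fderiv ℝ (smoothExt f) x y := inner_gradCLM _ _

theorem contDiff_gradExt (hf : ContMDiff (𝓡 2) 𝓘(ℝ, ℝ) ∞ f) : ContDiff ℝ ∞ (gradExt f) :=
  gradCLM.contDiff.comp ((contDiff_smoothExt hf).fderiv_right (by simp))

theorem inner_gradExt_self (hf : ContMDiff (𝓡 2) 𝓘(ℝ, ℝ) ∞ f) (p : S2) :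
    inner ℝ (gradExt f p) (p : E3) = 0 := by
  rw [inner_gradExt, fderiv_smoothExt_self hf]

theorem mem_criticalPoints_iff_gradExt (hf : ContMDiff (𝓡 2) 𝓘(ℝ, ℝ) ∞ f) (p : S2) :
    p ∈ criticalPoints f ↔ gradExt f p = 0 := by
  rw [mem_criticalPoints_iff hf, gradExt, gradCLM_eq_zero_iff]

theorem gradExt_toLin (hf : ContMDiff (𝓡 2) 𝓘(ℝ, ℝ) ∞ f) {R : SO3}
    (h : ∀ p, f (R • p) = f p) (x : E3) : gradExt f (toLin R x) = toLin R (gradExt f x) := by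
  refine ext_inner_right ℝ fun y => ?_
  rw [← toLin_apply_inv R y, inner_toLin, inner_gradExt, inner_gradExt,
    fderiv_smoothExt_toLin hf h]

/-- A nontrivial rotation preserving `f` has its axis through critical points. -/
theorem mem_criticalPoints_of_fixed (hf : ContMDiff (𝓡 2) 𝓘(ℝ, ℝ) ∞ f) {R : SO3}
    (h : ∀ p, f (R • p) = f p) (hR : R ≠ 1) {p : S2} (hp : R • p = p) : p ∈ criticalPoints f := by
  rw [mem_criticalPoints_iff_gradExt hf]
  by_contra hg
  have hp' : toLin R (p : E3) = p := by rw [← coe_smul_sphere, hp]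
  have hg' : toLin R (gradExt f p) = gradExt f p := by rw [← gradExt_toLin hf h, hp']
  refine hR (eq_one_of_fixes R _ _ hg' hp' fun h0 => hg ?_)
  have h1 := inner_gradExt_self hf p
  have h2 := norm_S2 p
  have e : ‖gradExt f p‖ ^ 2 * ‖(p : E3)‖ ^ 2
      = inner ℝ (gradExt f p) (p : E3) ^ 2 + ‖cross (gradExt f p) (p : E3)‖ ^ 2 := by
    rw [cross_apply', inner_E3, EuclideanSpace.norm_sq_eq, EuclideanSpace.norm_sq_eq,
      EuclideanSpace.norm_sq_eq]
    simp [Fin.sum_univ_three]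
    ring
  rw [h1, h2, h0] at e
  simpa using e

/-! ### Nondegenerate critical points -/

/-- Near `p`, `f` has value `c` and Hessian `diag (a, b)` in the orthonormal frame `τ₀, τ₁`, where
`a, b` refer to coordinates scaled by `2`. -/
structure HasQuadraticForm (f : S2 → ℝ) (p : S2) (a b c : ℝ) (τ₀ τ₁ : E3) : Prop where
  value : f p = c
  norm₀ : inner ℝ τ₀ τ₀ = (1 : ℝ)
  norm₁ : inner ℝ τ₁ τ₁ = (1 : ℝ)
  orth : inner ℝ τ₀ τ₁ = (0 : ℝ)
  tangent₀ : inner ℝ (p : E3) τ₀ = (0 : ℝ)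
  tangent₁ : inner ℝ (p : E3) τ₁ = (0 : ℝ)
  hess : HasFDerivAt (gradExt f)
    ((a / 4) • (innerSL ℝ τ₀).smulRight τ₀ + (b / 4) • (innerSL ℝ τ₁).smulRight τ₁) (p : E3)

/-- For a unit vector y the coordinates are y₀/(1 + y₂) and y₁/(1 + y₂); the homogeneous form keeps
them smooth functions on an open set of ℝ³. -/
theorem exists_stereo_coords (R : SO3) (x : E3) (hx : x ≠ 0)
    (hx' : 0 < ‖x‖ + inner ℝ x (toLin R !₂[0, 0, 1])) :
    (⟨‖x‖⁻¹ • x, by simp [norm_smul, hx]⟩ : S2) =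
      R • stereo (inner ℝ x (toLin R !₂[1, 0, 0]) / (‖x‖ + inner ℝ x (toLin R !₂[0, 0, 1])))
        (inner ℝ x (toLin R !₂[0, 1, 0]) / (‖x‖ + inner ℝ x (toLin R !₂[0, 0, 1]))) := by
  obtain ⟨y, rfl⟩ : ∃ y, x = toLin R y := ⟨toLin R⁻¹ x, (toLin_apply_inv R x).symm⟩
  simp only [inner_toLin, norm_toLin] at hx' ⊢
  apply Subtype.ext
  rw [coe_smul_sphere]
  change ‖y‖⁻¹ • toLin R y = _
  rw [← map_smul]
  congr 1
  have hy : y ≠ 0 := by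
    rintro rfl
    exact hx (map_zero _)
  have hn : 0 < ‖y‖ := norm_pos_iff.2 hy
  have hsq := EuclideanSpace.norm_sq_eq y
  simp [Fin.sum_univ_three] at hsq
  simp only [inner_E3] at hx' ⊢
  simp at hx' ⊢
  set r := ‖y‖
  have h1 : 1 + (y 0 / (r + y 2)) ^ 2 + (y 1 / (r + y 2)) ^ 2 = 2 * r / (r + y 2) := by
    field_simp
    linear_combination (-1 : ℝ) * hsq
  have h2 : 1 - (y 0 / (r + y 2)) ^ 2 - (y 1 / (r + y 2)) ^ 2 = 2 * y 2 / (r + y 2) := by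
    field_simp
    linear_combination hsq
  rw [stereo]
  simp only [h1, h2]
  ext i
  fin_cases i <;> simp <;> field_simp

/-- The stereographic coordinates are s(x) = ⟨x, τ⟩/(‖x‖ + ⟨x, p⟩), which vanish at `p` with
gradient τ/2 because the denominator is 2 there. In the second derivative of a s₀²/2 + b s₁²/2 + c
at `p` only products of first derivatives survive, hence the factor 1/4. -/
theorem HasLocalForm.exists_hasQuadraticForm {p : S2}
    {a b c : ℝ} (h : HasLocalForm f p fun x y => a * x ^ 2 / 2 + b * y ^ 2 / 2 + c) :
    ∃ τ₀ τ₁, HasQuadraticForm f p a b c τ₀ τ₁ := by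
  obtain ⟨R, hR, hloc⟩ := h
  have hp : (p : E3) = toLin R !₂[0, 0, 1] := by
    rw [← hR, coe_smul_sphere]
    simp [stereo]
  set τ₀ := toLin R !₂[1, 0, 0] with hτ₀
  set τ₁ := toLin R !₂[0, 1, 0] with hτ₁
  have hpτ₀ : inner ℝ (p : E3) τ₀ = (0 : ℝ) := by rw [hp, hτ₀, inner_toLin, inner_E3]; simp
  have hpτ₁ : inner ℝ (p : E3) τ₁ = (0 : ℝ) := by rw [hp, hτ₁, inner_toLin, inner_E3]; simp
  let N : E3 → ℝ := fun x => ‖x‖ + inner ℝ x (p : E3)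
  have hNp : N p = 2 := by
    simp only [N]
    rw [real_inner_self_eq_norm_sq, norm_S2]
    norm_num
  have hNc : ContDiffAt ℝ ∞ N p := by
    exact (contDiffAt_norm ℝ (S2_ne_zero p)).add (contDiffAt_id.inner ℝ contDiffAt_const)
  let s : E3 → E3 → ℝ := fun τ x => inner ℝ x τ / N x
  have hs : ∀ τ, ContDiffAt ℝ ∞ (s τ) p := fun τ =>
    ContDiffAt.div (contDiffAt_id.inner ℝ contDiffAt_const) hNc (by rw [hNp]; norm_num)
  have hsp : ∀ τ, inner ℝ (p : E3) τ = (0 : ℝ) → s τ p = 0 := fun τ h => by simp [s, h]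
  have hsd : ∀ τ, inner ℝ (p : E3) τ = (0 : ℝ) →
      fderiv ℝ (s τ) p = (1 / 2 : ℝ) • innerSL ℝ τ := by
    intro τ h
    have h1 : HasFDerivAt (fun x : E3 => inner ℝ x τ) (innerSL ℝ τ) (p : E3) := by
      have := (innerSL ℝ τ).hasFDerivAt (x := (p : E3))
      refine this.congr_of_eventuallyEq (Filter.Eventually.of_forall fun x => ?_)
      simp [real_inner_comm]
    have h2 := (hNc.differentiableAt (by simp)).hasFDerivAt
    have h3 := h1.mul ((hasDerivAt_inv (by rw [hNp]; norm_num : N p ≠ 0)).comp_hasFDerivAt _ h2)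
    have h4 : HasFDerivAt (s τ) _ (p : E3) := h3
    rw [h4.fderiv, h]
    ext1 v
    simp [hNp]
  have hev : smoothExt f =ᶠ[𝓝 (p : E3)]
      fun x => a * s τ₀ x ^ 2 / 2 + b * s τ₁ x ^ 2 / 2 + c := by
    have ht : Filter.Tendsto (fun x : E3 => (s τ₀ x, s τ₁ x)) (𝓝 (p : E3)) (𝓝 (0, 0)) := by
      have := (hs τ₀).continuousAt.prodMk (hs τ₁).continuousAt
      rw [ContinuousAt, hsp _ hpτ₀, hsp _ hpτ₁] at this
      exact this
    have hN0 : ∀ᶠ x in 𝓝 (p : E3), 0 < N x :=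
      hNc.continuousAt.eventually (lt_mem_nhds (by rw [hNp]; norm_num))
    filter_upwards [smoothExt_eventuallyEq f p, ht.eventually hloc, hN0,
      isOpen_ne.mem_nhds (S2_ne_zero p)] with x h1 h2 h3 h4
    rw [h1, radialExtension_of_ne f h4, exists_stereo_coords R x h4 (by rwa [← hp])]
    simpa only [s, N, hp] using h2
  have hfd : fderiv ℝ (smoothExt f) =ᶠ[𝓝 (p : E3)]
      fun x => (a * s τ₀ x) • fderiv ℝ (s τ₀) x + (b * s τ₁ x) • fderiv ℝ (s τ₁) x := by
    have hd : ∀ τ, ∀ᶠ x in 𝓝 (p : E3), DifferentiableAt ℝ (s τ) x := fun τ =>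
      (((hs τ).of_le (m := 1) (by simp)).eventually (by simp)).mono
        fun x hx => hx.differentiableAt (by simp)
    filter_upwards [hev.eventuallyEq_nhds, hd τ₀, hd τ₁] with x hx h0 h1
    rw [hx.fderiv_eq]
    have h := (((h0.hasFDerivAt.pow 2).const_mul (a / 2)).add
      ((h1.hasFDerivAt.pow 2).const_mul (b / 2))).add_const c
    refine HasFDerivAt.fderiv ((h.congr_fderiv ?_).congr_of_eventuallyEq
      (Filter.Eventually.of_forall fun y => ?_))
    · ext1 v
      simp
      ring
    · simp
      ring
  have hterm : ∀ (e : ℝ) (τ : E3), inner ℝ (p : E3) τ = (0 : ℝ) →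
      HasFDerivAt (fun x => (e * s τ x) • fderiv ℝ (s τ) x)
        ((e / 4) • (innerSL ℝ τ).smulRight (innerSL ℝ τ)) (p : E3) := by
    intro e τ h
    have h1 := ((hs τ).differentiableAt (by simp)).hasFDerivAt.const_mul e
    have h2 : HasFDerivAt (fderiv ℝ (s τ)) (fderiv ℝ (fderiv ℝ (s τ)) p) (p : E3) :=
      (((hs τ).fderiv_right (m := ∞) (by simp)).differentiableAt (by simp)).hasFDerivAt
    have h3 := h1.smul h2
    refine h3.congr_fderiv ?_
    ext v w
    simp [hsp τ h, hsd τ h]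
    ring
  refine ⟨τ₀, τ₁, ?_, ?_, ?_, ?_, hpτ₀, hpτ₁, ?_⟩
  · rw [← smoothExt_coe f p, hev.self_of_nhds]
    simp [hsp _ hpτ₀, hsp _ hpτ₁]
  · rw [hτ₀, inner_toLin, inner_E3]; simp
  · rw [hτ₁, inner_toLin, inner_E3]; simp
  · rw [hτ₀, hτ₁, inner_toLin, inner_E3]; simp
  · have h1 := ((hterm a τ₀ hpτ₀).add (hterm b τ₁ hpτ₁)).congr_of_eventuallyEq hfd
    have h2 := gradCLM.hasFDerivAt.comp (p : E3) h1
    refine HasFDerivAt.congr_fderiv (f' := _) (f := gradExt f) h2 ?_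
    ext1 v
    simp only [ContinuousLinearMap.comp_apply, add_apply,
      smul_apply, ContinuousLinearMap.smulRight_apply, map_add, map_smul,
      gradCLM_innerSL]

end

/-! ### The exterior derivative of the perturbed form -/

/-- The factor `1 + ε f ∘ 𝔓`, extended to `ℂ²`. -/
def conf (f : S2 → ℝ) (ε : ℝ) (z : C2) : ℝ := 1 + ε * smoothExt f (hopfBilin z z)

theorem conf_coe (f : S2 → ℝ) (ε : ℝ) (z : S3) : conf f ε z = 1 + ε * f (hopf z) := by
  rw [conf, ← hopf_eq_hopfBilin, smoothExt_coe]

theorem S3_ne_zero (z : S3) : (z : C2) ≠ 0 := by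
  intro h
  have := norm_S3 z
  rw [h, norm_zero] at this
  exact zero_ne_one this

/-- The map x ↦ `hopfBilin x x` is homogeneous of degree two, so the direction of its value depends
only on the direction of x. Near S³ the extension thus becomes a composition to which the chain rule
applies. -/
theorem radialExtension_eventuallyEq_conf (f : S2 → ℝ) (ε : ℝ) (z : S3) :
    radialExtension (fun y : S3 => 1 + ε * f (hopf y)) =ᶠ[𝓝 (z : C2)] conf f ε := by
  have hc : Filter.Tendsto (fun x : C2 => hopfBilin x x) (𝓝 (z : C2)) (𝓝 (hopf z : E3)) := by
    rw [hopf_eq_hopfBilin]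
    exact (hasFDerivAt_hopfBilin_self _).continuousAt
  filter_upwards [hc.eventually (smoothExt_eventuallyEq f (hopf z)),
    isOpen_ne.mem_nhds (S3_ne_zero z)] with x h1 h2
  have hx : hopfBilin x x ≠ 0 := by
    rw [← norm_ne_zero_iff, norm_hopfBilin_self]
    exact pow_ne_zero 2 (norm_ne_zero_iff.2 h2)
  rw [conf, h1, radialExtension_of_ne _ h2, radialExtension_of_ne f hx]
  congr 3
  apply Subtype.ext
  rw [hopf_eq_hopfBilin]
  simp only [map_smul, smul_apply, norm_hopfBilin_self, smul_smul]
  rw [sq, mul_inv]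

section

variable {f : S2 → ℝ} {ε : ℝ}

theorem contDiff_conf (hf : ContMDiff (𝓡 2) 𝓘(ℝ, ℝ) ∞ f) : ContDiff ℝ ∞ (conf f ε) :=
  contDiff_const.add (contDiff_const.mul ((contDiff_smoothExt hf).comp contDiff_hopfBilin_self))

theorem fderiv_conf (hf : ContMDiff (𝓡 2) 𝓘(ℝ, ℝ) ∞ f) (z v : C2) :
    fderiv ℝ (conf f ε) z v
      = 2 * ε * inner ℝ (gradExt f (hopfBilin z z)) (hopfBilin z v) := by
  have h1 := (differentiable_smoothExt hf (hopfBilin z z)).hasFDerivAt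
  have h2 := ((HasFDerivAt.comp (g := smoothExt f) (f := fun x => hopfBilin x x) z h1
    (hasFDerivAt_hopfBilin_self z)).const_mul ε).const_add 1
  have h3 : HasFDerivAt (conf f ε) _ z := h2
  rw [h3.fderiv, inner_gradExt]
  simp
  ring

theorem stdForm_apply (z v : C2) : stdForm z v = (inner ℂ z v).im := rfl

/-- This is d(gλ) = dg ∧ λ + g dλ, with dλ(v, w) = 2 Im⟨v, w⟩ because λ is linear in the base point
and Im⟨·,·⟩ is antisymmetric. -/
theorem dPerturbedForm_apply (hf : ContMDiff (𝓡 2) 𝓘(ℝ, ℝ) ∞ f) (z : S3) (v w : C2) :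
    dPerturbedForm f ε z ![v, w] = fderiv ℝ (conf f ε) z v * (inner ℂ (z : C2) w).im
      - fderiv ℝ (conf f ε) z w * (inner ℂ (z : C2) v).im
      + 2 * conf f ε z * (inner ℂ v w).im := by
  let L : C2 →L[ℝ] C2 →L[ℝ] ℝ := LinearMap.toContinuousBilinearMap <|
    LinearMap.mk₂ ℝ (fun z w : C2 => (inner ℂ z w).im)
      (by intros; simp) (by intros; simp [inner_C2]; ring)
      (by intros; simp) (by intros; simp [inner_C2]; ring)
  have hL : ∀ x y, L x y = (inner ℂ x y).im := fun _ _ => rfl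
  have hgd : Differentiable ℝ (conf f ε) := (contDiff_conf hf).differentiable (by simp)
  have hev : (fun x => ContinuousAlternatingMap.ofSubsingleton ℝ C2 ℝ (0 : Fin 1)
      (perturbedForm f ε x)) =ᶠ[𝓝 (z : C2)]
      fun x => ContinuousAlternatingMap.ofSubsingleton ℝ C2 ℝ (0 : Fin 1)
        (conf f ε x • L x) := by
    filter_upwards [radialExtension_eventuallyEq_conf f ε z] with x hx
    rw [perturbedForm, hx]
    rfl
  have hd : DifferentiableAt ℝ (fun x => ContinuousAlternatingMap.ofSubsingleton ℝ C2 ℝ (0 : Fin 1)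
        (conf f ε x • L x)) (z : C2) :=
    (ContinuousAlternatingMap.ofSubsingletonLIE (𝕜 := ℝ) (E := C2) (F := ℝ)
      (i := (0 : Fin 1))).toContinuousLinearEquiv.toContinuousLinearMap.differentiableAt.comp
        _ ((hgd _).smul L.differentiableAt)
  have hder : ∀ u : C2, fderiv ℝ (fun x => conf f ε x * L x u) (z : C2)
      = conf f ε z • L.flip u + L z u • fderiv ℝ (conf f ε) z := by
    intro u
    have h1 := (hgd (z : C2)).hasFDerivAt.mul (L.flip u).hasFDerivAt
    exact HasFDerivAt.fderiv h1
  rw [dPerturbedForm, hev.extDeriv_eq, extDeriv_apply hd]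
  have key : ∀ i : Fin 2, (fun x => (ContinuousAlternatingMap.ofSubsingleton ℝ C2 ℝ (0 : Fin 1)
      (conf f ε x • L x)) (i.removeNth ![v, w])) = fun x => conf f ε x * L x (![w, v] i) := by
    intro i
    funext x
    fin_cases i <;> simp [Fin.removeNth]
  simp only [key, hder]
  simp [hL]
  rw [← inner_conj_symm w v, Complex.conj_im]
  ring

/-! ### The Reeb vector field -/

end

/-- The factor `u` in the Reeb vector field `i u`. -/
def reebFactor (f : S2 → ℝ) (ε : ℝ) (z : C2) : C2 :=
  (conf f ε z)⁻¹ • z - (ε / conf f ε z ^ 2) • pauliMul (gradExt f (hopfBilin z z)) z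

/-- A smooth, compactly supported vector field on `ℂ²`, tangent to the spheres, whose restriction
to `S³` is the Reeb vector field. -/
def reebField (f : S2 → ℝ) (ε : ℝ) (z : C2) : C2 :=
  sphereBump (‖z‖ ^ 2) • Complex.I • reebFactor f ε z

theorem reebField_coe (f : S2 → ℝ) (ε : ℝ) (z : S3) :
    reebField f ε z = Complex.I • reebFactor f ε z := by
  rw [reebField, (sphereBump_eventually_eq_one (norm_S3 z)).self_of_nhds, one_smul]

theorem real_smul_C2 (a : ℝ) (v : C2) : a • v = (a : ℂ) • v := by
  ext i; simp

theorem inner_reebFactor (f : S2 → ℝ) (ε : ℝ) (z : C2) :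
    inner ℂ z (reebFactor f ε z) = ((‖z‖ ^ 2 / conf f ε z - ε / conf f ε z ^ 2 *
      inner ℝ (hopfBilin z z) (gradExt f (hopfBilin z z)) : ℝ) : ℂ) := by
  rw [reebFactor, inner_sub_right, real_smul_C2, real_smul_C2, inner_smul_right, inner_smul_right,
    inner_pauliMul_self, inner_self_eq_norm_sq_to_K]
  push_cast
  rw [div_eq_inv_mul (_ ^ 2)]
  rfl

/-- Hermitian matrices have real quadratic forms, so ⟨z, u⟩ is real for the factor u and i u is
tangent to every sphere about the origin. The ambient flow therefore preserves the norm. -/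
theorem inner_reebField_re (f : S2 → ℝ) (ε : ℝ) (z : C2) :
    (inner ℂ z (reebField f ε z)).re = 0 := by
  rw [reebField, real_smul_C2, inner_smul_right, inner_smul_right, inner_reebFactor,
    Complex.re_ofReal_mul, Complex.I_mul_re, Complex.ofReal_im, neg_zero, mul_zero]

section

variable {f : S2 → ℝ} {ε : ℝ}

theorem hopfBilin_reebField (z : S3) : hopfBilin z (reebField f ε z) =
    (ε / conf f ε z ^ 2) • cross (hopf z : E3) (gradExt f (hopf z)) := by
  rw [reebField_coe, reebFactor, smul_sub, map_sub, smul_comm, map_smul, hopfBilin_I_smul_self,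
    smul_zero, smul_comm, map_smul, hopfBilin_I_pauliMul, ← hopf_eq_hopfBilin, zero_sub, ← smul_neg]
  congr 1
  rw [cross_apply', cross_apply']
  ext i
  fin_cases i <;> simp <;> ring

theorem inner_reebField (hf : ContMDiff (𝓡 2) 𝓘(ℝ, ℝ) ∞ f) (z : S3) :
    inner ℂ (z : C2) (reebField f ε z) = Complex.I * ((conf f ε z)⁻¹ : ℝ) := by
  rw [reebField_coe, inner_smul_right, inner_reebFactor, norm_S3, ← hopf_eq_hopfBilin,
    real_inner_comm, inner_gradExt_self hf]
  simp

theorem isReebVector_reebField (hf : ContMDiff (𝓡 2) 𝓘(ℝ, ℝ) ∞ f) (z : S3) (hg : conf f ε z ≠ 0) :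
    IsReebVector f ε z (reebField f ε z) := by
  refine ⟨inner_reebField_re f ε z, ?_, fun w hw => ?_⟩
  · rw [perturbedForm, (radialExtension_eventuallyEq_conf f ε z).self_of_nhds, smul_apply,
      stdForm_apply, inner_reebField hf]
    simp [hg]
  · rw [dPerturbedForm_apply hf, inner_reebField hf, fderiv_conf hf, hopfBilin_reebField,
      ← hopf_eq_hopfBilin, inner_smul_right, fderiv_conf hf, ← hopf_eq_hopfBilin]
    have h1 : inner ℝ (gradExt f (hopf z)) (cross (hopf z : E3) (gradExt f (hopf z))) = (0 : ℝ) := by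
      rw [inner_E3, cross_apply']
      simp
      ring
    have h2 : (inner ℂ (reebField f ε z) w).im
        = ε / conf f ε z ^ 2 * inner ℝ (gradExt f (hopf z)) (hopfBilin z w) := by
      rw [reebField_coe, inner_smul_left, reebFactor, inner_sub_left, real_smul_C2, real_smul_C2,
        inner_smul_left, inner_smul_left, ← hopf_eq_hopfBilin, real_inner_comm, inner_hopfBilin,
        ← inner_conj_symm w]
      have : (inner ℂ (z : C2) w).re = 0 := hw
      simp only [Complex.conj_I, Complex.conj_ofReal, Complex.conj_re, neg_mul, Complex.neg_im,
        Complex.I_mul_im, Complex.sub_re, Complex.re_ofReal_mul, this]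
      ring
    rw [h1, h2]
    simp
    field_simp
    ring

/-- The value of the form fixes the component along `z`; testing the exterior derivative against the
contact plane, where it pairs through 2g Im⟨·,·⟩, fixes the two remaining components. -/
theorem IsReebVector.unique
    (hf : ContMDiff (𝓡 2) 𝓘(ℝ, ℝ) ∞ f) {z : S3} {v w : C2} (hg : conf f ε z ≠ 0)
    (hv : IsReebVector f ε z v)
    (hw : IsReebVector f ε z w) : v = w := by
  obtain ⟨a1, a2, a3⟩ := hv
  obtain ⟨b1, b2, b3⟩ := hw
  rw [perturbedForm, (radialExtension_eventuallyEq_conf f ε z).self_of_nhds, smul_apply,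
      stdForm_apply, smul_eq_mul] at a2 b2
  change (inner ℂ (z : C2) v).re = 0 at a1
  change (inner ℂ (z : C2) w).re = 0 at b1
  have hz : inner ℂ (z : C2) v = inner ℂ (z : C2) w := by
    apply Complex.ext
    · rw [a1, b1]
    · exact mul_left_cancel₀ hg (a2.trans b2.symm)
  have hj : ∀ u : C2, inner ℂ (z : C2) u = 0 → (inner ℂ v u).im = (inner ℂ w u).im := by
    intro u hu
    have hu' : u ∈ tangent z := by
      rw [tangent, Set.mem_ofPred_eq, hu]; rfl
    have e1 := a3 u hu'
    have e2 := b3 u hu'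
    rw [dPerturbedForm_apply hf, hu] at e1 e2
    rw [hz] at e1
    simp only [Complex.zero_im, mul_zero, zero_sub] at e1 e2
    have : 2 * conf f ε z * (inner ℂ v u).im = 2 * conf f ε z * (inner ℂ w u).im := by
      linarith
    exact mul_left_cancel₀ (mul_ne_zero two_ne_zero hg) this
  have h0 := hj (frame z 0) (inner_self_frame_zero z)
  have h1 := hj (Complex.I • frame z 0) (by rw [inner_smul_right, inner_self_frame_zero, mul_zero])
  rw [inner_smul_right, inner_smul_right] at h1
  simp at h1
  rw [frame_decomposition z v, frame_decomposition z w, hz]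
  congr 2
  rw [← inner_conj_symm v, ← inner_conj_symm w] at h0 h1
  simp only [Complex.conj_im, Complex.conj_re, neg_inj] at h0 h1
  exact Complex.ext h1 h0

theorem isReebVector_iff (hf : ContMDiff (𝓡 2) 𝓘(ℝ, ℝ) ∞ f) (z : S3)
    (hg : conf f ε z ≠ 0) (v : C2) :
    IsReebVector f ε z v ↔ v = reebField f ε z :=
  ⟨fun h => IsReebVector.unique hf hg h (isReebVector_reebField hf z hg),
    fun h => h ▸ isReebVector_reebField hf z hg⟩

/-- On the contact plane the exterior derivative is 2g Im⟨·,·⟩, and pairing v with iv gives 2g|v|².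
-/
theorem isContactForm (hf : ContMDiff (𝓡 2) 𝓘(ℝ, ℝ) ∞ f) (hg : ∀ z : S3, conf f ε z ≠ 0) :
    IsContactForm f ε := by
  intro z
  have hp : ∀ v, perturbedForm f ε z v = conf f ε z * (inner ℂ (z : C2) v).im := by
    intro v
    rw [perturbedForm, (radialExtension_eventuallyEq_conf f ε z).self_of_nhds, smul_apply,
      stdForm_apply, smul_eq_mul]
  refine ⟨⟨Complex.I • (z : C2), ?_, ?_⟩, ?_⟩
  · rw [tangent, Set.mem_ofPred_eq, inner_smul_right, inner_self_S3]
    simp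
  · rw [hp, inner_smul_right, inner_self_S3]
    simpa using hg z
  · intro v hv hv0 h
    rw [hp, mul_eq_zero, or_iff_right (hg z)] at hv0
    have hv' : inner ℂ (z : C2) v = 0 := Complex.ext hv hv0
    have hw' : inner ℂ (z : C2) (Complex.I • v) = 0 := by rw [inner_smul_right, hv', mul_zero]
    have := h (Complex.I • v) (by rw [tangent, Set.mem_ofPred_eq, hw']; rfl)
      (by rw [hp, hw']; simp)
    rw [dPerturbedForm_apply hf, hv', hw', inner_smul_right, inner_self_eq_norm_sq_to_K] at this
    have h2 : 2 * conf f ε z * ‖v‖ ^ 2 = 0 := by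
      rw [← this]
      simp [← Complex.ofReal_pow]
    rw [mul_eq_zero, or_iff_right (mul_ne_zero two_ne_zero (hg z))] at h2
    exact norm_eq_zero.1 (pow_eq_zero_iff two_ne_zero |>.1 h2)

theorem contDiff_reebField (hf : ContMDiff (𝓡 2) 𝓘(ℝ, ℝ) ∞ f)
    (hg : ∀ x, 1 + ε * smoothExt f x ≠ 0) : ContDiff ℝ ∞ (reebField f ε) := by
  have h1 : ContDiff ℝ ∞ (conf f ε) := contDiff_conf hf
  have h2 : ContDiff ℝ ∞ fun z : C2 => gradExt f (hopfBilin z z) :=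
    (contDiff_gradExt hf).comp contDiff_hopfBilin_self
  have h3 : ContDiff ℝ ∞ fun z : C2 => sphereBump (‖z‖ ^ 2) :=
    sphereBump.contDiff.comp (contDiff_norm_sq ℝ)
  have h4 : ContDiff ℝ ∞ fun z : C2 => (conf f ε z)⁻¹ := h1.inv fun z => hg _
  have h5 : ContDiff ℝ ∞ fun z : C2 => ε / conf f ε z ^ 2 :=
    contDiff_const.div (h1.pow 2) fun z => pow_ne_zero 2 (hg _)
  have h6 : ContDiff ℝ ∞ fun z : C2 => pauliMul (gradExt f (hopfBilin z z)) z := by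
    fun_prop
  have h7 : ContDiff ℝ ∞ fun z : C2 => Complex.I • reebFactor f ε z :=
    ((h4.smul contDiff_id).sub (h5.smul h6)).const_smul Complex.I
  exact h3.smul h7

theorem hasCompactSupport_reebField : HasCompactSupport (reebField f ε) :=
  hasCompactSupport_of_bump fun x hx => by
    rw [reebField, sphereBump_norm_sq_eq_zero (Or.inr hx), zero_smul]

theorem exists_lipschitz_reebField (hf : ContMDiff (𝓡 2) 𝓘(ℝ, ℝ) ∞ f)
    (hg : ∀ x, 1 + ε * smoothExt f x ≠ 0) :
    ∃ K, LipschitzWith K (reebField f ε) :=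
  (contDiff_reebField hf hg).lipschitzWith_of_hasCompactSupport hasCompactSupport_reebField
    (by simp)

end

/-! ### Global solutions of ordinary differential equations -/

section ODE

variable {E : Type*} [NormedAddCommGroup E] [NormedSpace ℝ E]

theorem eq_of_hasDerivAt_of_lipschitz {X : E → E} {K : NNReal} (hX : LipschitzWith K X)
    {c d : ℝ → E} (hc : ∀ t, HasDerivAt c (X (c t)) t) (hd : ∀ t, HasDerivAt d (X (d t)) t)
    {t₀ : ℝ} (h : c t₀ = d t₀) : c = d :=
  ODE_solution_unique_univ (v := fun _ => X) (s := fun _ => Set.univ) (K := K)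
    (fun _ => hX.lipschitzOnWith) (fun t => ⟨hc t, trivial⟩) (fun t => ⟨hd t, trivial⟩) h

/-- Because X is bounded by M, Picard–Lindelöf applies on [−n−1, n+1] with the ball of radius
M(n+1); uniqueness makes the solutions agree on overlaps, so they glue. -/
theorem exists_global_solution [CompleteSpace E] {X : E → E} {K : NNReal} (hX : LipschitzWith K X)
    {M : NNReal} (hM : ∀ x, ‖X x‖ ≤ M) (x : E) :
    ∃ c : ℝ → E, c 0 = x ∧ ∀ t, HasDerivAt c (X (c t)) t := by
  have hloc : ∀ n : ℕ, ∃ c : ℝ → E, c 0 = x ∧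
      ∀ t ∈ Set.Ioo (-(n : ℝ) - 1) (n + 1), HasDerivAt c (X (c t)) t := by
    intro n
    have hn : (0 : ℝ) ≤ n := n.cast_nonneg
    have h0 : (0 : ℝ) ∈ Set.Icc (-(n : ℝ) - 1) (n + 1) := ⟨by linarith, by linarith⟩
    have hP : IsPicardLindelof (fun _ => X) (⟨0, h0⟩ : Set.Icc (-(n : ℝ) - 1) (n + 1)) x
        (M * (n + 1)) 0 M K := by
      refine IsPicardLindelof.of_time_independent (fun y _ => hM y) hX.lipschitzOnWith ?_
      have : max ((n : ℝ) + 1 - 0) (0 - (-(n : ℝ) - 1)) = n + 1 := by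
        rw [max_eq_left] <;> linarith
      simp only [this]
      push_cast
      linarith
    obtain ⟨c, hc0, hc⟩ := hP.exists_eq_forall_mem_Icc_hasDerivWithinAt₀
    exact ⟨c, hc0, fun t ht => (hc t ⟨ht.1.le, ht.2.le⟩).hasDerivAt (Icc_mem_nhds ht.1 ht.2)⟩
  choose c hc0 hc using hloc
  have hagree : ∀ m n : ℕ, m ≤ n →
      Set.EqOn (c m) (c n) (Set.Ioo (-(m : ℝ) - 1) (m + 1)) := by
    intro m n hmn
    have hmn' : (m : ℝ) ≤ n := by exact_mod_cast hmn
    have hm : (0 : ℝ) ≤ m := m.cast_nonneg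
    refine ODE_solution_unique_of_mem_Ioo (v := fun _ => X) (s := fun _ => Set.univ) (K := K)
      (t₀ := 0) (fun _ _ => hX.lipschitzOnWith) ⟨by linarith, by linarith⟩
      (fun t ht => ⟨hc m t ht, trivial⟩)
      (fun t ht => ⟨hc n t ⟨by linarith [ht.1], by linarith [ht.2]⟩, trivial⟩) ?_
    rw [hc0, hc0]
  let d : ℝ → E := fun t => c ⌈|t|⌉₊ t
  have hd : ∀ n : ℕ, ∀ t ∈ Set.Ioo (-(n : ℝ) - 1) (n + 1), d t = c n t := by
    intro n t ht
    have habs : |t| < n + 1 := abs_lt.2 ⟨by linarith [ht.1], ht.2⟩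
    have ht2 : t ∈ Set.Ioo (-(⌈|t|⌉₊ : ℝ) - 1) (⌈|t|⌉₊ + 1) := by
      have := Nat.le_ceil |t|
      exact ⟨by linarith [neg_abs_le t], by linarith [le_abs_self t]⟩
    rcases le_total ⌈|t|⌉₊ n with h | h
    · exact hagree _ _ h ht2
    · exact (hagree _ _ h ht).symm
  refine ⟨d, ?_, fun t => ?_⟩
  · rw [hd 0 0 (by simp), hc0]
  · obtain ⟨n, hn⟩ := exists_nat_gt |t|
    have ht : t ∈ Set.Ioo (-(n : ℝ) - 1) (n + 1) :=
      ⟨by linarith [neg_abs_le t], by linarith [le_abs_self t]⟩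
    rw [hd n t ht]
    refine (hc n t ht).congr_of_eventuallyEq ?_
    filter_upwards [isOpen_Ioo.mem_nhds ht] with s hs using hd n s hs

/-- A closed orbit of small period of a Lipschitz vector field is constant. -/
theorem eq_zero_of_periodic_of_small [CompleteSpace E] {X : E → E} {K : NNReal}
    (hX : LipschitzWith K X) {κ T : ℝ} (hT : 0 < T) {b : ℝ → E}
    (hb : ∀ t, HasDerivAt b (κ • X (b t)) t) (hper : Function.Periodic b T)
    (hsmall : |κ| * K * T < 1) (t : ℝ) : κ • X (b t) = 0 := by
  have hcont : Continuous b := continuous_iff_continuousAt.2 fun t => (hb t).continuousAt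
  have hvc : Continuous fun t => κ • X (b t) := (hX.continuous.comp hcont).const_smul κ
  -- Start the period at a time of maximal speed m. Within one period the point moves by at most mT,
  -- so the velocity stays within |κ|K·mT of its initial value. The total displacement is zero,
  -- hence Tm ≤ |κ|K·mT·T, which forces m = 0.
  obtain ⟨t₀, ht₀, hmax⟩ := isCompact_Icc.exists_isMaxOn (Set.nonempty_Icc.2 hT.le)
    hvc.norm.continuousOn
  have hmax' : ∀ s, ‖κ • X (b s)‖ ≤ ‖κ • X (b t₀)‖ := by
    intro s
    obtain ⟨y, hy, hys⟩ := hper.exists_mem_Ico₀ hT s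
    rw [hys]
    exact hmax ⟨hy.1, hy.2.le⟩
  set m := ‖κ • X (b t₀)‖ with hm
  suffices h : m = 0 by
    have := hmax' t
    rw [h] at this
    exact norm_eq_zero.1 (le_antisymm this (norm_nonneg _))
  by_contra hne
  have hmpos : 0 < m := lt_of_le_of_ne (norm_nonneg _) (Ne.symm hne)
  have hdist : ∀ s ∈ Set.Icc t₀ (t₀ + T), ‖b s - b t₀‖ ≤ m * T := by
    intro s hs
    have := (convex_Icc t₀ (t₀ + T)).norm_image_sub_le_of_norm_hasDerivWithin_le
      (f := b) (f' := fun s => κ • X (b s)) (C := m) (x := t₀) (y := s)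
      (fun x _ => (hb x).hasDerivWithinAt) (fun x _ => hmax' x)
      ⟨le_rfl, by linarith⟩ hs
    refine this.trans (mul_le_mul_of_nonneg_left ?_ hmpos.le)
    rw [Real.norm_of_nonneg (by linarith [hs.1])]
    linarith [hs.2]
  have hdv : ∀ s ∈ Set.Icc t₀ (t₀ + T),
      ‖κ • X (b s) - κ • X (b t₀)‖ ≤ |κ| * K * (m * T) := by
    intro s hs
    rw [← smul_sub, norm_smul, Real.norm_eq_abs, mul_assoc]
    refine mul_le_mul_of_nonneg_left ?_ (abs_nonneg κ)
    refine (hX.norm_sub_le _ _).trans ?_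
    exact mul_le_mul_of_nonneg_left (hdist s hs) K.2
  have hend := (convex_Icc t₀ (t₀ + T)).norm_image_sub_le_of_norm_hasDerivWithin_le
      (f := fun s => b s - (s - t₀) • (κ • X (b t₀)))
      (f' := fun s => κ • X (b s) - κ • X (b t₀)) (C := |κ| * K * (m * T))
      (x := t₀) (y := t₀ + T)
      (fun x _ => by
        have h1 := ((hasDerivAt_id x).sub_const t₀).smul_const (κ • X (b t₀))
        rw [one_smul] at h1
        exact ((hb x).sub h1).hasDerivWithinAt) hdv
      ⟨le_rfl, by linarith⟩ ⟨by linarith, le_rfl⟩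
  rw [hper t₀] at hend
  simp only [add_sub_cancel_left, sub_self, zero_smul, sub_zero] at hend
  rw [sub_sub_cancel_left, norm_neg, norm_smul, Real.norm_of_nonneg hT.le, ← hm] at hend
  have h1 : T * m * (1 - |κ| * K * T) ≤ 0 := by linarith
  have h2 : 0 < T * m * (1 - |κ| * K * T) := mul_pos (mul_pos hT hmpos) (by linarith)
  linarith

end ODE

/-! ### Reeb trajectories -/

/-- The standing assumptions on `f` and `ε`. -/
structure Admissible (f : S2 → ℝ) (ε : ℝ) : Prop where
  smooth : ContMDiff (𝓡 2) 𝓘(ℝ, ℝ) ∞ f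
  half_le : ∀ x, 1 / 2 ≤ 1 + ε * smoothExt f x

section

variable {f : S2 → ℝ} {ε : ℝ}

theorem Admissible.ne (h : Admissible f ε) (x : E3) : 1 + ε * smoothExt f x ≠ 0 := by
  have := h.half_le x
  linarith

theorem Admissible.conf_ne (h : Admissible f ε) (z : C2) : conf f ε z ≠ 0 := h.ne _

theorem Admissible.half_le_conf (h : Admissible f ε) (z : C2) : 1 / 2 ≤ conf f ε z := h.half_le _

theorem isReebTrajectory_iff (h : Admissible f ε) (c : ℝ → S3) : IsReebTrajectory f ε c ↔
    ∀ t, HasDerivAt (fun s => (c s : C2)) (reebField f ε (c t)) t := by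
  refine forall_congr' fun t => ⟨?_, fun hd => ?_⟩
  · rintro ⟨v, hv, hr⟩
    rwa [← (isReebVector_iff h.smooth _ (h.conf_ne _) v).1 hr]
  · exact ⟨_, hd, isReebVector_reebField h.smooth _ (h.conf_ne _)⟩

theorem IsReebTrajectory.hasDerivAt (h : Admissible f ε) {c : ℝ → S3}
    (hc : IsReebTrajectory f ε c) (t : ℝ) :
    HasDerivAt (fun s => (c s : C2)) (reebField f ε (c t)) t :=
  (isReebTrajectory_iff h c).1 hc t

theorem exists_isReebTrajectory (h : Admissible f ε) (z : S3) :
    ∃ c, IsReebTrajectory f ε c ∧ c 0 = z := by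
  obtain ⟨K, hK⟩ := exists_lipschitz_reebField h.smooth h.ne
  obtain ⟨M, hM⟩ := (hasCompactSupport_reebField (f := f) (ε := ε)).exists_bound_of_continuous
    (contDiff_reebField h.smooth h.ne).continuous
  obtain ⟨c, hc0, hc⟩ := exists_global_solution hK (M := M.toNNReal)
    (fun x => (hM x).trans (Real.le_coe_toNNReal M)) (z : C2)
  have hnorm : ∀ t, ‖c t‖ ^ 2 = 1 := by
    have hd : ∀ t, HasDerivAt (fun s => ‖c s‖ ^ 2) 0 t := by
      intro t
      convert (hc t).norm_sq using 1
      have : inner ℝ (c t) (reebField f ε (c t)) = (inner ℂ (c t) (reebField f ε (c t))).re := by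
        simp [PiLp.inner_apply, Fin.sum_univ_two]
      rw [this, inner_reebField_re, mul_zero]
    intro t
    have := is_const_of_deriv_eq_zero (fun s => (hd s).differentiableAt) (fun s => (hd s).deriv) t 0
    simpa [hc0, norm_S3] using this
  refine ⟨fun t => ⟨c t, ?_⟩, (isReebTrajectory_iff h _).2 hc, Subtype.ext hc0⟩
  rw [mem_sphere_zero_iff_norm]
  exact (pow_eq_one_iff_of_nonneg (norm_nonneg _) two_ne_zero).1 (hnorm t)

theorem IsReebTrajectory.unique (h : Admissible f ε) {c d : ℝ → S3} (hc : IsReebTrajectory f ε c)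
    (hd : IsReebTrajectory f ε d) {t₀ : ℝ} (h0 : c t₀ = d t₀) : c = d := by
  obtain ⟨K, hK⟩ := exists_lipschitz_reebField h.smooth h.ne
  have := eq_of_hasDerivAt_of_lipschitz hK (hc.hasDerivAt h) (hd.hasDerivAt h)
    (congrArg Subtype.val h0)
  funext t
  exact Subtype.ext (congrFun this t)

/-- `reebFlow` picks a trajectory by choice; uniqueness makes the choice immaterial. -/
theorem reebFlow_eq (h : Admissible f ε) {c : ℝ → S3} (hc : IsReebTrajectory f ε c) (t : ℝ) :
    reebFlow f ε t (c 0) = c t := by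
  have hex : ∃ d, IsReebTrajectory f ε d ∧ d 0 = c 0 := ⟨c, hc, rfl⟩
  rw [reebFlow, dif_pos hex, hex.choose_spec.1.unique h hc hex.choose_spec.2]

theorem isReebTrajectory_reebFlow (h : Admissible f ε) (z : S3) :
    IsReebTrajectory f ε fun t => reebFlow f ε t z := by
  obtain ⟨c, hc, rfl⟩ := exists_isReebTrajectory h z
  simpa only [reebFlow_eq h hc] using hc

theorem reebFlow_zero (h : Admissible f ε) (z : S3) : reebFlow f ε 0 z = z := by
  obtain ⟨c, hc, rfl⟩ := exists_isReebTrajectory h z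
  rw [reebFlow_eq h hc]

theorem IsReebTrajectory.comp_add (h : Admissible f ε) {c : ℝ → S3} (hc : IsReebTrajectory f ε c)
    (s : ℝ) : IsReebTrajectory f ε fun t => c (t + s) := by
  rw [isReebTrajectory_iff h] at hc ⊢
  intro t
  exact (hc (t + s)).comp_add_const t s

theorem reebFactor_smul (c : ℂ) (hc : ‖c‖ = 1) (z : C2) :
    reebFactor f ε (c • z) = c • reebFactor f ε z := by
  have e : star c * c = 1 := by
    have := Complex.conj_mul' c
    rw [hc] at this
    simpa using this
  have h1 : hopfBilin (c • z) (c • z) = hopfBilin z z := by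
    rw [hopfBilin_smul_smul, e, one_smul]
  rw [reebFactor, reebFactor, conf, conf, h1, pauliMul_smul, smul_sub, smul_comm c, smul_comm c]

theorem reebField_smul (c : ℂ) (hc : ‖c‖ = 1) (z : C2) :
    reebField f ε (c • z) = c • reebField f ε z := by
  rw [reebField, reebField, reebFactor_smul c hc, norm_smul, hc, one_mul, smul_comm Complex.I c,
    smul_comm _ c]

/-- Equivariance of `hopfBilin` passes to its adjoint. The adjointness sees only real parts, and
replacing v by iv recovers the imaginary ones. -/
theorem pauliMul_toLin (A : SU2) (y : E3) (z : C2) :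
    pauliMul (toLin (cover A) y) (toLin A z) = toLin A (pauliMul y z) := by
  have hre : ∀ v, (inner ℂ v (pauliMul (toLin (cover A) y) (toLin A z))).re
      = (inner ℂ v (toLin A (pauliMul y z))).re := by
    intro v
    obtain ⟨w, rfl⟩ : ∃ w, v = toLin A w := ⟨toLin A⁻¹ v, (toLin_apply_inv A v).symm⟩
    rw [← inner_hopfBilin, hopfBilin_toLin, inner_toLin, inner_toLin, inner_hopfBilin]
  refine ext_inner_left ℂ fun v => Complex.ext (hre v) ?_
  have := hre (Complex.I • v)
  rw [inner_smul_left, inner_smul_left] at this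
  simpa using this

theorem reebField_toLin (h : Admissible f ε) {A : SU2} (hA : ∀ p, f (cover A • p) = f p) (z : C2) :
    reebField f ε (toLin A z) = toLin A (reebField f ε z) := by
  have h1 : conf f ε (toLin A z) = conf f ε z := by
    rw [conf, conf, hopfBilin_toLin, smoothExt_toLin hA]
  rw [reebField, reebField, reebFactor, reebFactor, h1, hopfBilin_toLin,
    gradExt_toLin h.smooth hA, pauliMul_toLin, norm_toLin]
  simp only [real_smul_C2, map_smul, map_sub]

theorem IsReebTrajectory.smul (h : Admissible f ε) {c : ℝ → S3} (hc : IsReebTrajectory f ε c)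
    {A : SU2} (hA : ∀ p, f (cover A • p) = f p) : IsReebTrajectory f ε fun t => A • c t := by
  rw [isReebTrajectory_iff h] at hc ⊢
  intro t
  have := ((toLin A).restrictScalars ℝ).hasFDerivAt.comp_hasDerivAt t (hc t)
  rw [coe_smul_sphere, reebField_toLin h hA]
  exact this

/-- The image of a Reeb trajectory in `S²` is a trajectory of a Hamiltonian field. -/
theorem IsReebTrajectory.hasDerivAt_hopf (h : Admissible f ε) {c : ℝ → S3}
    (hc : IsReebTrajectory f ε c) (t : ℝ) :
    HasDerivAt (fun s => (hopf (c s) : E3))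
      ((2 * ε / conf f ε (c t) ^ 2) • cross (hopf (c t) : E3) (gradExt f (hopf (c t)))) t := by
  have h1 := (hasFDerivAt_hopfBilin_self (c t : C2)).comp_hasDerivAt t (hc.hasDerivAt h t)
  rw [smul_apply, hopfBilin_reebField, smul_smul, ← mul_div_assoc] at h1
  have h2 : (fun s => (hopf (c s) : E3)) = (fun x => hopfBilin x x) ∘ fun s => (c s : C2) :=
    funext fun s => hopf_eq_hopfBilin _
  rw [h2]
  exact h1

theorem IsReebTrajectory.apply_hopf_eq (h : Admissible f ε) {c : ℝ → S3}
    (hc : IsReebTrajectory f ε c) (t : ℝ) : f (hopf (c t)) = f (hopf (c 0)) := by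
  have hd : ∀ t, HasDerivAt (fun s => f (hopf (c s))) 0 t := by
    intro t
    have h1 := (differentiable_smoothExt h.smooth (hopf (c t))).hasFDerivAt.comp_hasDerivAt t
      (hc.hasDerivAt_hopf h t)
    rw [map_smul, ← inner_gradExt] at h1
    have h2 : inner ℝ (gradExt f (hopf (c t))) (cross (hopf (c t) : E3) (gradExt f (hopf (c t))))
        = (0 : ℝ) := by
      rw [inner_E3, cross_apply']
      simp
      ring
    rw [h2, smul_zero] at h1
    refine h1.congr_of_eventuallyEq (Filter.Eventually.of_forall fun s => ?_)
    exact (smoothExt_coe f _).symm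
  exact is_const_of_deriv_eq_zero (fun s => (hd s).differentiableAt) (fun s => (hd s).deriv) t 0

theorem isReebTrajectory_phase (h : Admissible f ε) {z : S3} (hz : hopf z ∈ criticalPoints f) :
    IsReebTrajectory f ε fun t => phase (t / conf f ε z) z := by
  rw [isReebTrajectory_iff h]
  intro t
  rw [mem_criticalPoints_iff_gradExt h.smooth] at hz
  have hX : reebField f ε z = Complex.I • (conf f ε z)⁻¹ • (z : C2) := by
    rw [reebField_coe, reebFactor, ← hopf_eq_hopfBilin, hz]
    simp
  simp only [coe_phase]
  rw [reebField_smul _ (Complex.norm_exp_ofReal_mul_I _), hX]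
  have h1 : HasDerivAt (fun s : ℝ => (((s / conf f ε z : ℝ) : ℂ) * Complex.I))
      (((1 / conf f ε z : ℝ) : ℂ) * Complex.I) t :=
    (((hasDerivAt_id t).div_const _).ofReal_comp).mul_const _
  have h2 := (h1.cexp).smul_const (z : C2)
  refine h2.congr_deriv ?_
  rw [real_smul_C2, smul_smul, smul_smul]
  congr 1
  push_cast
  ring

/-- The reparametrised base field `x ↦ x × ∇f(x)`. -/
def baseField (f : S2 → ℝ) (x : E3) : E3 := cross x (gradExt f x)

theorem exists_lipschitz_baseField (hf : ContMDiff (𝓡 2) 𝓘(ℝ, ℝ) ∞ f) :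
    ∃ K, LipschitzWith K (baseField f) := by
  have hg : ContDiff ℝ ∞ (gradExt f) := contDiff_gradExt hf
  have hc : HasCompactSupport (gradExt f) := by
    have h1 : HasCompactSupport (fderiv ℝ (smoothExt f)) :=
      (hasCompactSupport_smoothExt f).fderiv ℝ
    exact h1.comp_left (g := gradCLM) (map_zero _)
  refine ContDiff.lipschitzWith_of_hasCompactSupport (n := ∞) (𝕂 := ℝ) ?_ ?_ (by simp)
  · refine hc.mono' ?_
    refine Set.Subset.trans ?_ subset_closure
    intro x hx h0
    apply hx
    rw [baseField, h0, cross_apply']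
    ext i
    fin_cases i <;> simp
  · have hgi : ∀ i : Fin 3, ContDiff ℝ ∞ fun x => gradExt f x i := contDiff_euclidean.1 hg
    have hxi : ∀ i : Fin 3, ContDiff ℝ ∞ fun x : E3 => x i := contDiff_euclidean.1 contDiff_id
    rw [contDiff_euclidean]
    intro i
    simp only [baseField, cross_apply']
    fin_cases i
    · exact ((hxi 1).mul (hgi 2)).sub ((hxi 2).mul (hgi 1))
    · exact ((hxi 2).mul (hgi 0)).sub ((hxi 0).mul (hgi 2))
    · exact ((hxi 0).mul (hgi 1)).sub ((hxi 1).mul (hgi 0))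

theorem cross_eq_zero_of_orthogonal {x y : E3} (hx : ‖x‖ = 1) (hxy : inner ℝ y x = (0 : ℝ))
    (h : cross x y = 0) : y = 0 := by
  have e : ‖y‖ ^ 2 * ‖x‖ ^ 2 = inner ℝ y x ^ 2 + ‖cross x y‖ ^ 2 := by
    rw [cross_apply', inner_E3, EuclideanSpace.norm_sq_eq, EuclideanSpace.norm_sq_eq,
      EuclideanSpace.norm_sq_eq]
    simp [Fin.sum_univ_three]
    ring
  rw [hx, hxy, h] at e
  simpa using e

/-- If the projection of a Reeb trajectory to `S²` closes up after a short time, it is a critical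
point. -/
theorem hopf_mem_criticalPoints_of_periodic (h : Admissible f ε) (hε : 0 < ε) {K : NNReal}
    (hK : LipschitzWith K (baseField f)) {c : ℝ → S3} (hc : IsReebTrajectory f ε c) {T : ℝ}
    (hT : 0 < T) (hper : Function.Periodic (fun t => hopf (c t)) T)
    (hsmall : 8 * ε * K * T < 1) : hopf (c 0) ∈ criticalPoints f := by
  set κ := 2 * ε / conf f ε (c 0) ^ 2 with hκ
  -- As f is conserved, the base curve is an orbit of `baseField` with a constant factor κ, which is
  -- at most 8ε because `conf` is at least 1/2.
  have hconf : ∀ t, conf f ε (c t) = conf f ε (c 0) := fun t => by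
    rw [conf_coe, conf_coe, hc.apply_hopf_eq h]
  have hhalf := h.half_le_conf (c 0)
  have hκ0 : 0 < κ := by positivity
  have hκ1 : κ ≤ 8 * ε := by
    rw [hκ, div_le_iff₀ (by positivity)]
    nlinarith [mul_nonneg hε.le (sub_nonneg.2 hhalf), mul_self_nonneg (conf f ε (c 0) - 1 / 2)]
  have hb : ∀ t, HasDerivAt (fun s => (hopf (c s) : E3)) (κ • baseField f (hopf (c t) : E3)) t := by
    intro t
    have := hc.hasDerivAt_hopf h t
    rwa [hconf t] at this
  have hs : |κ| * K * T < 1 := by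
    rw [abs_of_pos hκ0]
    refine lt_of_le_of_lt ?_ hsmall
    gcongr
  have h0 := eq_zero_of_periodic_of_small hK hT hb
    (fun t => congrArg Subtype.val (hper t)) hs 0
  rw [smul_eq_zero, or_iff_right hκ0.ne'] at h0
  rw [mem_criticalPoints_iff_gradExt h.smooth]
  exact cross_eq_zero_of_orthogonal (norm_S2 _) (inner_gradExt_self h.smooth _) h0

end

/-! ### The derivative of a flow at an equilibrium -/

section ODE

variable {E : Type*} [NormedAddCommGroup E] [NormedSpace ℝ E]

theorem gronwallBound_zero_eq_mul (K η x : ℝ) :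
    gronwallBound 0 K η x = η * gronwallBound 0 K 1 x := by
  rw [gronwallBound, gronwallBound]
  split_ifs
  · ring
  · ring

variable [CompleteSpace E]

theorem hasDerivAt_exp_smul_apply (B : E →L[ℝ] E) (v : E) (t : ℝ) :
    HasDerivAt (fun s : ℝ => NormedSpace.exp (s • B) v) (B (NormedSpace.exp (t • B) v)) t := by
  have h := (hasDerivAt_exp_smul_const' B t).clm_apply (hasDerivAt_const t v)
  refine h.congr_deriv ?_
  simp

theorem exp_smul_apply_eq (B : E →L[ℝ] E) {u : ℝ → E} (hu : ∀ t, HasDerivAt u (B (u t)) t) (t : ℝ) :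
    NormedSpace.exp (t • B) (u 0) = u t := by
  refine congrFun (eq_of_hasDerivAt_of_lipschitz B.lipschitz
    (hasDerivAt_exp_smul_apply B (u 0)) hu (t₀ := 0) ?_) t
  simp

/-- A first Grönwall estimate keeps the trajectory within e^{Kt}|y − z| of the equilibrium, so X
differs from its linearisation by at most η e^{Kt}|y − z| along it. A second one bounds the distance
to exp(tB)(y − z). The derivative is taken within `S`, since Ψ is tied to trajectories only there;
the application has `S` the unit sphere. -/
theorem hasFDerivWithinAt_flow_of_equilibrium {X : E → E} {K : NNReal} (hX : LipschitzWith K X)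
    {z : E} (hz : X z = 0) {B : E →L[ℝ] E} (hB : HasFDerivAt X B z) {t : ℝ} (ht : 0 ≤ t)
    {S : Set E} {Ψ : E → E}
    (hΨ : ∀ y ∈ S, ∃ d : ℝ → E, d 0 = y ∧ d t = Ψ y ∧ ∀ s, HasDerivAt d (X (d s)) s)
    (hzS : Ψ z = z) : HasFDerivWithinAt Ψ (NormedSpace.exp (t • B)) S z := by
  rw [hasFDerivWithinAt_iff_isLittleO, Asymptotics.isLittleO_iff]
  intro δ hδ
  -- C is the final error per unit of η and of |y − z|; dividing δ by C + 1 instead of C avoids the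
  -- case C = 0.
  set C := Real.exp (K * t) * gronwallBound 0 ‖B‖ 1 t with hC
  have hC0 : 0 ≤ C := by
    have h1 : gronwallBound 0 ‖B‖ 1 0 ≤ gronwallBound 0 ‖B‖ 1 t :=
      gronwallBound_mono le_rfl zero_le_one (norm_nonneg _) ht
    rw [gronwallBound_x0] at h1
    positivity
  set η := δ / (C + 1) with hη
  have hη0 : 0 < η := by positivity
  have hηC : η * C ≤ δ := by
    rw [hη, div_mul_eq_mul_div, div_le_iff₀ (by positivity)]
    nlinarith
  have hlin := (hasFDerivAt_iff_isLittleO.1 hB).def hη0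
  obtain ⟨r, hr, hball⟩ := Metric.eventually_nhds_iff.1 hlin
  have hnear : ∀ᶠ y in 𝓝[S] z, y ∈ S ∧ ‖y - z‖ * Real.exp (K * t) < r := by
    refine eventually_mem_nhdsWithin.and (Filter.Eventually.filter_mono nhdsWithin_le_nhds ?_)
    have hc : ContinuousAt (fun y => ‖y - z‖ * Real.exp (K * t)) z := by fun_prop
    exact hc.eventually_lt continuousAt_const (by simpa using hr)
  filter_upwards [hnear] with y hy
  obtain ⟨hyS, hyr⟩ := hy
  obtain ⟨d, hd0, hdt, hd⟩ := hΨ y hyS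
  have hdc : Continuous d := continuous_iff_continuousAt.2 fun s => (hd s).continuousAt
  have hk : ∀ s ∈ Set.Icc 0 t, ‖d s - z‖ ≤ ‖y - z‖ * Real.exp (K * t) := by
    intro s hs
    have h1 := dist_le_of_trajectories_ODE (v := fun _ => X) (K := K) (f := d) (g := fun _ => z)
      (a := 0) (b := t) (δ := ‖y - z‖) (fun _ => hX) hdc.continuousOn
      (fun s _ => (hd s).hasDerivWithinAt) continuousOn_const
      (fun s _ => by rw [hz]; exact (hasDerivAt_const s z).hasDerivWithinAt)
      (by rw [hd0, dist_eq_norm]) s hs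
    rw [dist_eq_norm] at h1
    refine h1.trans (mul_le_mul_of_nonneg_left (Real.exp_le_exp.2 ?_) (norm_nonneg _))
    exact mul_le_mul_of_nonneg_left (by linarith [hs.2]) K.2
  have he := norm_le_gronwallBound_of_norm_deriv_right_le
    (f := fun s => d s - z - NormedSpace.exp (s • B) (y - z))
    (f' := fun s => X (d s) - B (NormedSpace.exp (s • B) (y - z)))
    (δ := 0) (K := ‖B‖) (ε := η * (‖y - z‖ * Real.exp (K * t))) (a := 0) (b := t)
    (fun s _ => (((hd s).sub_const z).sub
      (hasDerivAt_exp_smul_apply B (y - z) s)).continuousAt.continuousWithinAt)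
    (fun s _ => (((hd s).sub_const z).sub
      (hasDerivAt_exp_smul_apply B (y - z) s)).hasDerivWithinAt)
    (by simp [hd0]) (by
      intro s hs
      have hs' : s ∈ Set.Icc 0 t := ⟨hs.1, hs.2.le⟩
      have h1 : ‖X (d s) - X z - B (d s - z)‖ ≤ η * ‖d s - z‖ := hball (by
        rw [dist_eq_norm]
        exact (hk s hs').trans_lt hyr)
      rw [hz, sub_zero] at h1
      have e : X (d s) - B (NormedSpace.exp (s • B) (y - z))
          = B (d s - z - NormedSpace.exp (s • B) (y - z)) + (X (d s) - B (d s - z)) := by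
        rw [map_sub B (d s - z)]
        abel
      rw [e]
      refine (norm_add_le _ _).trans (add_le_add (B.le_opNorm _) (h1.trans ?_))
      exact mul_le_mul_of_nonneg_left (hk s hs') hη0.le) t ⟨ht, le_rfl⟩
  rw [gronwallBound_zero_eq_mul, sub_zero, hdt] at he
  rw [hzS]
  refine he.trans ?_
  calc η * (‖y - z‖ * Real.exp (K * t)) * gronwallBound 0 ‖B‖ 1 t
      = η * C * ‖y - z‖ := by rw [hC]; ring
    _ ≤ δ * ‖y - z‖ := mul_le_mul_of_nonneg_right hηC (norm_nonneg _)

end ODE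

/-! ### The linearised Reeb flow over a critical point -/

theorem inner_pauliMul_pauliMul_re (z : S3) (x y : E3) :
    (inner ℂ (pauliMul x z) (pauliMul y z)).re = inner ℝ x y := by
  have h := congrArg Complex.re (S3_star_mul z)
  simp at h
  rw [inner_C2, inner_E3, pauliMul_apply, pauliMul_apply]
  simp
  linear_combination (x 0 * y 0 + x 1 * y 1 + x 2 * y 2) * h

theorem norm_frame_zero (z : S3) : ‖frame z 0‖ = 1 := by
  have h := congrArg Complex.re (inner_frame_zero z)
  rw [inner_self_eq_norm_sq_to_K] at h
  have h2 : ‖frame z 0‖ ^ 2 = 1 := by simpa [← Complex.ofReal_pow] using h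
  exact (pow_eq_one_iff_of_nonneg (norm_nonneg _) two_ne_zero).1 h2

theorem inner_frame_re (z : S3) (i j : Fin 2) :
    (inner ℂ (frame z i) (frame z j)).re = if i = j then 1 else 0 := by
  fin_cases i <;> fin_cases j <;>
    simp [frame_one, norm_frame_zero, norm_smul]

/-- Parseval's identity in the tangent plane of `S²`. -/
theorem inner_eq_sum_baseFrame (z : S3) {x y : E3} (hx : inner ℝ (hopf z : E3) x = 0)
    (hy : inner ℝ (hopf z : E3) y = 0) :
    inner ℝ x y = inner ℝ (baseFrame z 0) x * inner ℝ (baseFrame z 0) y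
      + inner ℝ (baseFrame z 1) x * inner ℝ (baseFrame z 1) y := by
  rw [← inner_pauliMul_pauliMul_re z, pauliMul_eq_frame z x hx, pauliMul_eq_frame z y hy]
  simp only [real_smul_C2, inner_add_left, inner_add_right, inner_smul_left, inner_smul_right,
    Complex.conj_ofReal, Complex.add_re, Complex.re_ofReal_mul, inner_frame_re]
  simp
  ring

section

variable {f : S2 → ℝ} {ε : ℝ}

/-- The Reeb field in a frame rotating with speed `1 / g`. -/
def rotatingField (f : S2 → ℝ) (ε g : ℝ) (x : C2) : C2 := reebField f ε x - g⁻¹ • Complex.I • x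

theorem exists_lipschitz_rotatingField (h : Admissible f ε) (g : ℝ) :
    ∃ K, LipschitzWith K (rotatingField f ε g) := by
  obtain ⟨K, hK⟩ := exists_lipschitz_reebField h.smooth h.ne
  let L : C2 →L[ℝ] C2 := g⁻¹ • (Complex.I • ContinuousLinearMap.id ℂ C2).restrictScalars ℝ
  exact ⟨_, hK.sub L.lipschitz⟩

theorem rotatingField_coe {z : S3} (hz : gradExt f (hopf z) = 0) :
    rotatingField f ε (conf f ε z) z = 0 := by
  rw [rotatingField, reebField_coe, reebFactor, ← hopf_eq_hopfBilin, hz]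
  simp only [map_zero, zero_apply, smul_zero, sub_zero]
  rw [smul_comm, sub_self]

/-- Where the gradient vanishes `conf` is stationary, and the two Hopf rotations cancel. Only the
derivative of the gradient survives, with a factor 2 from differentiating the quadratic Hopf map. -/
theorem exists_hasFDerivAt_rotatingField (h : Admissible f ε) {z : S3} {H : E3 →L[ℝ] E3}
    (hz : gradExt f (hopf z) = 0) (hH : HasFDerivAt (gradExt f) H (hopf z : E3)) :
    ∃ B : C2 →L[ℝ] C2, HasFDerivAt (rotatingField f ε (conf f ε z)) B z ∧
      ∀ v, B v = -(2 * ε / conf f ε z ^ 2) • Complex.I • pauliMul (H (hopfBilin z v)) z := by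
  have hconf : HasFDerivAt (conf f ε) (0 : C2 →L[ℝ] ℝ) z := by
    have h1 := ((contDiff_conf (ε := ε) h.smooth).differentiable (by simp) (z : C2)).hasFDerivAt
    refine h1.congr_fderiv ?_
    ext1 v
    rw [fderiv_conf h.smooth, ← hopf_eq_hopfBilin, hz]
    simp
  have h1 : HasFDerivAt (fun x => (conf f ε x)⁻¹) (0 : C2 →L[ℝ] ℝ) (z : C2) := by
    have := (hasDerivAt_inv (h.conf_ne z)).comp_hasFDerivAt (z : C2) hconf
    exact this.congr_fderiv (by simp)
  have h2 : HasFDerivAt (fun x => ε / conf f ε x ^ 2) (0 : C2 →L[ℝ] ℝ) (z : C2) := by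
    have := (h1.pow 2).const_mul ε
    refine (this.congr_fderiv (by simp)).congr_of_eventuallyEq
      (Filter.Eventually.of_forall fun x => ?_)
    simp [div_eq_mul_inv]
  have h3 : HasFDerivAt (fun x => gradExt f (hopfBilin x x)) (H.comp ((2 : ℝ) • hopfBilin z))
      (z : C2) := by
    rw [hopf_eq_hopfBilin] at hH
    exact HasFDerivAt.comp (g := gradExt f) (f := fun x => hopfBilin x x) (z : C2) hH
      (hasFDerivAt_hopfBilin_self _)
  have h4 := pauliMul.hasFDerivAt_of_bilinear h3 (hasFDerivAt_id (z : C2))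
  have h5 := (h1.smul (hasFDerivAt_id (z : C2))).sub (h2.smul h4)
  have h6 := (h5.const_smul Complex.I).sub
    (((hasFDerivAt_id (𝕜 := ℝ) (z : C2)).const_smul Complex.I).const_smul (conf f ε z)⁻¹)
  have h7 := h6.congr_of_eventuallyEq (f₁ := rotatingField f ε (conf f ε z)) (by
    filter_upwards [sphereBump_eventually_eq_one (norm_S3 z)] with x hx
    rw [rotatingField, reebField, hx, one_smul]
    rfl)
  refine ⟨_, h7, fun v => ?_⟩
  simp [← hopf_eq_hopfBilin, hz, smul_sub, smul_comm Complex.I, smul_smul]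
  congr 1
  ring

/-- V₁ is conjugate-linear in the point, so the frame turns by −θ while the Hopf action turns
vectors by +θ. This is the source of the doubled angle 2t/g in `flowMatrix_apply`. -/
theorem frame_phase (θ : ℝ) (z : S3) (j : Fin 2) :
    frame (phase θ z) j = Complex.exp (-(θ * Complex.I)) • frame z j := by
  have h0 : frame (phase θ z) 0 = Complex.exp (-(θ * Complex.I)) • frame z 0 := by
    rw [frame_zero, frame_zero]
    ext i
    fin_cases i <;> simp [coe_phase, ← Complex.exp_conj]
  fin_cases j
  · exact h0
  · change frame (phase θ z) 1 = _ • frame z 1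
    rw [frame_one, frame_one, h0, smul_comm]

theorem hasFDerivAt_normalize (z : S3) : ∃ D : C2 →L[ℝ] C2,
    HasFDerivAt (fun x : C2 => ‖x‖⁻¹ • x) D z ∧ ∀ v, (inner ℂ (z : C2) v).re = 0 → D v = v := by
  have h1 := (hasStrictFDerivAt_norm_sq (z : C2)).hasFDerivAt.sqrt (by simp)
  have h2 : HasFDerivAt (fun x : C2 => ‖x‖) _ (z : C2) :=
    h1.congr_of_eventuallyEq (Filter.Eventually.of_forall fun x =>
      (Real.sqrt_sq (norm_nonneg x)).symm)
  have h3 := ((hasDerivAt_inv (by rw [norm_S3]; exact one_ne_zero :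
    ‖(z : C2)‖ ≠ 0)).comp_hasFDerivAt _ h2).smul (hasFDerivAt_id (z : C2))
  refine ⟨_, h3, fun v hv => ?_⟩
  have : inner ℝ (z : C2) v = (inner ℂ (z : C2) v).re := by
    simp [PiLp.inner_apply, Fin.sum_univ_two]
  simp [this, hv]

theorem reebFlow_eq_phase (h : Admissible f ε) {z : S3} (hz : hopf z ∈ criticalPoints f) (t : ℝ) :
    reebFlow f ε t z = phase (t / conf f ε z) z := by
  have := reebFlow_eq h (isReebTrajectory_phase h hz) t
  simpa [phase_zero] using this

/-- In coordinates rotating at speed 1/g the point `z` is an equilibrium, so the time-t map has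
derivative exp(tB) along the sphere. The radial extension precomposes with normalisation, whose
derivative is the identity on tangent vectors. -/
theorem linearizedFlow_apply (h : Admissible f ε) {z : S3} (hz : hopf z ∈ criticalPoints f)
    {B : C2 →L[ℝ] C2} (hB : HasFDerivAt (rotatingField f ε (conf f ε z)) B z) {t : ℝ} (ht : 0 ≤ t)
    {v : C2} (hv : (inner ℂ (z : C2) v).re = 0) :
    linearizedFlow f ε t z v
      = Complex.exp ((t / conf f ε z : ℝ) * Complex.I) • NormedSpace.exp (t • B) v := by
  obtain ⟨K, hK⟩ := exists_lipschitz_rotatingField h (conf f ε z)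
  have hz0 := rotatingField_coe (ε := ε) ((mem_criticalPoints_iff_gradExt h.smooth _).1 hz)
  obtain ⟨D, hD, hDv⟩ := hasFDerivAt_normalize z
  set g := conf f ε z with hg
  let E : ℝ → ℂ := fun s => Complex.exp (-((s / g : ℝ) * Complex.I))
  have hE : ∀ s, ‖E s‖ = 1 := fun s => by
    have := Complex.norm_exp_ofReal_mul_I (-(s / g))
    simpa [E] using this
  have hE2 : ∀ s : ℝ, Complex.exp ((s / g : ℝ) * Complex.I) * E s = 1 := fun s => by
    rw [← Complex.exp_add, add_neg_cancel, Complex.exp_zero]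
  let Ψ : C2 → C2 := fun y => E t • radialExtension (fun y : S3 => (reebFlow f ε t y : C2)) y
  have hΨ : ∀ y ∈ Metric.sphere (0 : C2) 1, ∃ d : ℝ → C2, d 0 = y ∧ d t = Ψ y ∧
      ∀ s, HasDerivAt d (rotatingField f ε g (d s)) s := by
    intro y hy
    refine ⟨fun s => E s • (reebFlow f ε s ⟨y, hy⟩ : C2), ?_, ?_, fun s => ?_⟩
    · simp [E, reebFlow_zero h]
    · simp only [Ψ]
      rw [← radialExtension_coe (fun y : S3 => (reebFlow f ε t y : C2)) ⟨y, hy⟩]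
    · have h1 := (isReebTrajectory_reebFlow h ⟨y, hy⟩).hasDerivAt h s
      have h2 : HasDerivAt E (E s * (-(((1 / g : ℝ) : ℂ) * Complex.I))) s :=
        ((((hasDerivAt_id s).div_const g).ofReal_comp).mul_const Complex.I).neg.cexp
      refine (h2.smul h1).congr_deriv ?_
      rw [rotatingField, reebField_smul _ (hE s), real_smul_C2, smul_smul, smul_smul,
        sub_eq_add_neg, ← neg_smul]
      congr 2
      push_cast
      ring
  have hΨz : Ψ z = z := by
    simp only [Ψ]
    rw [radialExtension_coe (fun y : S3 => (reebFlow f ε t y : C2)) z, reebFlow_eq_phase h hz,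
      coe_phase, smul_smul, mul_comm, hE2, one_smul]
  have h1 := hasFDerivWithinAt_flow_of_equilibrium hK hz0 hB ht hΨ hΨz
  have hzn : ‖(z : C2)‖⁻¹ • (z : C2) = z := by rw [norm_S3, inv_one, one_smul]
  have h2 : HasFDerivAt (Ψ ∘ fun x : C2 => ‖x‖⁻¹ • x) ((NormedSpace.exp (t • B)).comp D) (z : C2) := by
    have hev : ∀ᶠ x in 𝓝 (z : C2), ‖x‖⁻¹ • x ∈ Metric.sphere (0 : C2) 1 := by
      filter_upwards [isOpen_ne.mem_nhds (S3_ne_zero z)] with x hx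
      have : x ≠ 0 := hx
      simp [norm_smul, this]
    rw [← hzn] at h1
    exact HasFDerivWithinAt.comp_hasFDerivAt (z : C2) h1 hD hev
  have h3 : HasFDerivAt (radialExtension fun y : S3 => (reebFlow f ε t y : C2))
      ((Complex.exp ((t / g : ℝ) * Complex.I)) • ((NormedSpace.exp (t • B)).comp D)) (z : C2) := by
    refine (h2.const_smul (Complex.exp ((t / g : ℝ) * Complex.I))).congr_of_eventuallyEq ?_
    filter_upwards [isOpen_ne.mem_nhds (S3_ne_zero z)] with x hx
    have hx' : x ≠ 0 := hx
    have hs : ‖x‖⁻¹ • x ∈ Metric.sphere (0 : C2) 1 := by simp [norm_smul, hx']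
    change _ = Complex.exp ((t / g : ℝ) * Complex.I) • E t •
      radialExtension (fun y : S3 => (reebFlow f ε t y : C2)) (‖x‖⁻¹ • x)
    rw [smul_smul, hE2, one_smul, radialExtension_of_ne _ hx']
    exact (radialExtension_coe (fun y : S3 => (reebFlow f ε t y : C2)) ⟨_, hs⟩).symm
  rw [linearizedFlow, h3.fderiv]
  simp [hDv v hv]

theorem flowMatrix_apply (h : Admissible f ε) {z : S3} (hz : hopf z ∈ criticalPoints f)
    {B : C2 →L[ℝ] C2} (hB : HasFDerivAt (rotatingField f ε (conf f ε z)) B z) {t : ℝ} (ht : 0 ≤ t)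
    (i j : Fin 2) : flowMatrix f ε z t i j =
      (inner ℂ (frame z i) (Complex.exp ((2 * t / conf f ε z : ℝ) * Complex.I) •
        NormedSpace.exp (t • B) (frame z j))).re := by
  have hj : (inner ℂ (z : C2) (frame z j)).re = 0 := by
    fin_cases j <;> simp [frame_one, inner_self_frame_zero]
  rw [flowMatrix, Matrix.of_apply, linearizedFlow_apply h hz hB ht hj, reebFlow_eq_phase h hz,
    frame_phase, inner_smul_left, inner_smul_right, inner_smul_right, ← mul_assoc,
    ← Complex.exp_conj, ← Complex.exp_add]
  congr 4
  simp
  ring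

/-- The rotation matrix of angle `φ`. -/
def rotMat (φ : ℝ) : Matrix (Fin 2) (Fin 2) ℝ :=
  !![Real.cos φ, -Real.sin φ; Real.sin φ, Real.cos φ]

theorem inner_frame_exp_smul (z : S3) (φ x y : ℝ) (i : Fin 2) :
    (inner ℂ (frame z i) (Complex.exp (φ * Complex.I) • (x • frame z 0 + y • frame z 1))).re
      = (rotMat φ *ᵥ ![x, y]) i := by
  rw [frame_one, real_smul_C2, real_smul_C2, inner_smul_right, inner_add_right, inner_smul_right,
    inner_smul_right, inner_smul_right]
  have h := inner_frame_zero z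
  fin_cases i
  · simp only [Fin.zero_eta, h]
    simp [rotMat, Matrix.mulVec, dotProduct, Fin.sum_univ_two, Complex.exp_ofReal_mul_I_re,
      Complex.exp_ofReal_mul_I_im]
    ring
  · simp only [Fin.mk_one, frame_one, inner_smul_left, h]
    simp [rotMat, Matrix.mulVec, dotProduct, Fin.sum_univ_two, Complex.exp_ofReal_mul_I_re,
      Complex.exp_ofReal_mul_I_im]
    ring

/-- The linearisation in the rotating frame, expressed in the frame `V₁, V₂`. -/
theorem exists_linearization (h : Admissible f ε) {z : S3} (hz : hopf z ∈ criticalPoints f)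
    {a b c : ℝ} {τ₀ τ₁ : E3} (hq : HasQuadraticForm f (hopf z) a b c τ₀ τ₁) :
    ∃ B : C2 →L[ℝ] C2, HasFDerivAt (rotatingField f ε (conf f ε z)) B z ∧ ∀ k,
      B (frame z k) = -(ε / (2 * conf f ε z ^ 2)) • Complex.I •
        ((a * inner ℝ (baseFrame z 0) τ₀ * inner ℝ (baseFrame z k) τ₀
            + b * inner ℝ (baseFrame z 0) τ₁ * inner ℝ (baseFrame z k) τ₁) • frame z 0
          + (a * inner ℝ (baseFrame z 1) τ₀ * inner ℝ (baseFrame z k) τ₀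
            + b * inner ℝ (baseFrame z 1) τ₁ * inner ℝ (baseFrame z k) τ₁) • frame z 1) := by
  obtain ⟨B, hB, hBv⟩ := exists_hasFDerivAt_rotatingField h
    ((mem_criticalPoints_iff_gradExt h.smooth _).1 hz) hq.hess
  refine ⟨B, hB, fun k => ?_⟩
  rw [hBv]
  have e : ((a / 4) • (innerSL ℝ τ₀).smulRight τ₀ + (b / 4) • (innerSL ℝ τ₁).smulRight τ₁)
      (hopfBilin z (frame z k)) = (a / 4 * inner ℝ (baseFrame z k) τ₀) • τ₀
        + (b / 4 * inner ℝ (baseFrame z k) τ₁) • τ₁ := by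
    simp [smul_smul, baseFrame, real_inner_comm]
  rw [e, map_add, map_smul, map_smul, add_apply, smul_apply, smul_apply,
    pauliMul_eq_frame z τ₀ hq.tangent₀, pauliMul_eq_frame z τ₁ hq.tangent₁]
  simp only [real_smul_C2, smul_add, smul_smul]
  rw [add_add_add_comm, ← add_smul, ← add_smul]
  congr 2 <;>
  · push_cast
    field_simp
    ring

/-- An isotropic Hessian commutes with i, so B is multiplication by −iν with ν = aε/(2g²), and
exp(tB) only corrects the speed 2/g of the rotation. -/
theorem flowMatrix_elliptic (h : Admissible f ε) {z : S3} (hz : hopf z ∈ criticalPoints f)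
    {a c : ℝ} {τ₀ τ₁ : E3} (hq : HasQuadraticForm f (hopf z) a a c τ₀ τ₁) {t : ℝ} (ht : 0 ≤ t) :
    flowMatrix f ε z t
      = rotMat ((2 / (1 + ε * c) - a * ε / (2 * (1 + ε * c) ^ 2)) * t) := by
  obtain ⟨B, hB, hBk⟩ := exists_linearization h hz hq
  have hg : conf f ε z = 1 + ε * c := by rw [conf_coe, hq.value]
  set ν := a * ε / (2 * conf f ε z ^ 2) with hν
  set m : Matrix (Fin 2) (Fin 2) ℝ := Matrix.of fun i j => inner ℝ (baseFrame z j) (![τ₀, τ₁] i) with hm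
  -- τ₀, τ₁ and `baseFrame` are orthonormal frames of one plane (Parseval gives m mᵀ = 1), so a
  -- multiple of the identity in one frame is the same multiple in the other.
  have hmm : mᵀ * m = 1 := by
    rw [mul_eq_one_comm]
    ext i j
    have p00 := inner_eq_sum_baseFrame z hq.tangent₀ hq.tangent₀
    have p01 := inner_eq_sum_baseFrame z hq.tangent₀ hq.tangent₁
    have p11 := inner_eq_sum_baseFrame z hq.tangent₁ hq.tangent₁
    rw [hq.norm₀] at p00
    rw [hq.orth] at p01
    rw [hq.norm₁] at p11
    fin_cases i <;> fin_cases j <;> simp [Matrix.mul_apply, Fin.sum_univ_two, m] <;> linarith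
  have m00 := congrFun (congrFun hmm 0) 0
  have m01 := congrFun (congrFun hmm 0) 1
  have m11 := congrFun (congrFun hmm 1) 1
  simp [Matrix.mul_apply, Fin.sum_univ_two, m] at m00 m01 m11
  have hB' : ∀ k, B (frame z k) = (-(ν * Complex.I)) • frame z k := by
    intro k
    rw [hBk]
    fin_cases k
    · have e1 : a * inner ℝ (baseFrame z 0) τ₀ * inner ℝ (baseFrame z 0) τ₀
            + a * inner ℝ (baseFrame z 0) τ₁ * inner ℝ (baseFrame z 0) τ₁ = a := by
        linear_combination a * m00
      have e2 : a * inner ℝ (baseFrame z 1) τ₀ * inner ℝ (baseFrame z 0) τ₀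
            + a * inner ℝ (baseFrame z 1) τ₁ * inner ℝ (baseFrame z 0) τ₁ = 0 := by
        linear_combination a * m01
      simp only [Fin.zero_eta, e1, e2, real_smul_C2, smul_smul]
      simp only [Complex.ofReal_zero, zero_smul, add_zero, smul_smul]
      congr 1
      rw [hν]
      push_cast
      ring
    · have e1 : a * inner ℝ (baseFrame z 0) τ₀ * inner ℝ (baseFrame z 1) τ₀
            + a * inner ℝ (baseFrame z 0) τ₁ * inner ℝ (baseFrame z 1) τ₁ = 0 := by
        linear_combination a * m01
      have e2 : a * inner ℝ (baseFrame z 1) τ₀ * inner ℝ (baseFrame z 1) τ₀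
            + a * inner ℝ (baseFrame z 1) τ₁ * inner ℝ (baseFrame z 1) τ₁ = a := by
        linear_combination a * m11
      simp only [Fin.mk_one, e1, e2, real_smul_C2, smul_smul]
      simp only [Complex.ofReal_zero, zero_smul, zero_add, smul_smul]
      congr 1
      rw [hν]
      push_cast
      ring
  have hBc : ∀ w : ℂ, B (w • frame z 0) = (-(ν * Complex.I)) • w • frame z 0 := by
    intro w
    have hw : w • frame z 0 = w.re • frame z 0 + w.im • frame z 1 := by
      rw [frame_one, real_smul_C2, real_smul_C2, smul_smul, ← add_smul, Complex.re_add_im]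
    rw [hw, map_add, map_smul, map_smul, hB', hB', smul_add, smul_comm, smul_comm w.im]
  have hexp : ∀ k, NormedSpace.exp (t • B) (frame z k)
      = Complex.exp (-((ν * t : ℝ) * Complex.I)) • frame z k := by
    intro k
    obtain ⟨w, hw⟩ : ∃ w : ℂ, frame z k = w • frame z 0 := by
      fin_cases k
      · exact ⟨1, (one_smul _ _).symm⟩
      · exact ⟨Complex.I, frame_one z⟩
    have hu : ∀ s : ℝ, HasDerivAt (fun s : ℝ => Complex.exp (-((ν * s : ℝ) * Complex.I)) • frame z k)
        (B (Complex.exp (-((ν * s : ℝ) * Complex.I)) • frame z k)) s := by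
      intro s
      have h2 : HasDerivAt (fun s : ℝ => Complex.exp (-((ν * s : ℝ) * Complex.I)))
          (Complex.exp (-((ν * s : ℝ) * Complex.I)) * (-(((ν * 1 : ℝ) : ℂ) * Complex.I))) s :=
        ((((hasDerivAt_id s).const_mul ν).ofReal_comp).mul_const Complex.I).neg.cexp
      refine (h2.smul_const (frame z k)).congr_deriv ?_
      rw [hw, smul_smul, smul_smul, hBc, smul_smul]
      congr 1
      push_cast
      ring
    have := exp_smul_apply_eq B hu t
    simpa using this
  ext i j
  rw [flowMatrix_apply h hz hB ht, hexp, smul_smul, ← Complex.exp_add, inner_smul_right]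
  have harg : ((2 * t / conf f ε z : ℝ) : ℂ) * Complex.I + -((ν * t : ℝ) * Complex.I)
      = (((2 / (1 + ε * c) - a * ε / (2 * (1 + ε * c) ^ 2)) * t : ℝ) : ℂ) * Complex.I := by
    rw [hν, hg]
    push_cast
    ring
  rw [harg]
  fin_cases i <;> fin_cases j <;>
    simp [rotMat, frame_one, inner_smul_left, inner_smul_right, norm_frame_zero, norm_smul,
      Complex.exp_ofReal_mul_I_re, Complex.exp_ofReal_mul_I_im, -Complex.ofReal_mul,
      -Complex.ofReal_sub, -Complex.ofReal_div]

/-- In `baseFrame` the form with a, b = 1, −1 has matrix (q r; r −q), a reflection because q² + r² =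
1. Multiplication by −i turns it into another reflection S with S² = 1, so exp(uS) = cosh u + sinh u
· S. The speed of the rotation is exactly 2 because f vanishes at the saddle. -/
theorem flowMatrix_hyperbolic (h : Admissible f ε) {z : S3} (hz : hopf z ∈ criticalPoints f)
    {τ₀ τ₁ : E3} (hq : HasQuadraticForm f (hopf z) 1 (-1) 0 τ₀ τ₁) :
    ∃ q r : ℝ, q ^ 2 + r ^ 2 = 1 ∧ ∀ t, 0 ≤ t → flowMatrix f ε z t
      = rotMat (2 * t) * (Real.cosh (ε / 2 * t) • 1 + Real.sinh (ε / 2 * t) • !![r, -q; -q, -r]) := by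
  obtain ⟨B, hB, hBk⟩ := exists_linearization h hz hq
  have hg : conf f ε z = 1 := by rw [conf_coe, hq.value]; ring
  have p00 := inner_eq_sum_baseFrame z hq.tangent₀ hq.tangent₀
  have p01 := inner_eq_sum_baseFrame z hq.tangent₀ hq.tangent₁
  have p11 := inner_eq_sum_baseFrame z hq.tangent₁ hq.tangent₁
  rw [hq.norm₀] at p00
  rw [hq.orth] at p01
  rw [hq.norm₁] at p11
  have hB0 := hBk 0
  have hB1 := hBk 1
  clear hBk
  set x₀ := inner ℝ (baseFrame z 0) τ₀
  set x₁ := inner ℝ (baseFrame z 1) τ₀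
  set y₀ := inner ℝ (baseFrame z 0) τ₁
  set y₁ := inner ℝ (baseFrame z 1) τ₁
  set q := x₀ * x₀ - y₀ * y₀ with hq'
  set r := x₀ * x₁ - y₀ * y₁ with hr'
  set s := ε / 2 with hs
  have hq2 : x₁ * x₁ - y₁ * y₁ = -q := by linear_combination p11 - p00
  replace hB0 : B (frame z 0) = (s * r) • frame z 0 - (s * q) • frame z 1 := by
    rw [hB0, hg, frame_one, hs]
    have e1 : 1 * x₀ * x₀ + -1 * y₀ * y₀ = q := by ring
    have e2 : 1 * x₁ * x₀ + -1 * y₁ * y₀ = r := by ring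
    simp only [e1, e2, real_smul_C2, smul_smul, ← add_smul, ← sub_smul]
    congr 1
    push_cast
    linear_combination (-ε / 2 * r) * Complex.I_sq
  replace hB1 : B (frame z 1) = -(s * q) • frame z 0 - (s * r) • frame z 1 := by
    rw [hB1, hg, frame_one, hs]
    have e1 : 1 * x₀ * x₁ + -1 * y₀ * y₁ = r := by ring
    have e2 : 1 * x₁ * x₁ + -1 * y₁ * y₁ = -q := by rw [← hq2]; ring
    simp only [e1, e2, real_smul_C2, smul_smul, ← add_smul, ← sub_smul]
    congr 1
    push_cast
    linear_combination (ε / 2 * q) * Complex.I_sq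
  have hqr : q ^ 2 + r ^ 2 = 1 := by
    -- Expressed through the Gram entries 1, 1, 0 of τ₀, τ₁; the last summand vanishes because the
    -- matrix has trace zero.
    have : q ^ 2 + r ^ 2 = (1 / 2) * ((x₀ * x₀ + x₁ * x₁) ^ 2 + (y₀ * y₀ + y₁ * y₁) ^ 2)
        - (x₀ * y₀ + x₁ * y₁) ^ 2
        + (1 / 2) * (q - (x₁ * x₁ - y₁ * y₁)) * (q + (x₁ * x₁ - y₁ * y₁)) := by
      rw [hq', hr']
      ring
    rw [this, hq2, ← p00, ← p11, ← p01]
    ring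
  refine ⟨q, r, hqr, fun t ht => ?_⟩
  have hd : ∀ u : ℝ, HasDerivAt (fun u : ℝ => Real.cosh (s * u)) (Real.sinh (s * u) * s) u ∧
      HasDerivAt (fun u : ℝ => Real.sinh (s * u)) (Real.cosh (s * u) * s) u := by
    intro u
    have h1 : HasDerivAt (fun u : ℝ => s * u) s u := by
      simpa using (hasDerivAt_id u).const_mul s
    exact ⟨h1.cosh, h1.sinh⟩
  have hexp0 : NormedSpace.exp (t • B) (frame z 0)
      = (Real.cosh (s * t) + Real.sinh (s * t) * r) • frame z 0
        + (-(Real.sinh (s * t) * q)) • frame z 1 := by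
    have hu : ∀ u : ℝ, HasDerivAt (fun u : ℝ => (Real.cosh (s * u) + Real.sinh (s * u) * r) •
        frame z 0 + (-(Real.sinh (s * u) * q)) • frame z 1)
        (B ((Real.cosh (s * u) + Real.sinh (s * u) * r) • frame z 0
          + (-(Real.sinh (s * u) * q)) • frame z 1)) u := by
      intro u
      refine ((((hd u).1.add ((hd u).2.mul_const r)).smul_const (frame z 0)).add
        (((hd u).2.mul_const q).neg.smul_const (frame z 1))).congr_deriv ?_
      rw [map_add, map_smul, map_smul, hB0, hB1]
      simp only [smul_sub, smul_smul]
      rw [sub_add_sub_comm, ← add_smul, ← add_smul, sub_eq_add_neg, ← neg_smul]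
      congr 2
      · linear_combination (-s * Real.sinh (s * u)) * hqr
      · ring
    have := exp_smul_apply_eq B hu t
    simpa using this
  have hexp1 : NormedSpace.exp (t • B) (frame z 1)
      = (-(Real.sinh (s * t) * q)) • frame z 0
        + (Real.cosh (s * t) - Real.sinh (s * t) * r) • frame z 1 := by
    have hu : ∀ u : ℝ, HasDerivAt (fun u : ℝ => (-(Real.sinh (s * u) * q)) • frame z 0
        + (Real.cosh (s * u) - Real.sinh (s * u) * r) • frame z 1)
        (B ((-(Real.sinh (s * u) * q)) • frame z 0
          + (Real.cosh (s * u) - Real.sinh (s * u) * r) • frame z 1)) u := by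
      intro u
      refine ((((hd u).2.mul_const q).neg.smul_const (frame z 0)).add
        (((hd u).1.sub ((hd u).2.mul_const r)).smul_const (frame z 1))).congr_deriv ?_
      rw [map_add, map_smul, map_smul, hB0, hB1]
      simp only [smul_sub, smul_smul]
      rw [sub_add_sub_comm, ← add_smul, ← add_smul, sub_eq_add_neg (_ • frame z 0), ← neg_smul]
      congr 2
      · ring
      · linear_combination (-s * Real.sinh (s * u)) * hqr
    have := exp_smul_apply_eq B hu t
    simpa using this
  ext i j
  have harg : ((2 * t / conf f ε z : ℝ) : ℂ) = ((2 * t : ℝ) : ℂ) := by rw [hg, div_one]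
  rw [flowMatrix_apply h hz hB ht, harg]
  fin_cases j
  · rw [Fin.zero_eta, hexp0, inner_frame_exp_smul]
    fin_cases i <;> simp [rotMat, Matrix.mul_apply, Fin.sum_univ_two, Matrix.mulVec, dotProduct]
  · rw [Fin.mk_one, hexp1, inner_frame_exp_smul]
    fin_cases i <;> simp [rotMat, Matrix.mul_apply, Fin.sum_univ_two, Matrix.mulVec, dotProduct,
      sub_eq_add_neg]

end

/-! ### Winding numbers and Conley-Zehnder indices of the model paths -/

theorem exists_polar {v : Fin 2 → ℝ} (hv : v ≠ 0) :
    ∃ ρ α : ℝ, 0 < ρ ∧ v = ρ • ![Real.cos α, Real.sin α] := by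
  set ζ : ℂ := ⟨v 0, v 1⟩ with hζ
  have h0 : ζ ≠ 0 := by
    intro h
    apply hv
    ext i
    fin_cases i
    · exact congrArg Complex.re h
    · exact congrArg Complex.im h
  refine ⟨‖ζ‖, ζ.arg, norm_pos_iff.2 h0, ?_⟩
  ext i
  fin_cases i
  · simp [Complex.norm_mul_cos_arg, hζ]
  · simp [Complex.norm_mul_sin_arg, hζ]

/-- Two lifts of one curve in the circle differ by a continuous function on an interval with values
in 2πℤ, hence by a constant. -/
theorem sub_eq_sub_of_continuousOn_lift {T : ℝ} (hT : 0 ≤ T) {θ φ : ℝ → ℝ}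
    (hθ : ContinuousOn θ (Set.Icc 0 T)) (hφ : ContinuousOn φ (Set.Icc 0 T))
    (h : ∀ t ∈ Set.Icc 0 T, Real.cos (θ t) = Real.cos (φ t) ∧ Real.sin (θ t) = Real.sin (φ t)) :
    θ T - θ 0 = φ T - φ 0 := by
  have key : ∀ t ∈ Set.Icc 0 T, ∃ n : ℤ, (θ t - φ t) / (2 * Real.pi) = n := by
    intro t ht
    have h1 : Real.cos (θ t - φ t) = 1 := by
      rw [Real.cos_sub, (h t ht).1, (h t ht).2, ← sq, ← sq, Real.cos_sq_add_sin_sq]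
    obtain ⟨n, hn⟩ := (Real.cos_eq_one_iff _).1 h1
    exact ⟨n, by rw [← hn]; field_simp⟩
  have hc : ContinuousOn (fun t => (θ t - φ t) / (2 * Real.pi)) (Set.Icc 0 T) :=
    (hθ.sub hφ).div_const _
  have hconn := (isPreconnected_Icc.image _ hc).ordConnected
  obtain ⟨a, ha⟩ := key 0 ⟨le_rfl, hT⟩
  obtain ⟨b, hb⟩ := key T ⟨hT, le_rfl⟩
  have hmem : ∀ t ∈ Set.Icc 0 T, (θ t - φ t) / (2 * Real.pi) ∈
      (fun t => (θ t - φ t) / (2 * Real.pi)) '' Set.Icc 0 T := fun t ht => ⟨t, ht, rfl⟩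
  have hall : ∀ x : ℝ, x ∈ Set.uIcc (a : ℝ) b → ∃ n : ℤ, x = n := by
    intro x hx
    have h1 := hconn.uIcc_subset (hmem 0 ⟨le_rfl, hT⟩) (hmem T ⟨hT, le_rfl⟩)
    rw [ha, hb] at h1
    obtain ⟨t, ht, rfl⟩ := h1 hx
    exact key t ht
  have hab : a = b := by
    by_contra hne
    rcases lt_or_gt_of_ne hne with hlt | hlt
    · have h1 : ((a : ℝ) + 1) ≤ b := by exact_mod_cast hlt
      obtain ⟨n, hn⟩ := hall (a + 1 / 2) (Set.mem_uIcc_of_le (by linarith) (by linarith))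
      have h2 : (a : ℝ) < n := by linarith
      have h3 : (n : ℝ) < a + 1 := by linarith
      have h4 : a < n := by exact_mod_cast h2
      have h5 : n < a + 1 := by exact_mod_cast h3
      omega
    · have h1 : ((b : ℝ) + 1) ≤ a := by exact_mod_cast hlt
      obtain ⟨n, hn⟩ := hall (b + 1 / 2) (Set.mem_uIcc_of_ge (by linarith) (by linarith))
      have h2 : (b : ℝ) < n := by linarith
      have h3 : (n : ℝ) < b + 1 := by linarith
      have h4 : b < n := by exact_mod_cast h2
      have h5 : n < b + 1 := by exact_mod_cast h3
      omega
  rw [hab, ← hb] at ha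
  have hpi : (2 * Real.pi) ≠ 0 := by positivity
  have := (div_left_inj' hpi).1 ha
  linarith

theorem cos_sin_eq_of_smul_eq {r s θ φ : ℝ} (hr : 0 < r) (hs : 0 < s)
    (h : r • ![Real.cos θ, Real.sin θ] = s • ![Real.cos φ, Real.sin φ]) :
    Real.cos θ = Real.cos φ ∧ Real.sin θ = Real.sin φ := by
  have h0 : r * Real.cos θ = s * Real.cos φ := by simpa using congrFun h 0
  have h1 : r * Real.sin θ = s * Real.sin φ := by simpa using congrFun h 1
  have hrs : r = s := by
    have : r ^ 2 = s ^ 2 := by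
      calc r ^ 2 = (r * Real.cos θ) ^ 2 + (r * Real.sin θ) ^ 2 := by
            linear_combination (-r ^ 2) * Real.cos_sq_add_sin_sq θ
        _ = s ^ 2 := by rw [h0, h1]; linear_combination s ^ 2 * Real.cos_sq_add_sin_sq φ
    exact (pow_left_inj₀ hr.le hs.le two_ne_zero).1 this
  subst hrs
  exact ⟨mul_left_cancel₀ hr.ne' h0, mul_left_cancel₀ hr.ne' h1⟩

theorem rotMat_mulVec (θ α ρ : ℝ) : rotMat θ *ᵥ (ρ • ![Real.cos α, Real.sin α])
    = ρ • ![Real.cos (θ + α), Real.sin (θ + α)] := by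
  ext i
  fin_cases i <;>
    simp [rotMat, Matrix.mulVec, dotProduct, Fin.sum_univ_two, Real.cos_add, Real.sin_add] <;> ring

/-- Winding depends neither on the length of v nor on the lift, so one explicit angle function for
each starting direction computes the whole set. -/
theorem mem_windingSet_iff {M : ℝ → Matrix (Fin 2) (Fin 2) ℝ} {T : ℝ} (hT : 0 ≤ T)
    (F : ℝ → ℝ → ℝ)
    (hF : ∀ α, ContinuousOn (F α) (Set.Icc 0 T) ∧ ∀ t ∈ Set.Icc 0 T, ∃ r : ℝ, 0 < r ∧
      M t *ᵥ ![Real.cos α, Real.sin α] = r • ![Real.cos (F α t), Real.sin (F α t)]) (δ : ℝ) :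
    δ ∈ windingSet M T ↔ ∃ α, δ = (F α T - F α 0) / (2 * Real.pi) := by
  constructor
  · rintro ⟨v, hv, θ, hθ, h, rfl⟩
    obtain ⟨ρ, α, hρ, rfl⟩ := exists_polar hv
    refine ⟨α, ?_⟩
    rw [sub_eq_sub_of_continuousOn_lift hT hθ (hF α).1]
    intro t ht
    obtain ⟨r, hr, h1⟩ := h t ht
    obtain ⟨s, hs, h2⟩ := (hF α).2 t ht
    rw [Matrix.mulVec_smul, h2, smul_smul] at h1
    exact (cos_sin_eq_of_smul_eq (mul_pos hρ hs) hr h1).imp Eq.symm Eq.symm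
  · rintro ⟨α, rfl⟩
    refine ⟨_, fun h0 => ?_, F α, (hF α).1, (hF α).2, rfl⟩
    have h1 : Real.cos α = 0 := congrFun h0 0
    have h2 : Real.sin α = 0 := congrFun h0 1
    have := Real.cos_sq_add_sin_sq α
    rw [h1, h2] at this
    norm_num at this

theorem windingSet_rotMat {M : ℝ → Matrix (Fin 2) (Fin 2) ℝ} {w T : ℝ} (hT : 0 ≤ T)
    (hM : ∀ t, 0 ≤ t → M t = rotMat (w * t)) : windingSet M T = {w * T / (2 * Real.pi)} := by
  ext δ
  rw [mem_windingSet_iff hT (fun α t => w * t + α)]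
  · simp
  · refine fun α => ⟨by fun_prop, fun t ht => ⟨1, one_pos, ?_⟩⟩
    rw [hM t ht.1]
    simpa using rotMat_mulVec (w * t) α 1

theorem czIndex_rotMat {M : ℝ → Matrix (Fin 2) (Fin 2) ℝ} {w T : ℝ} (hT : 0 ≤ T)
    (hM : ∀ t, 0 ≤ t → M t = rotMat (w * t)) (hw : ∀ k : ℤ, w * T / (2 * Real.pi) ≠ k) :
    czIndex M T = 2 * ⌊w * T / (2 * Real.pi)⌋ + 1 := by
  have h := windingSet_rotMat hT hM
  rw [czIndex, dif_neg, h, csInf_singleton]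
  rintro ⟨k, hk⟩
  rw [h] at hk
  exact hw k hk.symm

theorem one_notMem_spectrum_rotMat {φ : ℝ} (h : Real.sin φ ≠ 0) :
    (1 : ℝ) ∉ spectrum ℝ (rotMat φ) := by
  rw [spectrum.mem_iff, not_not, map_one, Matrix.isUnit_iff_isUnit_det, isUnit_iff_ne_zero,
    Matrix.det_fin_two]
  simp [rotMat]
  have : 0 < Real.sin φ ^ 2 := by positivity
  nlinarith [sq_nonneg (1 - Real.cos φ)]

/-- The eigenvalue e^{iφ} is not real when sin φ ≠ 0. -/
theorem exists_nonreal_mem_spectrum_rotMat {φ : ℝ} (h : Real.sin φ ≠ 0) :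
    ¬ ∀ μ ∈ spectrum ℂ ((rotMat φ).map (fun x : ℝ => (x : ℂ))), ∃ r : ℝ, r < 0 ∧ μ = r := by
  intro hall
  obtain ⟨r, -, hr⟩ := hall (Complex.exp (φ * Complex.I)) (by
    have he := Complex.exp_mul_I (φ : ℂ)
    generalize Complex.exp (φ * Complex.I) = μ at he
    rw [spectrum.mem_iff, Matrix.isUnit_iff_isUnit_det, isUnit_iff_ne_zero, not_not,
      Matrix.det_fin_two]
    simp [rotMat, Matrix.algebraMap_matrix_apply]
    rw [he]
    linear_combination (Complex.sin φ ^ 2) * Complex.I_sq)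
  apply h
  have := congrArg Complex.im hr
  rwa [Complex.exp_ofReal_mul_I_im, Complex.ofReal_im] at this

/-- The hyperbolic part of the linearised flow at a saddle. -/
def hypMat (q r u : ℝ) : Matrix (Fin 2) (Fin 2) ℝ :=
  Real.cosh u • 1 + Real.sinh u • !![r, -q; -q, -r]

theorem neg_one_lt_of_sq_add {x y : ℝ} (h : x ^ 2 + y ^ 2 = 1) : |x| ≤ 1 := by
  rw [← sq_le_one_iff_abs_le_one]
  nlinarith [sq_nonneg y]

/-- Let e be the unit vector of angle α and S the reflection in `hypMat`. With A = ⟨e, Se⟩ and B =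
⟨e^⊥, Se⟩, the image of e has components cosh u + A sinh u and B sinh u along e and e^⊥. As |A| ≤ 1
the first is positive, so the image stays in an open half-plane and an arctangent gives its angle
continuously. -/
theorem exists_angle_hypMat {q r : ℝ} (hqr : q ^ 2 + r ^ 2 = 1) (α : ℝ) : ∃ A B : ℝ,
    A ^ 2 + B ^ 2 = 1 ∧ (∀ u, 0 < Real.cosh u + Real.sinh u * A) ∧
    ∀ u θ, ∃ ρ : ℝ, 0 < ρ ∧ (rotMat θ * hypMat q r u) *ᵥ ![Real.cos α, Real.sin α]
      = ρ • ![Real.cos (θ + (α + Real.arctan (Real.sinh u * B / (Real.cosh u + Real.sinh u * A)))),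
          Real.sin (θ + (α + Real.arctan (Real.sinh u * B / (Real.cosh u + Real.sinh u * A))))] := by
  have hcs := Real.cos_sq_add_sin_sq α
  set A := r * (Real.cos α ^ 2 - Real.sin α ^ 2) - 2 * q * Real.cos α * Real.sin α with hA
  set B := -q * (Real.cos α ^ 2 - Real.sin α ^ 2) - 2 * r * Real.cos α * Real.sin α with hB
  have hAB : A ^ 2 + B ^ 2 = 1 := by
    have : A ^ 2 + B ^ 2 = (q ^ 2 + r ^ 2) * (Real.cos α ^ 2 + Real.sin α ^ 2) ^ 2 := by
      rw [hA, hB]; ring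
    rw [this, hqr, hcs]; norm_num
  have hpos : ∀ u, 0 < Real.cosh u + Real.sinh u * A := by
    intro u
    have h1 := abs_le.1 (neg_one_lt_of_sq_add hAB)
    have h2 := Real.exp_pos u
    have h3 := Real.exp_pos (-u)
    rw [Real.cosh_eq, Real.sinh_eq]
    nlinarith [mul_nonneg h2.le (by linarith [h1.1] : 0 ≤ 1 + A),
      mul_nonneg h3.le (by linarith [h1.2] : 0 ≤ 1 - A)]
  refine ⟨A, B, hAB, hpos, fun u θ => ?_⟩
  set x := Real.cosh u + Real.sinh u * A with hx
  set y := Real.sinh u * B with hy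
  have hx0 : 0 < x := hpos u
  refine ⟨x * Real.sqrt (1 + (y / x) ^ 2), by positivity, ?_⟩
  rw [← rotMat_mulVec, ← rotMat_mulVec, ← Matrix.mulVec_mulVec]
  congr 1
  have hs : Real.sqrt (1 + (y / x) ^ 2) ≠ 0 := by positivity
  have e : (x * Real.sqrt (1 + (y / x) ^ 2)) • ![Real.cos (Real.arctan (y / x)),
      Real.sin (Real.arctan (y / x))] = ![x, y] := by
    ext i
    fin_cases i
    · simp [Real.cos_arctan]; field_simp
    · simp [Real.sin_arctan]; field_simp
  rw [e]
  ext i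
  fin_cases i <;>
    simp [rotMat, hypMat, Matrix.mulVec, dotProduct, Fin.sum_univ_two, hx, hy, hA, hB]
  · linear_combination (-(Real.sinh u * (r * Real.cos α - q * Real.sin α))) * hcs
  · linear_combination (Real.sinh u * (q * Real.cos α + r * Real.sin α)) * hcs

/-- The reflection has a +1 eigenvector, namely (1 + r, −q) unless r = −1; along it cosh u + sinh u
is e^u, so this direction is turned by the rotation alone. -/
theorem exists_angle_fixed {q r : ℝ} (hqr : q ^ 2 + r ^ 2 = 1) : ∃ α : ℝ,
    ∀ u, hypMat q r u *ᵥ ![Real.cos α, Real.sin α] = Real.exp u • ![Real.cos α, Real.sin α] := by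
  obtain ⟨v, hv, hS⟩ : ∃ v : Fin 2 → ℝ, v ≠ 0 ∧ !![r, -q; -q, -r] *ᵥ v = v := by
    by_cases hr : r = -1
    · have hq : q = 0 := by
        rw [hr] at hqr
        exact pow_eq_zero_iff two_ne_zero |>.1 (by linarith)
      refine ⟨![0, 1], fun h => by simpa using congrFun h 1, ?_⟩
      ext i
      fin_cases i <;> simp [Matrix.mulVec, dotProduct, Fin.sum_univ_two, hr, hq]
    · refine ⟨![1 + r, -q], fun h => hr ?_, ?_⟩
      · have : 1 + r = 0 := congrFun h 0
        linarith
      · ext i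
        fin_cases i <;> simp [Matrix.mulVec, dotProduct, Fin.sum_univ_two]
        · linarith
        · ring
  obtain ⟨ρ, α, hρ, rfl⟩ := exists_polar hv
  refine ⟨α, fun u => ?_⟩
  rw [Matrix.mulVec_smul] at hS
  have hS' := smul_right_injective _ hρ.ne' hS
  rw [hypMat, Matrix.add_mulVec, Matrix.smul_mulVec, Matrix.smul_mulVec, Matrix.one_mulVec, hS',
    ← add_smul, Real.cosh_add_sinh]

/-- The eigendirection turns by exactly 2T; any other direction deviates from this by an arctangent,
that is by less than a quarter turn. -/
theorem windingSet_hyperbolic {M : ℝ → Matrix (Fin 2) (Fin 2) ℝ} {s q r T : ℝ} (hT : 0 ≤ T)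
    (hqr : q ^ 2 + r ^ 2 = 1) (hM : ∀ t, 0 ≤ t → M t = rotMat (2 * t) * hypMat q r (s * t)) :
    T / Real.pi ∈ windingSet M T ∧
      ∀ δ ∈ windingSet M T, |δ - T / Real.pi| < 1 / 4 := by
  have hpi := Real.pi_pos
  constructor
  · obtain ⟨α, hα⟩ := exists_angle_fixed hqr
    refine ⟨![Real.cos α, Real.sin α], fun h0 => ?_, fun t => 2 * t + α, by fun_prop,
      fun t ht => ⟨Real.exp (s * t), Real.exp_pos _, ?_⟩, by field_simp; ring⟩
    · have h1 : Real.cos α = 0 := congrFun h0 0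
      have h2 : Real.sin α = 0 := congrFun h0 1
      have := Real.cos_sq_add_sin_sq α
      rw [h1, h2] at this
      norm_num at this
    · rw [hM t ht.1, ← Matrix.mulVec_mulVec, hα, rotMat_mulVec]
  · intro δ hδ
    choose A B hAB hpos hang using fun α => exists_angle_hypMat hqr α
    rw [mem_windingSet_iff hT (fun α t => 2 * t + (α + Real.arctan (Real.sinh (s * t) * B α /
      (Real.cosh (s * t) + Real.sinh (s * t) * A α))))] at hδ
    · obtain ⟨α, rfl⟩ := hδ
      simp only [mul_zero, Real.sinh_zero, zero_mul, zero_div, Real.arctan_zero]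
      set a := Real.arctan (Real.sinh (s * T) * B α / (Real.cosh (s * T) + Real.sinh (s * T) * A α))
      have h1 : -(Real.pi / 2) < a := Real.neg_pi_div_two_lt_arctan _
      have h2 : a < Real.pi / 2 := Real.arctan_lt_pi_div_two _
      have e : (2 * T + (α + a) - (0 + (α + 0))) / (2 * Real.pi) - T / Real.pi
          = a / (2 * Real.pi) := by field_simp; ring
      rw [e, abs_lt, lt_div_iff₀ (by positivity), div_lt_iff₀ (by positivity)]
      constructor <;> linarith
    · refine fun α => ⟨?_, fun t ht => ?_⟩
      · have hne : ∀ t, Real.cosh (s * t) + Real.sinh (s * t) * A α ≠ 0 := fun t => (hpos α _).ne'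
        refine Continuous.continuousOn ?_
        refine (continuous_const.mul continuous_id).add (continuous_const.add
          (Real.continuous_arctan.comp (Continuous.div ?_ ?_ hne)))
        · exact (Real.continuous_sinh.comp (continuous_const.mul continuous_id)).mul
            continuous_const
        · exact (Real.continuous_cosh.comp (continuous_const.mul continuous_id)).add
            ((Real.continuous_sinh.comp (continuous_const.mul continuous_id)).mul continuous_const)
      · rw [hM t ht.1]
        exact hang α (s * t) (2 * t)

/-- The eigendirection has winding k/2. For even k this is the only integer within 1/4 of k/2, so
the choice in `czIndex` must return it; for odd k the set stays within 1/4 of a half-integer and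
contains no integer. -/
theorem czIndex_hyperbolic {M : ℝ → Matrix (Fin 2) (Fin 2) ℝ} {s q r : ℝ} {k : ℕ}
    (hqr : q ^ 2 + r ^ 2 = 1) (hM : ∀ t, 0 ≤ t → M t = rotMat (2 * t) * hypMat q r (s * t)) :
    czIndex M (k * Real.pi / 2) = k := by
  have hpi := Real.pi_pos
  obtain ⟨h1, h2⟩ := windingSet_hyperbolic (T := k * Real.pi / 2) (by positivity) hqr hM
  have e : (k * Real.pi / 2) / Real.pi = (k : ℝ) / 2 := by field_simp
  rw [e] at h1 h2
  rcases Nat.even_or_odd' k with ⟨j, hj | hj⟩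
  · have hk : ((j : ℤ) : ℝ) = (k : ℝ) / 2 := by rw [hj]; push_cast; ring
    have hex : ∃ k' : ℤ, (k' : ℝ) ∈ windingSet M (k * Real.pi / 2) := ⟨j, by rwa [hk]⟩
    rw [czIndex, dif_pos hex]
    have h3 := h2 _ hex.choose_spec
    rw [← hk] at h3
    have h4 := abs_lt.1 h3
    have h5 : (hex.choose : ℝ) < ((j + 1 : ℤ) : ℝ) := by push_cast at *; linarith
    have h6 : ((j - 1 : ℤ) : ℝ) < (hex.choose : ℝ) := by push_cast at *; linarith
    have h7 : hex.choose < j + 1 := by exact_mod_cast h5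
    have h8 : (j : ℤ) - 1 < hex.choose := by exact_mod_cast h6
    have h9 : hex.choose = j := by omega
    rw [h9, hj]
    push_cast
    ring
  · have hk : (k : ℝ) / 2 = ((j : ℤ) : ℝ) + 1 / 2 := by rw [hj]; push_cast; ring
    rw [hk] at h1 h2
    rw [czIndex, dif_neg]
    · have hfl : ⌊sInf (windingSet M (k * Real.pi / 2))⌋ = j := by
        rw [Int.floor_eq_iff]
        constructor
        · refine le_csInf ⟨_, h1⟩ fun δ hδ => ?_
          have := (abs_lt.1 (h2 δ hδ)).1
          linarith
        · have hbdd : BddBelow (windingSet M (k * Real.pi / 2)) := ⟨(j : ℤ), fun δ hδ => by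
            have := (abs_lt.1 (h2 δ hδ)).1
            linarith⟩
          exact (csInf_le hbdd h1).trans_lt (by linarith)
      rw [hfl, hj]
      push_cast
      ring
    · rintro ⟨i, hi⟩
      have h4 := abs_lt.1 (h2 _ hi)
      have h5 : (i : ℝ) < ((j + 1 : ℤ) : ℝ) := by push_cast at *; linarith
      have h6 : ((j : ℤ) : ℝ) < (i : ℝ) := by push_cast at *; linarith
      have h7 : i < j + 1 := by exact_mod_cast h5
      have h8 : (j : ℤ) < i := by exact_mod_cast h6
      omega

theorem rotMat_natCast_mul_pi (k : ℕ) : rotMat (k * Real.pi) = (-1 : ℝ) ^ k • 1 := by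
  ext i j
  fin_cases i <;> fin_cases j <;> simp [rotMat, Real.cos_nat_mul_pi, Real.sin_nat_mul_pi]

/-- `hypMat` has determinant 1 and trace 2 cosh u, so det(1 ∓ `hypMat`) = 2 ∓ 2 cosh u, which is
nonzero for u ≠ 0. -/
theorem one_notMem_spectrum_hyperbolic {q r u : ℝ} (hqr : q ^ 2 + r ^ 2 = 1) (hu : u ≠ 0) (k : ℕ) :
    (1 : ℝ) ∉ spectrum ℝ (rotMat (k * Real.pi) * hypMat q r u) := by
  rw [spectrum.mem_iff, not_not, map_one, Matrix.isUnit_iff_isUnit_det, isUnit_iff_ne_zero,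
    Matrix.det_fin_two, rotMat_natCast_mul_pi]
  have hc := Real.cosh_sq u
  have h1 : 1 < Real.cosh u := Real.one_lt_cosh.2 hu
  rcases neg_one_pow_eq_or ℝ k with h | h <;> rw [h] <;> simp [hypMat] <;> nlinarith

/-- The rotation by π is −1, and `hypMat` has eigenvalues e^u and e^{−u}. -/
theorem negative_of_mem_spectrum_hyperbolic {q r u : ℝ} (hqr : q ^ 2 + r ^ 2 = 1) {μ : ℂ}
    (hμ : μ ∈ spectrum ℂ ((rotMat Real.pi * hypMat q r u).map (fun x : ℝ => (x : ℂ)))) :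
    ∃ x : ℝ, x < 0 ∧ μ = x := by
  have hrot : rotMat Real.pi = -1 := by
    have := rotMat_natCast_mul_pi 1
    simpa using this
  rw [spectrum.mem_iff, Matrix.isUnit_iff_isUnit_det, isUnit_iff_ne_zero, not_not,
    Matrix.det_fin_two, hrot] at hμ
  simp [hypMat, Matrix.algebraMap_matrix_apply, -Complex.ofReal_cosh, -Complex.ofReal_sinh] at hμ
  have h1 : (q : ℂ) ^ 2 + (r : ℂ) ^ 2 = 1 := by exact_mod_cast congrArg (fun x : ℝ => (x : ℂ)) hqr
  have h2 : (Real.cosh u : ℂ) ^ 2 - (Real.sinh u : ℂ) ^ 2 = 1 := by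
    have := Real.cosh_sq_sub_sinh_sq u
    exact_mod_cast congrArg (fun x : ℝ => (x : ℂ)) this
  have h3 : (μ + (Real.cosh u + Real.sinh u : ℂ)) * (μ + (Real.cosh u - Real.sinh u : ℂ)) = 0 := by
    linear_combination hμ + (Real.sinh u : ℂ) ^ 2 * h1
  rcases mul_eq_zero.1 h3 with h | h
  · refine ⟨-Real.exp u, by simp [Real.exp_pos], ?_⟩
    rw [← Real.cosh_add_sinh]
    push_cast [-Complex.ofReal_cosh, -Complex.ofReal_sinh]
    linear_combination h
  · refine ⟨-Real.exp (-u), by simp [Real.exp_pos], ?_⟩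
    rw [← Real.cosh_sub_sinh]
    push_cast [-Complex.ofReal_cosh, -Complex.ofReal_sinh]
    linear_combination h

/-! ### Regular polyhedra with triangular faces -/

theorem inner_cross_self (x y : E3) :
    inner ℝ (cross x y) (cross x y) = inner ℝ x x * inner ℝ y y - inner ℝ x y ^ 2 := by
  simp only [inner_E3, cross_apply']
  simp
  ring

theorem cross_ne_zero {x y : E3} (h : inner ℝ x y ^ 2 < inner ℝ x x * inner ℝ y y) :
    cross x y ≠ 0 := by
  intro h0
  have := inner_cross_self x y
  rw [h0, inner_zero_left] at this
  linarith

/-- The vertices `W` of a regular polyhedron with triangular faces, of squared norm `c`: neighbours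
have inner product `κ`, `r` is a rotation of order `n` about the vertex `v₀` permuting its
neighbours cyclically, and `s` is the half-turn about the edge from `v₀` to `w₀`. -/
structure IsRegularPolyhedron (W : Set E3) (v₀ w₀ : E3) (c κ : ℝ) (n : ℕ) (r s : SO3) : Prop where
  finite : W.Finite
  inner_self : ∀ v ∈ W, inner ℝ v v = c
  pos : 0 < c
  lt : κ < c
  lower : 0 < c + 2 * κ
  v_mem : v₀ ∈ W
  w_mem : w₀ ∈ W
  inner_vw : inner ℝ v₀ w₀ = κ
  r_maps : ∀ v ∈ W, toLin r v ∈ W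
  s_maps : ∀ v ∈ W, toLin s v ∈ W
  r_v : toLin r v₀ = v₀
  s_v : toLin s v₀ = w₀
  s_w : toLin s w₀ = v₀
  trans : ∀ v ∈ W, ∃ g : SO3, (∀ w ∈ W, toLin g w ∈ W) ∧ toLin g v₀ = v
  le : ∀ w ∈ W, w ≠ v₀ → inner ℝ v₀ w ≤ κ
  link : ∀ w ∈ W, inner ℝ v₀ w = κ → ∃ j : ℕ, w = toLin (r ^ j) w₀
  inner_rw : inner ℝ w₀ (toLin r w₀) = κ
  common : ∀ u ∈ W, inner ℝ v₀ u = κ → inner ℝ w₀ u = κ → u = toLin r w₀ ∨ toLin r u = w₀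
  order : orderOf r = n

theorem smul_mem_radialImage_iff {X : Set E3} {x₀ : E3} {K : Subgroup SO3} {a : ℝ} (ha : 0 < a)
    (hx : x₀ ≠ 0) (hX : ∀ x, x ∈ X ↔ ∃ g ∈ K, x = a • toLin g x₀) (p₀ : S2)
    (hp : (p₀ : E3) = ‖x₀‖⁻¹ • x₀) (p : S2) : p ∈ radialImage X ↔ ∃ g ∈ K, p = g • p₀ := by
  have hn : 0 < ‖x₀‖ := norm_pos_iff.2 hx
  constructor
  · rintro ⟨b, hb, hm⟩
    obtain ⟨g, hg, h⟩ := (hX _).1 hm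
    refine ⟨g, hg, Subtype.ext ?_⟩
    have h1 := congrArg norm h
    rw [norm_smul, norm_smul, norm_S2, norm_toLin, Real.norm_of_nonneg hb.le,
      Real.norm_of_nonneg ha.le, mul_one] at h1
    rw [coe_smul_sphere, hp, map_smul, ← inv_smul_smul₀ hb.ne' (p : E3), h, smul_smul, h1]
    congr 1
    field_simp
  · rintro ⟨g, hg, rfl⟩
    refine ⟨a * ‖x₀‖, by positivity, (hX _).2 ⟨g, hg, ?_⟩⟩
    rw [coe_smul_sphere, hp, map_smul, smul_smul]
    congr 1
    field_simp

theorem smul_eq_self_iff_toLin {x₀ : E3} (hx : x₀ ≠ 0) {p₀ : S2} (hp : (p₀ : E3) = ‖x₀‖⁻¹ • x₀)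
    (g : SO3) : g • p₀ = p₀ ↔ toLin g x₀ = x₀ := by
  have hn : ‖x₀‖ ≠ 0 := norm_ne_zero_iff.2 hx
  rw [Subtype.ext_iff, coe_smul_sphere, hp, map_smul]
  exact (smul_right_injective E3 (inv_ne_zero hn)).eq_iff

/-- The radial projection of a point. -/
def radialPoint {x : E3} (hx : x ≠ 0) : S2 := ⟨‖x‖⁻¹ • x, by simp [norm_smul, hx]⟩

namespace IsRegularPolyhedron

variable {W : Set E3} {v₀ w₀ : E3} {c κ : ℝ} {n : ℕ} {r s : SO3}

/-- All vertices have norm √c, so radial projection only rescales W; since W is finite, a rotation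
mapping it into itself maps it onto itself. -/
theorem mem_stabilizer_iff (h : IsRegularPolyhedron W v₀ w₀ c κ n r s) (g : SO3) :
    g ∈ MulAction.stabilizer SO3 (radialImage W) ↔ ∀ v ∈ W, toLin g v ∈ W := by
  have hne : ∀ v ∈ W, v ≠ 0 := by
    rintro v hv rfl
    have := h.inner_self _ hv
    rw [inner_zero_left] at this
    exact h.pos.ne this
  have hnorm : ∀ v ∈ W, ‖v‖ = Real.sqrt c := fun v hv => by
    rw [← h.inner_self v hv, real_inner_self_eq_norm_sq, Real.sqrt_sq (norm_nonneg _)]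
  have hsc : 0 < Real.sqrt c := Real.sqrt_pos.2 h.pos
  have hmem : ∀ p : S2, p ∈ radialImage W ↔ Real.sqrt c • (p : E3) ∈ W := by
    refine fun p => ⟨?_, fun hp => ⟨_, hsc, hp⟩⟩
    rintro ⟨a, ha, hp⟩
    have := hnorm _ hp
    rw [norm_smul, norm_S2, mul_one, Real.norm_of_nonneg ha.le] at this
    rwa [← this]
  have hfin : (radialImage W).Finite := by
    refine Set.Finite.of_injOn (f := fun p : S2 => Real.sqrt c • (p : E3)) (t := W)
      (fun p hp => (hmem p).1 hp) ?_ h.finite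
    intro p _ q _ hpq
    exact Subtype.ext (smul_right_injective E3 hsc.ne' hpq)
  rw [MulAction.mem_stabilizer_set' hfin]
  constructor
  · intro hg v hv
    have h1 : radialPoint (hne v hv) ∈ radialImage W := by
      rw [hmem]
      simpa [radialPoint, ← hnorm v hv, smul_smul, hne v hv] using hv
    have h2 := (hmem _).1 (hg h1)
    rw [coe_smul_sphere, ← map_smul] at h2
    simpa [radialPoint, ← hnorm v hv, smul_smul, hne v hv] using h2
  · intro hg p hp
    rw [hmem] at hp ⊢
    rw [coe_smul_sphere, ← map_smul]
    exact hg _ hp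

theorem inner_le (h : IsRegularPolyhedron W v₀ w₀ c κ n r s) {v w : E3} (hv : v ∈ W) (hw : w ∈ W)
    (hvw : v ≠ w) : inner ℝ v w ≤ κ := by
  obtain ⟨g, hg, rfl⟩ := h.trans v hv
  have hg' := (h.mem_stabilizer_iff _).1 (inv_mem ((h.mem_stabilizer_iff g).2 hg))
  have h1 := h.le (toLin g⁻¹ w) (hg' w hw) (by
    rintro h2
    apply hvw
    rw [← h2, toLin_apply_inv])
  rwa [← inner_toLin g, toLin_apply_inv] at h1

/-- Transitivity on vertices together with the powers of r on the neighbours of v₀ gives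
transitivity on oriented edges. -/
theorem exists_arc (h : IsRegularPolyhedron W v₀ w₀ c κ n r s) {v w : E3} (hv : v ∈ W) (hw : w ∈ W)
    (hvw : inner ℝ v w = κ) :
    ∃ g ∈ MulAction.stabilizer SO3 (radialImage W), toLin g v₀ = v ∧ toLin g w₀ = w := by
  obtain ⟨g, hg, rfl⟩ := h.trans v hv
  have hgK := (h.mem_stabilizer_iff g).2 hg
  have hg' := (h.mem_stabilizer_iff _).1 (inv_mem hgK)
  obtain ⟨j, hj⟩ := h.link (toLin g⁻¹ w) (hg' w hw) (by
    rw [← inner_toLin g, toLin_apply_inv, hvw])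
  have hr : r ∈ MulAction.stabilizer SO3 (radialImage W) := (h.mem_stabilizer_iff r).2 h.r_maps
  have hrj : ∀ j : ℕ, toLin (r ^ j) v₀ = v₀ := by
    intro j
    induction j with
    | zero => rw [pow_zero, toLin_one]
    | succ j ih => rw [pow_succ, toLin_mul, h.r_v, ih]
  refine ⟨g * r ^ j, mul_mem hgK (pow_mem hr j), ?_, ?_⟩
  · rw [toLin_mul, hrj]
  · rw [toLin_mul, ← hj, toLin_apply_inv]

theorem inner_r (h : IsRegularPolyhedron W v₀ w₀ c κ n r s) : inner ℝ v₀ (toLin r w₀) = κ := by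
  have := inner_toLin r v₀ w₀
  rwa [h.r_v, h.inner_vw] at this

theorem eq_one (h : IsRegularPolyhedron W v₀ w₀ c κ n r s) {g : SO3} (hv : toLin g v₀ = v₀)
    (hw : toLin g w₀ = w₀) : g = 1 := by
  refine eq_one_of_fixes g v₀ w₀ hv hw (cross_ne_zero ?_)
  rw [h.inner_vw, h.inner_self _ h.v_mem, h.inner_self _ h.w_mem]
  have := h.pos; have := h.lt; have := h.lower
  nlinarith

theorem v_ne_w (h : IsRegularPolyhedron W v₀ w₀ c κ n r s) : v₀ ≠ w₀ := by
  rintro rfl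
  have := h.inner_vw
  rw [h.inner_self _ h.v_mem] at this
  exact h.lt.ne' this

theorem finite_stabilizer (h : IsRegularPolyhedron W v₀ w₀ c κ n r s) :
    Finite (MulAction.stabilizer SO3 (radialImage W)) := by
  have : Finite W := h.finite
  refine Finite.of_injective (β := W × W) (fun g => (⟨toLin g.1 v₀,
    (h.mem_stabilizer_iff g.1).1 g.2 _ h.v_mem⟩, ⟨toLin g.1 w₀,
    (h.mem_stabilizer_iff g.1).1 g.2 _ h.w_mem⟩)) fun g g' hgg => ?_
  simp only [Prod.mk.injEq, Subtype.mk.injEq] at hgg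
  have := h.eq_one (g := g'.1⁻¹ * g.1) (by rw [toLin_mul, hgg.1, toLin_inv_apply])
    (by rw [toLin_mul, hgg.2, toLin_inv_apply])
  exact Subtype.ext (inv_mul_eq_one.1 this).symm

/-- Such a g sends w₀ to some r^j w₀, so r^{−j} g fixes both ends of an edge and is trivial. -/
theorem fixes_vertex_iff (h : IsRegularPolyhedron W v₀ w₀ c κ n r s) {g : SO3} :
    (g ∈ MulAction.stabilizer SO3 (radialImage W) ∧ toLin g v₀ = v₀) ↔ g ∈ Subgroup.zpowers r := by
  have hr : r ∈ MulAction.stabilizer SO3 (radialImage W) := (h.mem_stabilizer_iff r).2 h.r_maps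
  have hrv : ∀ p₀ : S2, (p₀ : E3) = ‖v₀‖⁻¹ • v₀ → r • p₀ = p₀ := fun p₀ hp => by
    apply Subtype.ext
    rw [coe_smul_sphere, hp, map_smul, h.r_v]
  have hv0 : v₀ ≠ 0 := by
    rintro rfl
    have := h.inner_self _ h.v_mem
    rw [inner_zero_left] at this
    exact h.pos.ne this
  have hp : (radialPoint hv0 : E3) = ‖v₀‖⁻¹ • v₀ := rfl
  rw [← smul_eq_self_iff_toLin hv0 hp]
  constructor
  · rintro ⟨hg, hgv⟩
    rw [smul_eq_self_iff_toLin hv0 hp] at hgv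
    obtain ⟨j, hj⟩ := h.link (toLin g w₀) ((h.mem_stabilizer_iff g).1 hg _ h.w_mem) (by
      have := inner_toLin g v₀ w₀
      rwa [hgv, h.inner_vw] at this)
    have hrj : toLin (r ^ j)⁻¹ v₀ = v₀ := by
      rw [← smul_eq_self_iff_toLin hv0 hp, ← MulAction.mem_stabilizer_iff]
      exact inv_mem (pow_mem (MulAction.mem_stabilizer_iff.2 (hrv _ hp)) j)
    have := h.eq_one (g := (r ^ j)⁻¹ * g) (by rw [toLin_mul, hgv, hrj])
      (by rw [toLin_mul, hj, toLin_inv_apply])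
    rw [inv_mul_eq_one] at this
    exact ⟨j, by simpa using this⟩
  · intro hg
    have hle : Subgroup.zpowers r ≤ MulAction.stabilizer SO3 (radialImage W) ⊓
        MulAction.stabilizer SO3 (radialPoint hv0) :=
      Subgroup.zpowers_le.2 ⟨hr, MulAction.mem_stabilizer_iff.2 (hrv _ hp)⟩
    exact hle hg

theorem u_mem (h : IsRegularPolyhedron W v₀ w₀ c κ n r s) : toLin r w₀ ∈ W := h.r_maps _ h.w_mem

/-- The functional ⟨·, v₀ + w₀⟩ equals c + κ at the ends of the edge and is at most 2κ < c + κ at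
all other vertices. In `face_or` the comparison is c + 2κ against 3κ. -/
theorem edge_or (h : IsRegularPolyhedron W v₀ w₀ c κ n r s) {g : SO3}
    (hg : g ∈ MulAction.stabilizer SO3 (radialImage W)) (he : toLin g (v₀ + w₀) = v₀ + w₀) :
    toLin g v₀ = v₀ ∨ toLin g v₀ = w₀ := by
  by_contra! hne
  have hm := (h.mem_stabilizer_iff g).1 hg _ h.v_mem
  have h1 := h.inner_le hm h.v_mem hne.1
  have h2 := h.inner_le hm h.w_mem hne.2
  have h3 : inner ℝ (toLin g v₀) (v₀ + w₀) = c + κ := by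
    rw [← he, inner_toLin, inner_add_right, h.inner_self _ h.v_mem, h.inner_vw]
  rw [inner_add_right] at h3
  have := h.lt
  linarith

theorem face_or (h : IsRegularPolyhedron W v₀ w₀ c κ n r s) {g : SO3}
    (hg : g ∈ MulAction.stabilizer SO3 (radialImage W))
    (he : toLin g (v₀ + w₀ + toLin r w₀) = v₀ + w₀ + toLin r w₀) :
    toLin g v₀ = v₀ ∨ toLin g v₀ = w₀ ∨ toLin g v₀ = toLin r w₀ := by
  by_contra! hne
  have hm := (h.mem_stabilizer_iff g).1 hg _ h.v_mem
  have h1 := h.inner_le hm h.v_mem hne.1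
  have h2 := h.inner_le hm h.w_mem hne.2.1
  have h4 := h.inner_le hm h.u_mem hne.2.2
  have h3 : inner ℝ (toLin g v₀) (v₀ + w₀ + toLin r w₀) = c + κ + κ := by
    rw [← he, inner_toLin, inner_add_right, inner_add_right, h.inner_self _ h.v_mem, h.inner_vw,
      h.inner_r]
  rw [inner_add_right, inner_add_right] at h3
  have := h.lt
  linarith

theorem eq_one_of_edge (h : IsRegularPolyhedron W v₀ w₀ c κ n r s) {g : SO3}
    (hv : toLin g v₀ = v₀) (he : toLin g (v₀ + w₀) = v₀ + w₀) : g = 1 := by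
  rw [map_add, hv] at he
  exact h.eq_one hv (add_left_cancel he)

theorem eq_one_of_face (h : IsRegularPolyhedron W v₀ w₀ c κ n r s) {g : SO3}
    (hv : toLin g v₀ = v₀)
    (he : toLin g (v₀ + w₀ + toLin r w₀) = v₀ + w₀ + toLin r w₀) : g = 1 := by
  refine eq_one_of_fixes g v₀ _ hv he (cross_ne_zero ?_)
  simp only [inner_add_right, inner_add_left, h.inner_vw, h.inner_self _ h.v_mem,
    h.inner_self _ h.w_mem, h.inner_self _ h.u_mem, h.inner_r, h.inner_rw, real_inner_comm]
  have := h.pos; have := h.lt; have := h.lower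
  nlinarith [mul_pos h.lower (sub_pos.2 h.lt)]

/-- The half-turn s swaps v₀ and w₀, so it permutes their common neighbours. If it fixed u = r w₀ it
would fix both u and v₀ + w₀ and be trivial; hence s u is the other common neighbour, which r
carries to w₀. Consequently r s permutes the vertices of a face cyclically. -/
theorem s_u (h : IsRegularPolyhedron W v₀ w₀ c κ n r s) :
    toLin r (toLin s (toLin r w₀)) = w₀ := by
  have h1 : inner ℝ v₀ (toLin s (toLin r w₀)) = κ := by
    conv_lhs => rw [← h.s_w]
    rw [inner_toLin, h.inner_rw]
  have h2 : inner ℝ w₀ (toLin s (toLin r w₀)) = κ := by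
    conv_lhs => rw [← h.s_v]
    rw [h.s_v, ← h.s_v, inner_toLin, h.s_v, h.inner_r]
  rcases h.common _ (h.s_maps _ h.u_mem) h1 h2 with h3 | h3
  · exfalso
    have hs1 : s = 1 := by
      refine eq_one_of_fixes s (toLin r w₀) (v₀ + w₀) h3
        (by rw [map_add, h.s_v, h.s_w, add_comm]) (cross_ne_zero ?_)
      simp only [inner_add_right, inner_add_left, h.inner_vw, h.inner_self _ h.v_mem,
        h.inner_self _ h.w_mem, h.inner_self _ h.u_mem, real_inner_comm _ (toLin r w₀),
        h.inner_r, h.inner_rw]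
      rw [real_inner_comm v₀ w₀, h.inner_vw]
      nlinarith [mul_pos h.lower (sub_pos.2 h.lt)]
    have := h.s_v
    rw [hs1, toLin_one] at this
    exact h.v_ne_w this
  · exact h3

theorem s_mem (h : IsRegularPolyhedron W v₀ w₀ c κ n r s) :
    s ∈ MulAction.stabilizer SO3 (radialImage W) := (h.mem_stabilizer_iff s).2 h.s_maps

theorem r_mem (h : IsRegularPolyhedron W v₀ w₀ c κ n r s) :
    r ∈ MulAction.stabilizer SO3 (radialImage W) := (h.mem_stabilizer_iff r).2 h.r_maps

theorem orderOf_s (h : IsRegularPolyhedron W v₀ w₀ c κ n r s) : orderOf s = 2 := by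
  refine orderOf_eq_prime (h.eq_one ?_ ?_) fun h1 => ?_
  · rw [pow_two, toLin_mul, h.s_v, h.s_w]
  · rw [pow_two, toLin_mul, h.s_w, h.s_v]
  · have := h.s_v
    rw [h1, toLin_one] at this
    exact h.v_ne_w this

theorem rs_v (h : IsRegularPolyhedron W v₀ w₀ c κ n r s) : toLin (r * s) v₀ = toLin r w₀ := by
  rw [toLin_mul, h.s_v]

theorem rs_w (h : IsRegularPolyhedron W v₀ w₀ c κ n r s) : toLin (r * s) w₀ = v₀ := by
  rw [toLin_mul, h.s_w, h.r_v]

theorem rs_u (h : IsRegularPolyhedron W v₀ w₀ c κ n r s) :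
    toLin (r * s) (toLin r w₀) = w₀ := by
  rw [toLin_mul, h.s_u]

theorem orderOf_rs (h : IsRegularPolyhedron W v₀ w₀ c κ n r s) : orderOf (r * s) = 3 := by
  refine orderOf_eq_prime (h.eq_one ?_ ?_) fun h1 => ?_
  · rw [pow_succ, pow_two, toLin_mul, toLin_mul, h.rs_v, h.rs_u, h.rs_w]
  · rw [pow_succ, pow_two, toLin_mul, toLin_mul, h.rs_w, h.rs_v, h.rs_u]
  · have := h.rs_w
    rw [h1, toLin_one] at this
    exact h.v_ne_w this.symm

theorem fixes_edge_iff (h : IsRegularPolyhedron W v₀ w₀ c κ n r s) {g : SO3} :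
    (g ∈ MulAction.stabilizer SO3 (radialImage W) ∧ toLin g (v₀ + w₀) = v₀ + w₀) ↔
      g ∈ Subgroup.zpowers s := by
  have hse : toLin s (v₀ + w₀) = v₀ + w₀ := by rw [map_add, h.s_v, h.s_w, add_comm]
  constructor
  · rintro ⟨hg, he⟩
    rcases h.edge_or hg he with h1 | h1
    · rw [h.eq_one_of_edge h1 he]
      exact one_mem _
    · have := h.eq_one_of_edge (g := s * g) (by rw [toLin_mul, h1, h.s_w])
        (by rw [toLin_mul, he, hse])
      rw [eq_inv_of_mul_eq_one_right this]
      exact inv_mem (Subgroup.mem_zpowers s)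
  · intro hg
    have h2 : s ^ 2 = 1 := by rw [← h.orderOf_s, pow_orderOf_eq_one]
    rw [Subgroup.mem_zpowers_iff] at hg
    obtain ⟨k, rfl⟩ := hg
    refine ⟨zpow_mem h.s_mem k, ?_⟩
    rcases Int.even_or_odd' k with ⟨j, rfl | rfl⟩
    · rw [zpow_mul]; norm_cast; rw [h2, one_zpow, toLin_one]
    · rw [zpow_add, zpow_mul, zpow_one]; norm_cast; rw [h2, one_zpow, one_mul, hse]

/-- A rotation fixing the barycenter sends v₀ to a vertex of the face; a power of r s brings it
back, and the product fixes v₀ and the barycenter, so it is trivial. -/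
theorem fixes_face_iff (h : IsRegularPolyhedron W v₀ w₀ c κ n r s) {g : SO3} :
    (g ∈ MulAction.stabilizer SO3 (radialImage W) ∧
      toLin g (v₀ + w₀ + toLin r w₀) = v₀ + w₀ + toLin r w₀) ↔
      g ∈ Subgroup.zpowers (r * s) := by
  have hse : toLin (r * s) (v₀ + w₀ + toLin r w₀) = v₀ + w₀ + toLin r w₀ := by
    rw [map_add, map_add, h.rs_v, h.rs_w, h.rs_u]
    abel
  have h3 : (r * s) ^ 3 = 1 := by
    have := pow_orderOf_eq_one (r * s)
    rwa [h.orderOf_rs] at this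
  have hpow : ∀ k : ℕ, toLin ((r * s) ^ k) (v₀ + w₀ + toLin r w₀) = v₀ + w₀ + toLin r w₀ := by
    intro k
    induction k with
    | zero => rw [pow_zero, toLin_one]
    | succ k ih => rw [pow_succ, toLin_mul, hse, ih]
  constructor
  · rintro ⟨hg, he⟩
    have key : ∀ k : ℕ, toLin ((r * s) ^ k) (toLin g v₀) = v₀ → g ∈ Subgroup.zpowers (r * s) := by
      intro k hk
      have := h.eq_one_of_face (g := (r * s) ^ k * g) (by rw [toLin_mul, hk])
        (by rw [toLin_mul, he, hpow])
      rw [eq_inv_of_mul_eq_one_right this]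
      exact inv_mem (Subgroup.npow_mem_zpowers _ k)
    rcases h.face_or hg he with h1 | h1 | h1
    · exact key 0 (by rw [pow_zero, toLin_one, h1])
    · exact key 1 (by rw [pow_one, h1, h.rs_w])
    · exact key 2 (by rw [pow_two, toLin_mul, h1, h.rs_u, h.rs_w])
  · intro hg
    obtain ⟨k, -, rfl⟩ := (isOfFinOrder_iff_pow_eq_one.2 ⟨3, by norm_num, h3⟩
      ).mem_zpowers_iff_mem_range_orderOf
      |>.1 hg |> Finset.mem_image.1
    exact ⟨pow_mem (mul_mem h.r_mem h.s_mem) k, hpow k⟩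

end IsRegularPolyhedron

theorem ne_zero_of_inner_pos {x y : E3} (hx : 0 < inner ℝ x y) : y ≠ 0 := by
  rintro rfl
  rw [inner_zero_right] at hx
  exact hx.false

/-- `X` is an orbit of `K` on `S²` with isotropy groups of order `n`. -/
def IsIsotropyOrbit (K : Subgroup SO3) (X : Set S2) (n : ℕ) : Prop :=
  ∃ p₀ : S2, (∀ p, p ∈ X ↔ ∃ g ∈ K, p = g • p₀) ∧
    Nat.card (K ⊓ MulAction.stabilizer SO3 p₀ : Subgroup SO3) = n

theorem isIsotropyOrbit_radialImage {X : Set E3} {x₀ : E3} {K : Subgroup SO3} {a : ℝ} (ha : 0 < a)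
    (hx : x₀ ≠ 0) (hX : ∀ x, x ∈ X ↔ ∃ g ∈ K, x = a • toLin g x₀) {t : SO3} {n : ℕ}
    (ht : orderOf t = n) (hK : ∀ g, (g ∈ K ∧ toLin g x₀ = x₀) ↔ g ∈ Subgroup.zpowers t) :
    IsIsotropyOrbit K (radialImage X) n := by
  refine ⟨radialPoint hx, smul_mem_radialImage_iff ha hx hX _ rfl, ?_⟩
  have : K ⊓ MulAction.stabilizer SO3 (radialPoint hx) = Subgroup.zpowers t := by
    ext g
    rw [← hK, Subgroup.mem_inf, MulAction.mem_stabilizer_iff, smul_eq_self_iff_toLin hx rfl]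
  rw [this, Nat.card_zpowers, ht]

theorem card_inf_stabilizer_smul (K : Subgroup SO3) (ρ : SO3) (p : S2) :
    Nat.card (K.map (MulAut.conj ρ).toMonoidHom ⊓ MulAction.stabilizer SO3 (ρ • p) : Subgroup SO3)
      = Nat.card (K ⊓ MulAction.stabilizer SO3 p : Subgroup SO3) := by
  rw [MulAction.stabilizer_smul_eq_stabilizer_map_conj,
    ← Subgroup.map_inf_eq _ _ _ (MulAut.conj ρ).injective,
    Subgroup.card_map_of_injective (MulAut.conj ρ).injective]

namespace IsIsotropyOrbit

variable {K : Subgroup SO3} {X : Set S2} {n : ℕ}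

theorem nonempty (h : IsIsotropyOrbit K X n) : X.Nonempty := by
  obtain ⟨p, hp, -⟩ := h
  exact ⟨p, (hp p).2 ⟨1, one_mem _, (one_smul _ _).symm⟩⟩

theorem exists_smul_eq (h : IsIsotropyOrbit K X n) {p q : S2} (hp : p ∈ X) (hq : q ∈ X) :
    ∃ g ∈ K, q = g • p := by
  obtain ⟨p₀, h₀, -⟩ := h
  obtain ⟨g, hg, rfl⟩ := (h₀ p).1 hp
  obtain ⟨g', hg', rfl⟩ := (h₀ q).1 hq
  exact ⟨g' * g⁻¹, mul_mem hg' (inv_mem hg), by rw [mul_smul, inv_smul_smul]⟩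

theorem smul_mem (h : IsIsotropyOrbit K X n) {p : S2} (hp : p ∈ X) {g : SO3} (hg : g ∈ K) :
    g • p ∈ X := by
  obtain ⟨p₀, h₀, -⟩ := h
  obtain ⟨g', hg', rfl⟩ := (h₀ p).1 hp
  exact (h₀ _).2 ⟨g * g', mul_mem hg hg', (mul_smul _ _ _).symm⟩

theorem card_eq (h : IsIsotropyOrbit K X n) {p : S2} (hp : p ∈ X) :
    Nat.card (K ⊓ MulAction.stabilizer SO3 p : Subgroup SO3) = n := by
  obtain ⟨p₀, h₀, hc⟩ := h
  obtain ⟨g, hg, rfl⟩ := (h₀ p).1 hp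
  rw [← hc, ← card_inf_stabilizer_smul K g p₀]
  congr 2
  have hn : K.map (MulAut.conj g).toMonoidHom = K := by
    ext x
    simp only [Subgroup.mem_map, MulEquiv.coe_toMonoidHom, MulAut.conj_apply]
    constructor
    · rintro ⟨y, hy, rfl⟩
      exact mul_mem (mul_mem hg hy) (inv_mem hg)
    · intro hx
      exact ⟨g⁻¹ * x * g, mul_mem (mul_mem (inv_mem hg) hx) hg, by group⟩
  rw [hn]

theorem conj (h : IsIsotropyOrbit K X n) (ρ : SO3) :
    IsIsotropyOrbit (K.map (MulAut.conj ρ).toMonoidHom) (ρ • X) n := by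
  obtain ⟨p₀, h₀, hc⟩ := h
  refine ⟨ρ • p₀, fun p => ?_, by rw [card_inf_stabilizer_smul, hc]⟩
  rw [Set.mem_smul_set_iff_inv_smul_mem, h₀]
  constructor
  · rintro ⟨g, hg, h1⟩
    refine ⟨ρ * g * ρ⁻¹, ⟨g, hg, rfl⟩, ?_⟩
    rw [inv_smul_eq_iff] at h1
    rw [h1, mul_smul, mul_smul, inv_smul_smul]
  · rintro ⟨-, ⟨g, hg, rfl⟩, rfl⟩
    refine ⟨g, hg, ?_⟩
    simp [mul_smul]

theorem card_mul (h : IsIsotropyOrbit K X n) : Nat.card X * n = Nat.card K := by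
  obtain ⟨p₀, h₀, hc⟩ := h
  have hX : X = MulAction.orbit K p₀ := by
    ext p
    rw [h₀]
    constructor
    · rintro ⟨g, hg, rfl⟩
      exact ⟨⟨g, hg⟩, rfl⟩
    · rintro ⟨g, rfl⟩
      exact ⟨g.1, g.2, rfl⟩
  have hs : Nat.card (MulAction.stabilizer K p₀) = n := by
    rw [← hc]
    refine Nat.card_congr ⟨fun g => ⟨g.1.1, g.1.2, g.2⟩, fun g => ⟨⟨g.1, g.2.1⟩, g.2.2⟩,
      fun _ => rfl, fun _ => rfl⟩
  rw [hX, ← hs, ← Nat.card_prod]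
  exact Nat.card_congr (MulAction.orbitProdStabilizerEquivGroup K p₀)

end IsIsotropyOrbit

namespace IsRegularPolyhedron

variable {W : Set E3} {v₀ w₀ : E3} {c κ : ℝ} {n : ℕ} {r s : SO3}

theorem isIsotropyOrbit_vertices (h : IsRegularPolyhedron W v₀ w₀ c κ n r s) :
    IsIsotropyOrbit (MulAction.stabilizer SO3 (radialImage W)) (radialImage W) n := by
  refine isIsotropyOrbit_radialImage one_pos (ne_zero_of_inner_pos (x := v₀) (by
    rw [h.inner_self _ h.v_mem]; exact h.pos)) (fun x => ?_) h.order fun g => h.fixes_vertex_iff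
  simp only [one_smul]
  constructor
  · intro hx
    obtain ⟨g, hg, rfl⟩ := h.trans x hx
    exact ⟨g, (h.mem_stabilizer_iff g).2 hg, rfl⟩
  · rintro ⟨g, hg, rfl⟩
    exact (h.mem_stabilizer_iff g).1 hg _ h.v_mem

theorem isIsotropyOrbit_edges (h : IsRegularPolyhedron W v₀ w₀ c κ n r s) :
    IsIsotropyOrbit (MulAction.stabilizer SO3 (radialImage W)) (radialImage
      {x | ∃ v ∈ W, ∃ w ∈ W, inner ℝ v w = κ ∧ x = (2 : ℝ)⁻¹ • (v + w)}) 2 := by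
  have := h.pos; have := h.lower
  refine isIsotropyOrbit_radialImage (a := 2⁻¹) (by norm_num) (ne_zero_of_inner_pos (x := v₀) (by
    rw [inner_add_right, h.inner_self _ h.v_mem, h.inner_vw]; linarith)) (fun x => ?_) h.orderOf_s
    fun g => h.fixes_edge_iff
  constructor
  · rintro ⟨v, hv, w, hw, hvw, rfl⟩
    obtain ⟨g, hg, rfl, rfl⟩ := h.exists_arc hv hw hvw
    exact ⟨g, hg, by rw [map_add]⟩
  · rintro ⟨g, hg, rfl⟩
    have hm := (h.mem_stabilizer_iff g).1 hg
    exact ⟨_, hm _ h.v_mem, _, hm _ h.w_mem, by rw [inner_toLin, h.inner_vw], by rw [map_add]⟩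

theorem isIsotropyOrbit_faces (h : IsRegularPolyhedron W v₀ w₀ c κ n r s) :
    IsIsotropyOrbit (MulAction.stabilizer SO3 (radialImage W)) (radialImage
      {x | ∃ u ∈ W, ∃ v ∈ W, ∃ w ∈ W, inner ℝ u v = κ ∧ inner ℝ v w = κ ∧ inner ℝ u w = κ ∧
        x = (3 : ℝ)⁻¹ • (u + v + w)}) 3 := by
  have := h.pos; have := h.lower
  refine isIsotropyOrbit_radialImage (a := 3⁻¹) (by norm_num) (ne_zero_of_inner_pos (x := v₀) (by
    rw [inner_add_right, inner_add_right, h.inner_self _ h.v_mem, h.inner_vw, h.inner_r]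
    linarith)) (fun x => ?_) h.orderOf_rs fun g => h.fixes_face_iff
  constructor
  · rintro ⟨v, hv, w, hw, u, hu, hvw, hwu, hvu, rfl⟩
    obtain ⟨g, hg, rfl, rfl⟩ := h.exists_arc hv hw hvw
    have hm := (h.mem_stabilizer_iff _).1 (inv_mem hg) _ hu
    rw [← toLin_apply_inv g u, inner_toLin] at hwu hvu
    rcases h.common _ hm hvu hwu with h1 | h1
    · refine ⟨g, hg, ?_⟩
      rw [map_add, map_add, ← h1, toLin_apply_inv]
    -- Here the third vertex is the other common neighbour r⁻¹ w₀, and r⁻¹ carries the triangle v₀,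
    -- w₀, r w₀ to v₀, r⁻¹ w₀, w₀.
    · refine ⟨g * r⁻¹, mul_mem hg (inv_mem h.r_mem), ?_⟩
      have e1 : toLin r⁻¹ v₀ = v₀ := by
        conv_lhs => rw [← h.r_v]
        rw [toLin_inv_apply]
      have e2 : toLin r⁻¹ w₀ = toLin g⁻¹ u := by rw [← h1, toLin_inv_apply]
      rw [toLin_mul, map_add, map_add, map_add, map_add, toLin_inv_apply, e1, e2, toLin_apply_inv]
      congr 1
      abel
  · rintro ⟨g, hg, rfl⟩
    have hm := (h.mem_stabilizer_iff g).1 hg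
    exact ⟨_, hm _ h.v_mem, _, hm _ h.w_mem, _, hm _ h.u_mem, by rw [inner_toLin, h.inner_vw],
      by rw [inner_toLin, h.inner_rw], by rw [inner_toLin, h.inner_r],
      by rw [map_add, map_add]⟩

/-- All vertices have the same norm, so minimal distance means maximal inner product. -/
theorem adj_iff {Q : Polyhedron} (h : IsRegularPolyhedron Q.vertices v₀ w₀ c κ n r s) (v w : E3) :
    Q.Adj v w ↔ v ∈ Q.vertices ∧ w ∈ Q.vertices ∧ inner ℝ v w = κ := by
  have hd : ∀ v ∈ Q.vertices, ∀ w ∈ Q.vertices, dist v w ^ 2 = 2 * c - 2 * inner ℝ v w := by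
    intro v hv w hw
    rw [dist_eq_norm, norm_sub_sq_real, ← real_inner_self_eq_norm_sq, ← real_inner_self_eq_norm_sq,
      h.inner_self _ hv, h.inner_self _ hw]
    ring
  constructor
  · rintro ⟨hv, hw, hvw, hmin⟩
    refine ⟨hv, hw, le_antisymm (h.inner_le hv hw hvw) ?_⟩
    have h1 := pow_le_pow_left₀ dist_nonneg (hmin _ h.v_mem _ h.w_mem h.v_ne_w) 2
    rw [hd _ hv _ hw, hd _ h.v_mem _ h.w_mem, h.inner_vw] at h1
    linarith
  · rintro ⟨hv, hw, hvw⟩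
    refine ⟨hv, hw, ?_, fun v' hv' w' hw' hne => ?_⟩
    · rintro rfl
      rw [h.inner_self _ hv] at hvw
      exact h.lt.ne' hvw
    · rw [← pow_le_pow_iff_left₀ dist_nonneg dist_nonneg two_ne_zero, hd _ hv _ hw,
        hd _ hv' _ hw', hvw]
      have := h.inner_le hv' hw' hne
      linarith

theorem orbits {Q : Polyhedron} (h : IsRegularPolyhedron Q.vertices v₀ w₀ c κ n r s) (ρ : SO3) :
    IsIsotropyOrbit (rotationGroup Q ρ) (vertexPoints Q ρ) n ∧
      IsIsotropyOrbit (rotationGroup Q ρ) (edgePoints Q ρ) 2 ∧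
      IsIsotropyOrbit (rotationGroup Q ρ) (facePoints Q ρ) 3 ∧ Finite (rotationGroup Q ρ) := by
  have hP : rotationGroup Q ρ = (MulAction.stabilizer SO3 (radialImage Q.vertices)).map
      (MulAut.conj ρ).toMonoidHom := by
    rw [rotationGroup, vertexPoints, MulAction.stabilizer_smul_eq_stabilizer_map_conj]
  have hE : Q.edgeMidpoints = {x | ∃ v ∈ Q.vertices, ∃ w ∈ Q.vertices, inner ℝ v w = κ ∧
      x = (2 : ℝ)⁻¹ • (v + w)} := by
    ext x
    simp only [Polyhedron.edgeMidpoints, h.adj_iff, Set.mem_ofPred_eq]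
    constructor
    · rintro ⟨v, w, ⟨hv, hw, hvw⟩, hx⟩
      exact ⟨v, hv, w, hw, hvw, hx⟩
    · rintro ⟨v, hv, w, hw, hvw, hx⟩
      exact ⟨v, w, ⟨hv, hw, hvw⟩, hx⟩
  have hF : Q.faceBarycenters = {x | ∃ u ∈ Q.vertices, ∃ v ∈ Q.vertices, ∃ w ∈ Q.vertices,
      inner ℝ u v = κ ∧ inner ℝ v w = κ ∧ inner ℝ u w = κ ∧ x = (3 : ℝ)⁻¹ • (u + v + w)} := by
    ext x
    simp only [Polyhedron.faceBarycenters, h.adj_iff, Set.mem_ofPred_eq]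
    constructor
    · rintro ⟨u, v, w, ⟨hu, hv, huv⟩, ⟨-, hw, hvw⟩, ⟨-, -, huw⟩, hx⟩
      exact ⟨u, hu, v, hv, w, hw, huv, hvw, huw, hx⟩
    · rintro ⟨u, hu, v, hv, w, hw, huv, hvw, huw, hx⟩
      exact ⟨u, v, w, ⟨hu, hv, huv⟩, ⟨hv, hw, hvw⟩, ⟨hu, hw, huw⟩, hx⟩
  rw [hP]
  refine ⟨h.isIsotropyOrbit_vertices.conj ρ, ?_, ?_, ?_⟩
  · rw [edgePoints, hE]
    exact h.isIsotropyOrbit_edges.conj ρ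
  · rw [facePoints, hF]
    exact h.isIsotropyOrbit_faces.conj ρ
  · have := h.finite_stabilizer
    exact Finite.of_equiv _ (Subgroup.equivMapOfInjective _ _ (MulAut.conj ρ).injective).toEquiv

end IsRegularPolyhedron

/-! ### The tetrahedron, the octahedron and the icosahedron -/

theorem toLin_mk {a b c d e f g h i : ℝ}
    (hM : !![a, b, c; d, e, f; g, h, i] ∈ Matrix.specialOrthogonalGroup (Fin 3) ℝ) (x y z : ℝ) :
    toLin (⟨!![a, b, c; d, e, f; g, h, i], hM⟩ : SO3) !₂[x, y, z]
      = !₂[a * x + b * y + c * z, d * x + e * y + f * z, g * x + h * y + i * z] := by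
  rw [toLin_apply]
  ext j
  fin_cases j <;> simp [Matrix.mulVec, dotProduct, Fin.sum_univ_three]

theorem inner_E3_mk (x y z x' y' z' : ℝ) :
    inner ℝ (!₂[x, y, z] : E3) !₂[x', y', z'] = x * x' + y * y' + z * z' := by
  rw [inner_E3]
  simp

theorem E3_mk_inj {x y z x' y' z' : ℝ} :
    (!₂[x, y, z] : E3) = !₂[x', y', z'] ↔ x = x' ∧ y = y' ∧ z = z' := by
  constructor
  · intro h
    exact ⟨congrArg (fun v : E3 => v 0) h, congrArg (fun v : E3 => v 1) h,
      congrArg (fun v : E3 => v 2) h⟩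
  · rintro ⟨rfl, rfl, rfl⟩
    rfl

theorem real_sq_eq_one_iff {a : ℝ} : a ^ 2 = 1 ↔ a = 1 ∨ a = -1 :=
  ⟨fun h => sq_eq_sq_iff_eq_or_eq_neg.1 (h.trans (one_pow 2).symm), by
    rintro (rfl | rfl) <;> norm_num⟩

theorem diagonal_mem {a b : ℝ} (ha : a ^ 2 = 1) (hb : b ^ 2 = 1) :
    !![a, 0, 0; 0, b, 0; 0, 0, a * b] ∈ Matrix.specialOrthogonalGroup (Fin 3) ℝ := by
  rw [Matrix.mem_specialOrthogonalGroup_iff, Matrix.mem_orthogonalGroup_iff]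
  constructor
  · ext i j
    fin_cases i <;> fin_cases j <;> simp [Matrix.mul_apply, Fin.sum_univ_three] <;> nlinarith
  · simp [Matrix.det_fin_three]
    linear_combination b ^ 2 * ha + hb

/-- The rotation `diag(a, b, ab)` with `a, b = ±1`. -/
def diagRot {a b : ℝ} (ha : a ^ 2 = 1) (hb : b ^ 2 = 1) : SO3 := ⟨_, diagonal_mem ha hb⟩

theorem toLin_diagRot {a b : ℝ} (ha : a ^ 2 = 1) (hb : b ^ 2 = 1) (x y z : ℝ) :
    toLin (diagRot ha hb) !₂[x, y, z] = !₂[a * x, b * y, a * b * z] := by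
  rw [diagRot, toLin_mk]
  simp

theorem cyclic_mem :
    !![0, 0, 1; 1, 0, 0; 0, 1, 0] ∈ Matrix.specialOrthogonalGroup (Fin 3) ℝ := by
  rw [Matrix.mem_specialOrthogonalGroup_iff, Matrix.mem_orthogonalGroup_iff]
  constructor
  · ext i j
    fin_cases i <;> fin_cases j <;> simp [Matrix.mul_apply, Fin.sum_univ_three]
  · simp [Matrix.det_fin_three]

/-- The cyclic permutation of the coordinates. -/
def cyclicRot : SO3 := ⟨_, cyclic_mem⟩

theorem toLin_cyclicRot (x y z : ℝ) : toLin cyclicRot !₂[x, y, z] = !₂[z, x, y] := by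
  rw [cyclicRot, toLin_mk]
  simp

theorem quarter_mem :
    !![0, -1, 0; 1, 0, 0; 0, 0, 1] ∈ Matrix.specialOrthogonalGroup (Fin 3) ℝ := by
  rw [Matrix.mem_specialOrthogonalGroup_iff, Matrix.mem_orthogonalGroup_iff]
  constructor
  · ext i j
    fin_cases i <;> fin_cases j <;> simp [Matrix.mul_apply, Fin.sum_univ_three]
  · simp [Matrix.det_fin_three]

/-- The quarter-turn about the third axis. -/
def quarterRot : SO3 := ⟨_, quarter_mem⟩

theorem toLin_quarterRot (x y z : ℝ) : toLin quarterRot !₂[x, y, z] = !₂[-y, x, z] := by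
  rw [quarterRot, toLin_mk]
  simp

theorem swap_mem :
    !![0, 0, 1; 0, -1, 0; 1, 0, 0] ∈ Matrix.specialOrthogonalGroup (Fin 3) ℝ := by
  rw [Matrix.mem_specialOrthogonalGroup_iff, Matrix.mem_orthogonalGroup_iff]
  constructor
  · ext i j
    fin_cases i <;> fin_cases j <;> simp [Matrix.mul_apply, Fin.sum_univ_three]
  · simp [Matrix.det_fin_three]

/-- The half-turn about `(1, 0, 1)`. -/
def swapRot : SO3 := ⟨_, swap_mem⟩

theorem toLin_swapRot (x y z : ℝ) : toLin swapRot !₂[x, y, z] = !₂[z, -y, x] := by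
  rw [swapRot, toLin_mk]
  simp

theorem pentagonal_mem {φ : ℝ} (h : φ ^ 2 = φ + 1) :
    !![(φ - 1) / 2, -φ / 2, 1 / 2; φ / 2, 1 / 2, (φ - 1) / 2; -1 / 2, (φ - 1) / 2, φ / 2]
      ∈ Matrix.specialOrthogonalGroup (Fin 3) ℝ := by
  rw [Matrix.mem_specialOrthogonalGroup_iff, Matrix.mem_orthogonalGroup_iff]
  constructor
  · ext i j
    fin_cases i <;> fin_cases j <;> simp [Matrix.mul_apply, Fin.sum_univ_three] <;> nlinarith
  · simp [Matrix.det_fin_three]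
    linear_combination (3 / 4) * h

/-- The rotation of order five about `(0, 1, φ)`, where `φ` is the golden ratio. -/
def pentagonalRot : SO3 := ⟨_, pentagonal_mem Real.goldenRatio_sq⟩

theorem toLin_pentagonalRot (x y z : ℝ) : toLin pentagonalRot !₂[x, y, z] =
    !₂[((Real.goldenRatio - 1) * x - Real.goldenRatio * y + z) / 2,
      (Real.goldenRatio * x + y + (Real.goldenRatio - 1) * z) / 2,
      (-x + (Real.goldenRatio - 1) * y + Real.goldenRatio * z) / 2] := by
  rw [pentagonalRot, toLin_mk, E3_mk_inj]
  refine ⟨?_, ?_, ?_⟩ <;> ring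

theorem isRegularPolyhedron_tetrahedron : IsRegularPolyhedron Polyhedron.tetrahedron.vertices
    !₂[1, 1, 1] !₂[1, -1, -1] 3 (-1) 3 cyclicRot
    (diagRot (a := 1) (b := -1) (by norm_num) (by norm_num)) where
  finite := Set.toFinite {!₂[1, 1, 1], !₂[1, -1, -1], !₂[-1, 1, -1], !₂[-1, -1, 1]}
  inner_self := by
    rintro v (rfl | rfl | rfl | rfl) <;> rw [inner_E3_mk] <;> norm_num
  pos := by norm_num
  lt := by norm_num
  lower := by norm_num
  v_mem := by simp [Polyhedron.vertices]
  w_mem := by simp [Polyhedron.vertices]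
  inner_vw := by rw [inner_E3_mk]; norm_num
  r_maps := by
    rintro v (rfl | rfl | rfl | rfl) <;> rw [toLin_cyclicRot] <;> simp [Polyhedron.vertices]
  s_maps := by
    rintro v (rfl | rfl | rfl | rfl) <;> rw [toLin_diagRot] <;> simp [Polyhedron.vertices]
  r_v := by rw [toLin_cyclicRot]
  s_v := by rw [toLin_diagRot]; simp
  s_w := by rw [toLin_diagRot]; simp
  trans := by
    have key : ∀ a b : ℝ, ∀ ha : a ^ 2 = 1, ∀ hb : b ^ 2 = 1,
        ∀ v ∈ Polyhedron.tetrahedron.vertices,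
          toLin (diagRot ha hb) v ∈ Polyhedron.tetrahedron.vertices := by
      intro a b ha hb
      rcases real_sq_eq_one_iff.1 ha with rfl | rfl <;>
      rcases real_sq_eq_one_iff.1 hb with rfl | rfl <;>
      rintro v (rfl | rfl | rfl | rfl) <;> rw [toLin_diagRot] <;> simp [Polyhedron.vertices]
    rintro v (rfl | rfl | rfl | rfl)
    · exact ⟨1, fun w hw => by rwa [toLin_one], toLin_one _⟩
    · exact ⟨diagRot (a := 1) (b := -1) (by norm_num) (by norm_num), key _ _ _ _,
        by rw [toLin_diagRot]; simp⟩
    · exact ⟨diagRot (a := -1) (b := 1) (by norm_num) (by norm_num), key _ _ _ _,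
        by rw [toLin_diagRot]; simp⟩
    · exact ⟨diagRot (a := -1) (b := -1) (by norm_num) (by norm_num), key _ _ _ _,
        by rw [toLin_diagRot]; simp⟩
  le := by
    rintro w (rfl | rfl | rfl | rfl) hw
    · exact absurd rfl hw
    all_goals rw [inner_E3_mk]; norm_num
  link := by
    rintro w (rfl | rfl | rfl | rfl) hw
    · rw [inner_E3_mk] at hw
      norm_num at hw
    · exact ⟨0, by rw [pow_zero, toLin_one]⟩
    · exact ⟨1, by rw [pow_one, toLin_cyclicRot]⟩
    · exact ⟨2, by rw [pow_two, toLin_mul, toLin_cyclicRot, toLin_cyclicRot]⟩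
  inner_rw := by rw [toLin_cyclicRot, inner_E3_mk]; norm_num
  common := by
    rintro w (rfl | rfl | rfl | rfl) h1 h2
    · rw [inner_E3_mk] at h1
      norm_num at h1
    · rw [inner_E3_mk] at h2
      norm_num at h2
    · left; rw [toLin_cyclicRot]
    · right; rw [toLin_cyclicRot]
  order := by
    refine orderOf_eq_prime (eq_one_of_fixes _ !₂[1, 0, 0] !₂[0, 1, 0] ?_ ?_ ?_) fun h => ?_
    · rw [pow_succ, pow_two, toLin_mul, toLin_mul, toLin_cyclicRot, toLin_cyclicRot,
        toLin_cyclicRot]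
    · rw [pow_succ, pow_two, toLin_mul, toLin_mul, toLin_cyclicRot, toLin_cyclicRot,
        toLin_cyclicRot]
    · refine cross_ne_zero ?_
      rw [inner_E3_mk, inner_E3_mk, inner_E3_mk]
      norm_num
    · have := toLin_cyclicRot 1 0 0
      rw [h, toLin_one, E3_mk_inj] at this
      norm_num at this

theorem isRegularPolyhedron_octahedron : IsRegularPolyhedron Polyhedron.octahedron.vertices
    !₂[0, 0, 1] !₂[1, 0, 0] 1 0 4 quarterRot swapRot where
  finite := Set.toFinite {!₂[1, 0, 0], !₂[-1, 0, 0], !₂[0, 1, 0], !₂[0, -1, 0], !₂[0, 0, 1],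
    !₂[0, 0, -1]}
  inner_self := by
    rintro v (rfl | rfl | rfl | rfl | rfl | rfl) <;> rw [inner_E3_mk] <;> norm_num
  pos := by norm_num
  lt := by norm_num
  lower := by norm_num
  v_mem := by simp [Polyhedron.vertices]
  w_mem := by simp [Polyhedron.vertices]
  inner_vw := by rw [inner_E3_mk]; norm_num
  r_maps := by
    rintro v (rfl | rfl | rfl | rfl | rfl | rfl) <;> rw [toLin_quarterRot] <;>
      simp [Polyhedron.vertices]
  s_maps := by
    rintro v (rfl | rfl | rfl | rfl | rfl | rfl) <;> rw [toLin_swapRot] <;>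
      simp [Polyhedron.vertices]
  r_v := by rw [toLin_quarterRot]; simp
  s_v := by rw [toLin_swapRot]; simp
  s_w := by rw [toLin_swapRot]; simp
  trans := by
    have hc : ∀ v ∈ Polyhedron.octahedron.vertices,
        toLin cyclicRot v ∈ Polyhedron.octahedron.vertices := by
      rintro v (rfl | rfl | rfl | rfl | rfl | rfl) <;> rw [toLin_cyclicRot] <;>
        simp [Polyhedron.vertices]
    have hd : ∀ v ∈ Polyhedron.octahedron.vertices,
        toLin (diagRot (a := 1) (b := -1) (by norm_num) (by norm_num)) v ∈
          Polyhedron.octahedron.vertices := by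
      rintro v (rfl | rfl | rfl | rfl | rfl | rfl) <;> rw [toLin_diagRot] <;>
        simp [Polyhedron.vertices]
    rintro v (rfl | rfl | rfl | rfl | rfl | rfl)
    · exact ⟨cyclicRot, hc, by rw [toLin_cyclicRot]⟩
    · refine ⟨cyclicRot * diagRot (a := 1) (b := -1) (by norm_num) (by norm_num),
        fun v hv => ?_, ?_⟩
      · rw [toLin_mul]
        exact hc _ (hd _ hv)
      · rw [toLin_mul, toLin_diagRot, toLin_cyclicRot]
        simp
    · refine ⟨cyclicRot * cyclicRot, fun v hv => ?_, ?_⟩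
      · rw [toLin_mul]
        exact hc _ (hc _ hv)
      · rw [toLin_mul, toLin_cyclicRot, toLin_cyclicRot]
    · refine ⟨cyclicRot * (cyclicRot * diagRot (a := 1) (b := -1) (by norm_num) (by norm_num)),
        fun v hv => ?_, ?_⟩
      · rw [toLin_mul, toLin_mul]
        exact hc _ (hc _ (hd _ hv))
      · rw [toLin_mul, toLin_mul, toLin_diagRot, toLin_cyclicRot, toLin_cyclicRot]
        simp
    · exact ⟨1, fun w hw => by rwa [toLin_one], toLin_one _⟩
    · exact ⟨_, hd, by rw [toLin_diagRot]; simp⟩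
  le := by
    rintro w (rfl | rfl | rfl | rfl | rfl | rfl) hw
    any_goals exact absurd rfl hw
    all_goals rw [inner_E3_mk]; norm_num
  link := by
    rintro w (rfl | rfl | rfl | rfl | rfl | rfl) hw
    · exact ⟨0, by rw [pow_zero, toLin_one]⟩
    · exact ⟨2, by rw [pow_two, toLin_mul, toLin_quarterRot, toLin_quarterRot]; simp⟩
    · exact ⟨1, by rw [pow_one, toLin_quarterRot]; simp⟩
    · exact ⟨3, by rw [pow_succ, pow_two, toLin_mul, toLin_mul, toLin_quarterRot, toLin_quarterRot,
        toLin_quarterRot]; simp⟩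
    all_goals
      rw [inner_E3_mk] at hw
      norm_num at hw
  inner_rw := by rw [toLin_quarterRot, inner_E3_mk]; norm_num
  common := by
    rintro w (rfl | rfl | rfl | rfl | rfl | rfl) h1 h2
    any_goals rw [inner_E3_mk] at h2; norm_num at h2
    any_goals rw [inner_E3_mk] at h1; norm_num at h1
    · left; rw [toLin_quarterRot]; simp
    · right; rw [toLin_quarterRot]; simp
  order := by
    have h2 : ∀ x y z, toLin (quarterRot ^ 2) !₂[x, y, z] = !₂[-x, -y, z] := fun x y z => by
      rw [pow_two, toLin_mul, toLin_quarterRot, toLin_quarterRot]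
    have h4 : ∀ x y z, toLin (quarterRot ^ 4) !₂[x, y, z] = !₂[x, y, z] := fun x y z => by
      rw [show 4 = 2 * 2 from rfl, pow_mul, pow_two (quarterRot ^ 2), toLin_mul, h2, h2]
      simp
    refine orderOf_eq_prime_pow (p := 2) (n := 1) (fun h => ?_)
      (eq_one_of_fixes _ !₂[1, 0, 0] !₂[0, 1, 0] (h4 _ _ _) (h4 _ _ _) ?_)
    · have := h2 1 0 0
      rw [pow_one] at h
      rw [h, toLin_one, E3_mk_inj] at this
      norm_num at this
    · refine cross_ne_zero ?_
      rw [inner_E3_mk, inner_E3_mk, inner_E3_mk]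
      norm_num

theorem mem_icosahedron_iff {v : E3} : v ∈ Polyhedron.icosahedron.vertices ↔
    ∃ a b : ℝ, (a = 1 ∨ a = -1) ∧ (b = 1 ∨ b = -1) ∧
      (v = !₂[0, a, b * Real.goldenRatio] ∨ v = !₂[a, b * Real.goldenRatio, 0] ∨
        v = !₂[b * Real.goldenRatio, 0, a]) := by
  simp only [Polyhedron.vertices, Set.mem_ofPred_eq, real_sq_eq_one_iff]

/-- `hr1` to `hr5` trace the 5-cycle of the neighbours of v₀ under `pentagonalRot`; this cycle
supplies `link`, `common` and `order`. -/
theorem isRegularPolyhedron_icosahedron : IsRegularPolyhedron Polyhedron.icosahedron.vertices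
    !₂[0, 1, Real.goldenRatio] !₂[0, -1, Real.goldenRatio] (Real.goldenRatio + 2) Real.goldenRatio
    5 pentagonalRot (diagRot (a := -1) (b := -1) (by norm_num) (by norm_num)) := by
  have hφ := Real.goldenRatio_sq
  have hφ1 := Real.one_lt_goldenRatio
  have hr0 : toLin pentagonalRot !₂[0, 1, Real.goldenRatio] = !₂[0, 1, Real.goldenRatio] := by
    rw [toLin_pentagonalRot, E3_mk_inj]
    refine ⟨?_, ?_, ?_⟩ <;> linarith
  have hr1 : toLin pentagonalRot !₂[0, -1, Real.goldenRatio] = !₂[Real.goldenRatio, 0, 1] := by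
    rw [toLin_pentagonalRot, E3_mk_inj]
    refine ⟨?_, ?_, ?_⟩ <;> linarith
  have hr2 : toLin pentagonalRot !₂[Real.goldenRatio, 0, 1] = !₂[1, Real.goldenRatio, 0] := by
    rw [toLin_pentagonalRot, E3_mk_inj]
    refine ⟨?_, ?_, ?_⟩ <;> linarith
  have hr3 : toLin pentagonalRot !₂[1, Real.goldenRatio, 0] = !₂[-1, Real.goldenRatio, 0] := by
    rw [toLin_pentagonalRot, E3_mk_inj]
    refine ⟨?_, ?_, ?_⟩ <;> linarith
  have hr4 : toLin pentagonalRot !₂[-1, Real.goldenRatio, 0] = !₂[-Real.goldenRatio, 0, 1] := by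
    rw [toLin_pentagonalRot, E3_mk_inj]
    refine ⟨?_, ?_, ?_⟩ <;> linarith
  have hr5 : toLin pentagonalRot !₂[-Real.goldenRatio, 0, 1] = !₂[0, -1, Real.goldenRatio] := by
    rw [toLin_pentagonalRot, E3_mk_inj]
    refine ⟨?_, ?_, ?_⟩ <;> linarith
  have hd : ∀ a b : ℝ, ∀ ha : a ^ 2 = 1, ∀ hb : b ^ 2 = 1,
      ∀ v ∈ Polyhedron.icosahedron.vertices,
        toLin (diagRot ha hb) v ∈ Polyhedron.icosahedron.vertices := by
    rintro a b ha hb v ⟨c, d, hc, hd, rfl | rfl | rfl⟩ <;> rw [toLin_diagRot]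
    · refine ⟨b * c, a * b * d, by rw [mul_pow, hb, hc, one_mul],
        by rw [mul_pow, mul_pow, ha, hb, hd]; norm_num, Or.inl ?_⟩
      rw [E3_mk_inj]; refine ⟨?_, ?_, ?_⟩ <;> ring
    · refine ⟨a * c, b * d, by rw [mul_pow, ha, hc, one_mul],
        by rw [mul_pow, hb, hd]; norm_num, Or.inr (Or.inl ?_)⟩
      rw [E3_mk_inj]; refine ⟨?_, ?_, ?_⟩ <;> ring
    · refine ⟨a * b * c, a * d, by rw [mul_pow, mul_pow, ha, hb, hc]; norm_num,
        by rw [mul_pow, ha, hd, one_mul], Or.inr (Or.inr ?_)⟩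
      rw [E3_mk_inj]; refine ⟨?_, ?_, ?_⟩ <;> ring
  have hcy : ∀ v ∈ Polyhedron.icosahedron.vertices,
      toLin cyclicRot v ∈ Polyhedron.icosahedron.vertices := by
    rintro v ⟨c, d, hc, hd, rfl | rfl | rfl⟩ <;> rw [toLin_cyclicRot]
    · exact ⟨c, d, hc, hd, Or.inr (Or.inr rfl)⟩
    · exact ⟨c, d, hc, hd, Or.inl rfl⟩
    · exact ⟨c, d, hc, hd, Or.inr (Or.inl rfl)⟩
  exact {
    finite := by
      refine (((Set.toFinite {((1 : ℝ), (1 : ℝ)), (1, -1), (-1, 1), (-1, -1)}).image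
        (fun u : ℝ × ℝ => (!₂[0, u.1, u.2 * Real.goldenRatio] : E3))).union
        (((Set.toFinite {((1 : ℝ), (1 : ℝ)), (1, -1), (-1, 1), (-1, -1)}).image
        (fun u : ℝ × ℝ => (!₂[u.1, u.2 * Real.goldenRatio, 0] : E3))).union
        ((Set.toFinite {((1 : ℝ), (1 : ℝ)), (1, -1), (-1, 1), (-1, -1)}).image
        (fun u : ℝ × ℝ => (!₂[u.2 * Real.goldenRatio, 0, u.1] : E3))))).subset ?_
      intro v hv
      obtain ⟨a, b, ha, hb, h⟩ := mem_icosahedron_iff.1 hv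
      have hab : (a, b) ∈ ({((1 : ℝ), (1 : ℝ)), (1, -1), (-1, 1), (-1, -1)} : Set (ℝ × ℝ)) := by
        rcases ha with rfl | rfl <;> rcases hb with rfl | rfl <;> simp
      rcases h with rfl | rfl | rfl
      · exact Or.inl ⟨_, hab, rfl⟩
      · exact Or.inr (Or.inl ⟨_, hab, rfl⟩)
      · exact Or.inr (Or.inr ⟨_, hab, rfl⟩)
    inner_self := by
      rintro v ⟨a, b, ha, hb, rfl | rfl | rfl⟩ <;> rw [inner_E3_mk] <;>
        linear_combination ha + Real.goldenRatio ^ 2 * hb + hφ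
    pos := by linarith
    lt := by linarith
    lower := by linarith
    v_mem := ⟨1, 1, by norm_num, by norm_num, Or.inl (by rw [one_mul])⟩
    w_mem := ⟨-1, 1, by norm_num, by norm_num, Or.inl (by rw [one_mul])⟩
    inner_vw := by rw [inner_E3_mk]; linarith
    r_maps := by
      rintro v ⟨a, b, ha, hb, h⟩
      have hab : a = b ∨ a = -b := sq_eq_sq_iff_eq_or_eq_neg.1 (ha.trans hb.symm)
      have hb' : (-b) ^ 2 = 1 := by rw [neg_sq, hb]
      rcases hab with rfl | rfl <;> rcases h with rfl | rfl | rfl <;> rw [toLin_pentagonalRot]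
      · refine ⟨a, a, ha, ha, Or.inl ?_⟩
        rw [E3_mk_inj]
        refine ⟨?_, ?_, ?_⟩ <;>
          first | ring1 | linear_combination (a / 2) * hφ
      · refine ⟨-a, a, hb', ha, Or.inr (Or.inl ?_)⟩
        rw [E3_mk_inj]
        refine ⟨?_, ?_, ?_⟩ <;>
          first | ring1 | linear_combination (a / 2) * hφ | linear_combination (-a / 2) * hφ
      · refine ⟨a, a, ha, ha, Or.inr (Or.inl ?_)⟩
        rw [E3_mk_inj]
        refine ⟨?_, ?_, ?_⟩ <;>
          first | ring1 | linear_combination (a / 2) * hφ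
      · refine ⟨b, b, hb, hb, Or.inr (Or.inr ?_)⟩
        rw [E3_mk_inj]
        refine ⟨?_, ?_, ?_⟩ <;>
          first | ring1 | linear_combination (b / 2) * hφ
      · refine ⟨b, -b, hb, hb', Or.inr (Or.inr ?_)⟩
        rw [E3_mk_inj]
        refine ⟨?_, ?_, ?_⟩ <;>
          first | ring1 | linear_combination (b / 2) * hφ | linear_combination (-b / 2) * hφ
      · refine ⟨b, -b, hb, hb', Or.inl ?_⟩
        rw [E3_mk_inj]
        refine ⟨?_, ?_, ?_⟩ <;>
          first | ring1 | linear_combination (b / 2) * hφ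
    s_maps := hd _ _ _ _
    r_v := hr0
    s_v := by rw [toLin_diagRot]; simp
    s_w := by rw [toLin_diagRot]; simp
    trans := by
      have h0 : ∀ a b : ℝ, a ^ 2 = 1 → b ^ 2 = 1 → ∃ g : SO3,
          (∀ w ∈ Polyhedron.icosahedron.vertices, toLin g w ∈ Polyhedron.icosahedron.vertices) ∧
          toLin g !₂[0, 1, Real.goldenRatio] = !₂[0, a, b * Real.goldenRatio] := by
        intro a b ha hb
        refine ⟨diagRot (a := a * b) (b := a) (by rw [mul_pow, ha, hb, one_mul]) ha,
          hd _ _ _ _, ?_⟩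
        rw [toLin_diagRot, E3_mk_inj]
        refine ⟨?_, ?_, ?_⟩
        · ring
        · ring
        · linear_combination (b * Real.goldenRatio) * ha
      rintro v ⟨a, b, ha, hb, rfl | rfl | rfl⟩ <;> obtain ⟨g, hg, hgv⟩ := h0 a b ha hb
      · exact ⟨g, hg, hgv⟩
      · refine ⟨cyclicRot * (cyclicRot * g), fun w hw => ?_, ?_⟩
        · rw [toLin_mul, toLin_mul]
          exact hcy _ (hcy _ (hg _ hw))
        · rw [toLin_mul, toLin_mul, hgv, toLin_cyclicRot, toLin_cyclicRot]
      · refine ⟨cyclicRot * g, fun w hw => ?_, ?_⟩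
        · rw [toLin_mul]
          exact hcy _ (hg _ hw)
        · rw [toLin_mul, hgv, toLin_cyclicRot]
    le := by
      intro w hw hne
      obtain ⟨a, b, rfl | rfl, rfl | rfl, rfl | rfl | rfl⟩ := mem_icosahedron_iff.1 hw
      · exact absurd (by rw [one_mul]) hne
      all_goals rw [inner_E3_mk]; nlinarith
    link := by
      intro w hw hin
      obtain ⟨a, b, rfl | rfl, rfl | rfl, h⟩ := mem_icosahedron_iff.1 hw
      all_goals
        simp only [one_mul, neg_mul] at h
        rcases h with rfl | rfl | rfl
      any_goals
        exfalso
        rw [inner_E3_mk] at hin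
        nlinarith
      · exact ⟨2, by rw [pow_two, toLin_mul, hr1, hr2]⟩
      · exact ⟨1, by rw [pow_one, hr1]⟩
      · exact ⟨4, by simp only [pow_succ, pow_zero, one_mul, toLin_mul, hr1, hr2, hr3, hr4]⟩
      · exact ⟨0, by rw [pow_zero, toLin_one]⟩
      · exact ⟨3, by simp only [pow_succ, pow_zero, one_mul, toLin_mul, hr1, hr2, hr3]⟩
    inner_rw := by rw [hr1, inner_E3_mk]; linarith
    common := by
      intro w hw hin hin'
      obtain ⟨a, b, rfl | rfl, rfl | rfl, h⟩ := mem_icosahedron_iff.1 hw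
      all_goals
        simp only [one_mul, neg_mul] at h
        rcases h with rfl | rfl | rfl
      any_goals
        exfalso
        rw [inner_E3_mk] at hin hin'
        nlinarith
      · exact Or.inl hr1.symm
      · exact Or.inr hr5
    order := by
      have : Fact (Nat.Prime 5) := ⟨by norm_num⟩
      refine orderOf_eq_prime (eq_one_of_fixes _ !₂[0, 1, Real.goldenRatio]
        !₂[0, -1, Real.goldenRatio] ?_ ?_ ?_) fun h => ?_
      · simp only [pow_succ, pow_zero, one_mul, toLin_mul, hr0]
      · simp only [pow_succ, pow_zero, one_mul, toLin_mul, hr1, hr2, hr3, hr4, hr5]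
      · refine cross_ne_zero ?_
        rw [inner_E3_mk, inner_E3_mk, inner_E3_mk]
        nlinarith
      · rw [h, toLin_one, E3_mk_inj] at hr1
        linarith [hr1.1] }

theorem polyhedron_orbits (Q : Polyhedron) (ρ : SO3) :
    IsIsotropyOrbit (rotationGroup Q ρ) (vertexPoints Q ρ) Q.vertexOrder ∧
      IsIsotropyOrbit (rotationGroup Q ρ) (edgePoints Q ρ) 2 ∧
      IsIsotropyOrbit (rotationGroup Q ρ) (facePoints Q ρ) 3 ∧ Finite (rotationGroup Q ρ) := by
  cases Q with
  | tetrahedron => exact isRegularPolyhedron_tetrahedron.orbits ρ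
  | octahedron => exact isRegularPolyhedron_octahedron.orbits ρ
  | icosahedron => exact isRegularPolyhedron_icosahedron.orbits ρ

/-! ### Counting conjugacy classes by axes -/

/-- If every element outside a central subset `Z` has two axes, and its centralizer is the
stabilizer of each of them, the number of conjugacy classes is determined by the orders of the
stabilizers. -/
theorem card_conjClasses_of_axes {G S : Type*} [Group G] [Fintype G] [Fintype S]
    (F : G → S → Prop) [∀ A p, Decidable (F A p)] (Z : Finset G) (hZ : ∀ A ∈ Z, ∀ B, Commute A B)
    (hF : ∀ A ∈ Z, ∀ p, F A p)
    (h2 : ∀ A ∉ Z, (Finset.univ.filter fun p => F A p).card = 2)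
    (hC : ∀ A ∉ Z, ∀ p, F A p → ∀ B, Commute A B ↔ F B p) :
    2 * (Nat.card (ConjClasses G) * Nat.card G)
        + Z.card * ∑ p : S, (Finset.univ.filter fun B => F B p).card
      = 2 * (Z.card * Nat.card G) + ∑ p : S, (Finset.univ.filter fun B => F B p).card ^ 2 := by
  classical
  set st : S → ℕ := fun p => (Finset.univ.filter fun B => F B p).card with hst
  set cz : G → ℕ := fun A => (Finset.univ.filter fun B => Commute A B).card with hcz
  -- Both sides count commuting pairs.
  have hcomm : Nat.card (ConjClasses G) * Nat.card G = ∑ A : G, cz A := by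
    rw [← card_comm_eq_card_conjClasses_mul_card,
      Nat.card_congr (Equiv.subtypeProdEquivSigmaSubtype (fun A B : G => Commute A B)),
      Nat.card_sigma]
    refine Finset.sum_congr rfl fun A _ => ?_
    rw [Nat.card_eq_fintype_card, Fintype.card_subtype]
  have hsplit : ∑ A : G, cz A = Z.card * Nat.card G + ∑ A ∈ Zᶜ, cz A := by
    rw [← Finset.sum_add_sum_compl Z]
    congr 1
    rw [Finset.sum_const_nat (m := Nat.card G)]
    intro A hA
    rw [hcz, Nat.card_eq_fintype_card, ← Finset.card_univ]
    simp only
    congr 1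
    ext B
    simp [hZ A hA B]
  -- Outside Z both axes of A have the centralizer of A as stabilizer, so summing stabilizer orders
  -- over the axes counts the centralizer twice. Exchanging the sums over A and p then leaves
  -- squares of stabilizer orders.
  have h3 : ∀ A ∈ Zᶜ, 2 * cz A = ∑ p : S, if F A p then st p else 0 := by
    intro A hA
    rw [Finset.mem_compl] at hA
    rw [← Finset.sum_filter, Finset.sum_const_nat (m := cz A), h2 A hA]
    intro p hp
    rw [hst, hcz]
    simp only
    congr 1
    ext B
    simp [hC A hA p (Finset.mem_filter.1 hp).2 B]
  have h4 : ∀ p : S, (∑ A ∈ Zᶜ, if F A p then st p else 0) + Z.card * st p = st p ^ 2 := by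
    intro p
    have h5 : ∑ A : G, (if F A p then st p else 0) = st p ^ 2 := by
      rw [← Finset.sum_filter, Finset.sum_const, smul_eq_mul, pow_two]
    have h6 : ∑ A ∈ Z, (if F A p then st p else 0) = Z.card * st p :=
      Finset.sum_const_nat fun A hA => if_pos (hF A hA p)
    rw [← h5, ← Finset.sum_add_sum_compl Z, h6, add_comm]
  have h7 : 2 * ∑ A ∈ Zᶜ, cz A + Z.card * ∑ p : S, st p = ∑ p : S, st p ^ 2 := by
    rw [Finset.mul_sum, Finset.sum_congr rfl h3, Finset.sum_comm, Finset.mul_sum,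
      ← Finset.sum_add_distrib]
    exact Finset.sum_congr rfl fun p _ => h4 p
  rw [hcomm, hsplit]
  linarith

/-- The central element `-1` of `SU(2)`. -/
def negOne : SU2 := ⟨-1, by
  rw [Matrix.mem_specialUnitaryGroup_iff, Matrix.mem_unitaryGroup_iff]
  simp [Matrix.det_neg]⟩

theorem coe_negOne_smul (z : S3) : ((negOne • z : S3) : C2) = -(z : C2) := by
  rw [coe_smul_sphere, toLin_apply]
  ext i
  simp [negOne, Matrix.neg_mulVec]

theorem negOne_ne_one : negOne ≠ 1 := by
  intro h
  have := congrArg (fun A : SU2 => A.1 0 0) h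
  simp [negOne] at this
  norm_num [Complex.ext_iff] at this

theorem negOne_smul (z : S3) : negOne • z = phase Real.pi z := by
  apply Subtype.ext
  rw [coe_negOne_smul, coe_phase, Complex.exp_pi_mul_I, neg_one_smul]

theorem cover_negOne : cover negOne = 1 :=
  (cover_eq_one_iff _).2 fun z => ⟨_, negOne_smul z⟩

theorem eq_one_or_negOne_of_cover_eq_one {A : SU2} (h : cover A = 1) : A = 1 ∨ A = negOne := by
  have hm : coverMatrix (A.1 0 0) (A.1 1 0) = 1 := congrArg Subtype.val h
  have hn := SU2.normSq_add A
  have h00 := congrFun (congrFun hm 0) 0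
  have h11 := congrFun (congrFun hm 1) 1
  have h12 := congrFun (congrFun hm 1) 2
  simp [coverMatrix, Complex.normSq_apply, pow_two] at h00 h11 h12
  have hb1 : (A.1 1 0).re ^ 2 + (A.1 1 0).im ^ 2 = 0 := by nlinarith
  have hbr : (A.1 1 0).re = 0 := by nlinarith [sq_nonneg (A.1 1 0).re, sq_nonneg (A.1 1 0).im]
  have hbi : (A.1 1 0).im = 0 := by nlinarith [sq_nonneg (A.1 1 0).re, sq_nonneg (A.1 1 0).im]
  rw [hbr, hbi] at h11
  have hai : (A.1 0 0).im = 0 := by nlinarith [sq_nonneg (A.1 0 0).im]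
  have hb : A.1 1 0 = 0 := Complex.ext hbr hbi
  have hz : ∀ z : S3, ((A • z : S3) : C2) = ((A.1 0 0).re : ℂ) • (z : C2) := by
    intro z
    have ha : A.1 0 0 = ((A.1 0 0).re : ℂ) := Complex.ext rfl (by simp [hai])
    rw [coe_smul_sphere, toLin_SU2, hb, ha]
    ext i
    fin_cases i <;> simp
  have har : (A.1 0 0).re ^ 2 = 1 := by rw [hai, hbr, hbi] at hn; linarith
  rcases real_sq_eq_one_iff.1 har with h1 | h1
  · left
    refine eq_one_of_smul_S3 A baseS3 (Subtype.ext ?_)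
    rw [hz, h1, Complex.ofReal_one, one_smul]
  · right
    have := eq_one_of_smul_S3 (negOne⁻¹ * A) baseS3 (by
      rw [mul_smul, inv_smul_eq_iff]
      apply Subtype.ext
      rw [hz, h1, coe_negOne_smul, Complex.ofReal_neg, Complex.ofReal_one, neg_one_smul])
    exact (inv_mul_eq_one.1 this).symm

theorem negOne_mem_comap (K : Subgroup SO3) : negOne ∈ K.comap cover := by
  rw [Subgroup.mem_comap, cover_negOne]
  exact one_mem K

theorem card_comap_cover (K : Subgroup SO3) : Nat.card (K.comap cover) = 2 * Nat.card K := by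
  have hs := MonoidHom.subgroupComap_surjective_of_surjective cover K cover_surjective
  rw [← Subgroup.card_mul_index (cover.subgroupComap K).ker, Subgroup.index_ker,
    MonoidHom.range_eq_top.2 hs, Subgroup.card_top]
  congr 1
  rw [Nat.card_eq_two_iff]
  have hker : ∀ x : K.comap cover, x ∈ (cover.subgroupComap K).ker ↔ cover x.1 = 1 := fun x => by
    rw [MonoidHom.mem_ker, Subtype.ext_iff]
    rfl
  refine ⟨⟨1, one_mem _⟩, ⟨⟨negOne, negOne_mem_comap K⟩, (hker _).2 cover_negOne⟩, ?_, ?_⟩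
  · intro h
    exact negOne_ne_one (congrArg (fun x => x.1.1) h).symm
  · ext x
    simp only [Set.mem_insert_iff, Set.mem_singleton_iff, Set.mem_univ, iff_true]
    rcases eq_one_or_negOne_of_cover_eq_one ((hker _).1 x.2) with h | h
    · exact Or.inl (Subtype.ext (Subtype.ext h))
    · exact Or.inr (Subtype.ext (Subtype.ext h))

theorem finite_comap_cover (K : Subgroup SO3) [Finite K] : Finite (K.comap cover) := by
  refine Nat.finite_of_card_ne_zero ?_
  rw [card_comap_cover]
  have : 0 < Nat.card K := Nat.card_pos
  omega

/-- A unitary matrix has an eigenvector, and its eigenvalue has modulus one. -/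
theorem exists_smul_eq_phase (A : SU2) : ∃ z θ, A • z = phase θ z := by
  obtain ⟨μ, hμ⟩ := Module.End.exists_eigenvalue ((toLin A : C2 →L[ℂ] C2) : Module.End ℂ C2)
  obtain ⟨v, hv⟩ := hμ.exists_hasEigenvector
  have hv0 : v ≠ 0 := hv.2
  have hAv : toLin A v = μ • v := hv.apply_eq_smul
  have hn := norm_toLin A v
  rw [hAv, norm_smul] at hn
  have hμ1 : ‖μ‖ = 1 := by
    have : ‖v‖ ≠ 0 := norm_ne_zero_iff.2 hv0
    exact mul_right_cancel₀ this (by rw [hn, one_mul])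
  refine ⟨⟨((‖v‖⁻¹ : ℝ) : ℂ) • v, by simp [norm_smul, hv0]⟩, μ.arg, Subtype.ext ?_⟩
  rw [coe_smul_sphere, coe_phase, map_smul, hAv, smul_comm]
  congr 1
  have := Complex.norm_mul_exp_arg_mul_I μ
  rw [hμ1, Complex.ofReal_one, one_mul] at this
  exact this.symm

/-- If B commutes with A, then Bz is an eigenvector with the same eigenvalue as z. Were it not on
the line of z, A would be scalar and cover the identity. Conversely AB and BA agree at z when B acts
there by a phase, and SU(2) acts freely on S³. -/
theorem commute_iff_of_smul_eq_phase {A : SU2} (hA : cover A ≠ 1) {z : S3} {θ : ℝ}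
    (h : A • z = phase θ z) (B : SU2) : Commute A B ↔ ∃ φ, B • z = phase φ z := by
  constructor
  · intro hc
    by_contra hB
    apply hA
    rw [cover_eq_one_iff]
    set w := B • z with hw
    have hAw : A • w = phase θ w := by
      rw [hw, ← mul_smul, hc.eq, mul_smul, h, phase_smul]
    have hz' : toLin A (z : C2) = Complex.exp (θ * Complex.I) • (z : C2) := by
      rw [← coe_smul_sphere, h, coe_phase]
    have hw' : toLin A (w : C2) = Complex.exp (θ * Complex.I) • (w : C2) := by
      rw [← coe_smul_sphere, hAw, coe_phase]
    have hdec := frame_decomposition z (w : C2)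
    have hb : inner ℂ (frame z 0) (w : C2) ≠ 0 := by
      intro h0
      rw [h0, zero_smul, add_zero] at hdec
      apply hB
      set a := inner ℂ (z : C2) (w : C2) with ha
      have hn := congrArg norm hdec
      rw [norm_smul, norm_S3, norm_S3, mul_one] at hn
      refine ⟨a.arg, Subtype.ext ?_⟩
      rw [coe_phase, hdec]
      have := Complex.norm_mul_exp_arg_mul_I a
      rw [← hn, Complex.ofReal_one, one_mul] at this
      rw [this]
    have hf : toLin A (frame z 0) = Complex.exp (θ * Complex.I) • frame z 0 := by
      rw [hdec, map_add, map_smul, map_smul, hz', smul_add, smul_comm, add_right_inj,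
        smul_comm (Complex.exp _)] at hw'
      exact smul_right_injective C2 hb hw'
    intro y
    refine ⟨θ, Subtype.ext ?_⟩
    rw [coe_smul_sphere, coe_phase, frame_decomposition z (y : C2), map_add, map_smul, map_smul,
      hz', hf, smul_add, smul_comm, smul_comm (inner ℂ (frame z 0) (y : C2))]
  · rintro ⟨φ, hφ⟩
    have h1 : (B * A)⁻¹ * (A * B) = 1 := by
      refine eq_one_of_smul_S3 _ z ?_
      rw [mul_smul, inv_smul_eq_iff, mul_smul, mul_smul, hφ, h, phase_smul, phase_smul, h, hφ,
        ← phase_add, ← phase_add, add_comm]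
    exact (inv_mul_eq_one.1 h1).symm

theorem commute_iff_cover_smul {A : SU2} (hA : cover A ≠ 1) {p : S2} (h : cover A • p = p)
    (B : SU2) : Commute A B ↔ cover B • p = p := by
  obtain ⟨z, rfl⟩ := hopf_surjective p
  obtain ⟨θ, hθ⟩ := (cover_smul_hopf_eq_iff A z).1 h
  rw [commute_iff_of_smul_eq_phase hA hθ, cover_smul_hopf_eq_iff]

theorem exists_cover_smul_eq (A : SU2) : ∃ p : S2, cover A • p = p := by
  obtain ⟨z, θ, h⟩ := exists_smul_eq_phase A
  exact ⟨hopf z, (cover_smul_hopf_eq_iff A z).2 ⟨θ, h⟩⟩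

theorem smul_neg_sphere (R : SO3) (p : S2) : R • (-p) = -(R • p) := by
  apply Subtype.ext
  rw [coe_smul_sphere, coe_neg_sphere, map_neg, coe_neg_sphere, coe_smul_sphere]

theorem eq_or_eq_neg_of_fixes {R : SO3} (hR : R ≠ 1) {p q : S2} (hp : R • p = p)
    (hq : R • q = q) : q = p ∨ q = -p := by
  have hc : cross (p : E3) (q : E3) = 0 := by
    by_contra h
    exact hR (eq_one_of_fixes R p q (by rw [← coe_smul_sphere, hp])
      (by rw [← coe_smul_sphere, hq]) h)
  have h1 := inner_cross_self (p : E3) (q : E3)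
  rw [hc, inner_zero_left, real_inner_self_eq_norm_sq, real_inner_self_eq_norm_sq, norm_S2,
    norm_S2] at h1
  have h2 : inner ℝ (p : E3) (q : E3) ^ 2 = 1 := by linarith
  rcases real_sq_eq_one_iff.1 h2 with h3 | h3
  · left
    exact Subtype.ext ((inner_eq_one_iff_of_norm_eq_one (norm_S2 p) (norm_S2 q)).1 h3).symm
  · right
    apply Subtype.ext
    rw [coe_neg_sphere]
    have h4 : inner ℝ (p : E3) (-(q : E3)) = 1 := by rw [inner_neg_right, h3, neg_neg]
    have := (inner_eq_one_iff_of_norm_eq_one (norm_S2 p) (by rw [norm_neg, norm_S2])).1 h4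
    rw [this, neg_neg]

theorem neg_ne_self_sphere (p : S2) : p ≠ -p := by
  intro h
  have h1 := congrArg (fun x : S2 => (x : E3)) h
  simp only [coe_neg_sphere] at h1
  have h3 : (2 : ℝ) • (p : E3) = 0 := by rw [two_smul]; exact eq_neg_iff_add_eq_zero.1 h1
  have h2 : (p : E3) = 0 := (smul_eq_zero.1 h3).resolve_left two_ne_zero
  have := norm_S2 p
  rw [h2, norm_zero] at this
  norm_num at this

/-- Let g = |G| and let m be the number of classes. An element other than ±1 covers a rotation with
exactly two fixed points ±p. An orbit with isotropy order n has g/(2n) points, each with stabilizer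
of order 2n in G, so it contributes g to the sum of stabilizer orders and 2ng to the sum of their
squares. `card_conjClasses_of_axes` becomes 2mg + 6g = 4g + 2g(n₁ + n₂ + n₃). -/
theorem card_conjClasses_comap_cover {K : Subgroup SO3} [Finite K] {V E F : Set S2} {n₁ n₂ n₃ : ℕ}
    (hV : IsIsotropyOrbit K V n₁) (hE : IsIsotropyOrbit K E n₂) (hF : IsIsotropyOrbit K F n₃)
    (hVE : Disjoint V E) (hVF : Disjoint V F) (hEF : Disjoint E F)
    (hfix : ∀ R ∈ K, R ≠ 1 → ∀ p : S2, R • p = p → p ∈ V ∪ E ∪ F) :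
    Nat.card (ConjClasses (K.comap cover)) + 1 = n₁ + n₂ + n₃ := by
  classical
  have := finite_comap_cover K
  have : Fintype (K.comap cover) := Fintype.ofFinite _
  have hfin : ∀ {X n}, IsIsotropyOrbit K X n → X.Finite := by
    rintro X n ⟨p₀, h₀, -⟩
    refine (Set.finite_range fun g : K => g.1 • p₀).subset fun p hp => ?_
    obtain ⟨g, hg, rfl⟩ := (h₀ p).1 hp
    exact ⟨⟨g, hg⟩, rfl⟩
  obtain ⟨V, rfl⟩ := (hfin hV).exists_finset_coe
  obtain ⟨E, rfl⟩ := (hfin hE).exists_finset_coe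
  obtain ⟨F, rfl⟩ := (hfin hF).exists_finset_coe
  rw [Finset.disjoint_coe] at hVE hVF hEF
  set S : Finset S2 := V ∪ E ∪ F with hS
  let one : K.comap cover := 1
  let neg : K.comap cover := ⟨negOne, negOne_mem_comap K⟩
  let Z : Finset (K.comap cover) := {one, neg}
  have hne : one ≠ neg := fun h => negOne_ne_one (congrArg Subtype.val h).symm
  have hZ : ∀ A : K.comap cover, A ∈ Z ↔ cover A.1 = 1 := by
    intro A
    simp only [Z, Finset.mem_insert, Finset.mem_singleton]
    constructor
    · rintro (rfl | rfl)
      · exact map_one cover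
      · exact cover_negOne
    · intro h
      exact (eq_one_or_negOne_of_cover_eq_one h).imp (fun h => Subtype.ext h) fun h => Subtype.ext h
  have hcard : Z.card = 2 := Finset.card_pair hne
  have key := card_conjClasses_of_axes (G := K.comap cover) (S := S)
    (fun A p => cover A.1 • p.1 = p.1) Z ?_ ?_ ?_ ?_
  · have hst : ∀ {X : Finset S2} {n : ℕ}, IsIsotropyOrbit K (X : Set S2) n → ∀ p ∈ X,
        (Finset.univ.filter fun B : K.comap cover => cover B.1 • p = p).card = 2 * n := by
      intro X n hX p hp
      rw [← hX.card_eq hp, ← card_comap_cover, ← Fintype.card_subtype, ← Nat.card_eq_fintype_card]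
      exact Nat.card_congr ⟨fun B => ⟨B.1.1, B.1.2, B.2⟩, fun B => ⟨⟨B.1, B.2.1⟩, B.2.2⟩,
        fun _ => rfl, fun _ => rfl⟩
    have hG : ∀ {X : Finset S2} {n : ℕ}, IsIsotropyOrbit K (X : Set S2) n →
        X.card * (2 * n) = Nat.card (K.comap cover) := by
      intro X n hX
      rw [card_comap_cover, ← hX.card_mul]
      simp only [Finset.coe_sort_coe, Nat.card_eq_fintype_card, Fintype.card_coe]
      ring
    have hsum : ∀ φ : ℕ → ℕ, ∑ p : S, φ (Finset.univ.filter fun B : K.comap cover =>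
        cover B.1 • p.1 = p.1).card
          = V.card * φ (2 * n₁) + E.card * φ (2 * n₂) + F.card * φ (2 * n₃) := by
      intro φ
      rw [Finset.sum_coe_sort S (fun p => φ (Finset.univ.filter fun B : K.comap cover =>
        cover B.1 • p = p).card), hS, Finset.sum_union (Finset.disjoint_union_left.2 ⟨hVF, hEF⟩),
        Finset.sum_union hVE]
      congr 1
      · congr 1
        · exact Finset.sum_const_nat fun p hp => by rw [hst hV p hp]
        · exact Finset.sum_const_nat fun p hp => by rw [hst hE p hp]
      · exact Finset.sum_const_nat fun p hp => by rw [hst hF p hp]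
    beta_reduce at key
    rw [hcard, hsum (fun x => x), hsum (fun x => x ^ 2)] at key
    simp only [pow_two, ← mul_assoc] at key
    have e1 := hG hV
    have e2 := hG hE
    have e3 := hG hF
    have hpos : 0 < Nat.card (K.comap cover) := Nat.card_pos
    set g := Nat.card (K.comap cover)
    set m := Nat.card (ConjClasses (K.comap cover))
    have h1 : 2 * g * (m + 1) = 2 * g * (n₁ + n₂ + n₃) := by
      zify at key e1 e2 e3 ⊢
      linear_combination key + (2 * (n₁ : ℤ) - 2) * e1 + (2 * (n₂ : ℤ) - 2) * e2
        + (2 * (n₃ : ℤ) - 2) * e3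
    exact Nat.eq_of_mul_eq_mul_left (by positivity) h1
  · intro A hA B
    simp only [Z, Finset.mem_insert, Finset.mem_singleton] at hA
    rcases hA with rfl | rfl
    · exact Commute.one_left B
    · apply Subtype.ext
      apply Subtype.ext
      change negOne.1 * B.1.1 = B.1.1 * negOne.1
      simp [negOne]
  · intro A hA p
    rw [(hZ A).1 hA, one_smul]
  · intro A hA
    rw [hZ] at hA
    obtain ⟨p, hp⟩ := exists_cover_smul_eq A.1
    have hp' : cover A.1 • (-p) = -p := by rw [smul_neg_sphere, hp]
    have hmem : ∀ q : S2, cover A.1 • q = q → q ∈ S := by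
      intro q hq
      have := hfix _ A.2 hA q hq
      simpa [hS, or_assoc] using this
    rw [Finset.card_eq_two]
    refine ⟨⟨p, hmem p hp⟩, ⟨-p, hmem _ hp'⟩, fun h => neg_ne_self_sphere p
      (congrArg Subtype.val h), ?_⟩
    ext q
    simp only [Finset.mem_filter, Finset.mem_univ, true_and, Finset.mem_insert,
      Finset.mem_singleton]
    constructor
    · intro hq
      exact (eq_or_eq_neg_of_fixes hA hp hq).imp (fun h => Subtype.ext h) fun h => Subtype.ext h
    · rintro (rfl | rfl)
      · exact hp
      · exact hp'
  · intro A hA p hp B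
    rw [hZ] at hA
    rw [← commute_iff_cover_smul hA hp B.1]
    exact ⟨fun h => congrArg Subtype.val h, fun h => Subtype.ext h⟩

/-! ### Isotropy along Hopf fibres -/

theorem inner_phase (θ : ℝ) (z : S3) :
    inner ℂ (z : C2) (phase θ z : C2) = Complex.exp (θ * Complex.I) := by
  rw [coe_phase, inner_smul_right, inner_self_S3, mul_one]

theorem phase_eq_phase_iff (θ φ : ℝ) (z : S3) : phase θ z = phase φ z ↔
    Complex.exp (θ * Complex.I) = Complex.exp (φ * Complex.I) := by
  constructor
  · intro h
    rw [← inner_phase θ z, ← inner_phase φ z, h]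
  · intro h
    apply Subtype.ext
    rw [coe_phase, coe_phase, h]

theorem pow_smul_eq_phase {A : SU2} {z : S3} {θ : ℝ} (h : A • z = phase θ z) (k : ℕ) :
    A ^ k • z = phase (k * θ) z := by
  induction k with
  | zero => simp [phase_zero]
  | succ k ih =>
    rw [pow_succ', mul_smul, ih, phase_smul, h, ← phase_add]
    push_cast
    ring_nf

/-- The elements preserving the Hopf fibre form the preimage of the isotropy group, of order 2n
since ±1 act trivially on S². They act freely by phases, so A ↦ ⟨z, Az⟩ is an injection into the
2n-th roots of unity, onto by cardinality. -/
theorem exists_smul_eq_phase_iff {K : Subgroup SO3} [Finite K] {z : S3} {n : ℕ} (hn : 0 < n)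
    (hz : Nat.card (K ⊓ MulAction.stabilizer SO3 (hopf z) : Subgroup SO3) = n) (θ : ℝ) :
    (∃ A ∈ K.comap cover, A • z = phase θ z) ↔ ∃ k : ℤ, θ = k * (Real.pi / n) := by
  classical
  set H : Subgroup SU2 := (K ⊓ MulAction.stabilizer SO3 (hopf z)).comap cover with hH
  have hcard : Nat.card H = 2 * n := by rw [hH, card_comap_cover, hz]
  have hfin : Finite H := Nat.finite_of_card_ne_zero (by omega)
  have : Fintype H := Fintype.ofFinite _
  have hmem : ∀ A : SU2, A ∈ H ↔ A ∈ K.comap cover ∧ ∃ θ, A • z = phase θ z := by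
    intro A
    rw [← cover_smul_hopf_eq_iff]
    rfl
  have hroot : ∀ A ∈ H, ∀ θ, A • z = phase θ z → Complex.exp (θ * Complex.I) ^ (2 * n) = 1 := by
    intro A hA θ h
    have h1 := pow_smul_eq_phase h (2 * n)
    have h2 : A ^ (2 * n) = 1 := by
      have := pow_card_eq_one' (x := (⟨A, hA⟩ : H))
      rw [hcard] at this
      exact congrArg Subtype.val this
    rw [h2, one_smul, eq_comm, phase_eq_self_iff] at h1
    rw [← Complex.exp_nat_mul, ← h1]
    push_cast
    ring_nf
  have hpi := Real.pi_pos
  have hn' : (n : ℝ) ≠ 0 := by positivity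
  constructor
  · rintro ⟨A, hA, h⟩
    have h1 := hroot A ((hmem A).2 ⟨hA, θ, h⟩) θ h
    rw [← Complex.exp_nat_mul, Complex.exp_eq_one_iff] at h1
    obtain ⟨k, hk⟩ := h1
    refine ⟨k, ?_⟩
    have h2 : ((2 * n * θ : ℝ) : ℂ) * Complex.I = ((k * (2 * Real.pi) : ℝ) : ℂ) * Complex.I := by
      push_cast at hk ⊢
      linear_combination hk
    have h3 : 2 * n * θ = k * (2 * Real.pi) := by
      exact_mod_cast mul_right_cancel₀ Complex.I_ne_zero h2
    field_simp
    linarith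
  · rintro ⟨k, rfl⟩
    let χ : H → ℂ := fun A => inner ℂ (z : C2) ((A.1 • z : S3) : C2)
    have hχ : ∀ A : H, ∃ θ, A.1 • z = phase θ z ∧ χ A = Complex.exp (θ * Complex.I) := by
      intro A
      obtain ⟨θ, hθ⟩ := ((hmem A.1).1 A.2).2
      exact ⟨θ, hθ, by simp only [χ]; rw [hθ, inner_phase]⟩
    have hinj : Function.Injective χ := by
      intro A B hAB
      obtain ⟨θ, hθ, h1⟩ := hχ A
      obtain ⟨φ, hφ, h2⟩ := hχ B
      have h3 : A.1 • z = B.1 • z := by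
        rw [hθ, hφ, phase_eq_phase_iff, ← h1, ← h2, hAB]
      have := eq_one_of_smul_S3 (B.1⁻¹ * A.1) z (by rw [mul_smul, h3, inv_smul_smul])
      exact Subtype.ext (inv_mul_eq_one.1 this).symm
    have himg : Finset.univ.image χ = Polynomial.nthRootsFinset (2 * n) (1 : ℂ) := by
      refine Finset.eq_of_subset_of_card_le ?_ ?_
      · intro ζ hζ
        obtain ⟨A, -, rfl⟩ := Finset.mem_image.1 hζ
        obtain ⟨θ, hθ, h1⟩ := hχ A
        rw [Polynomial.mem_nthRootsFinset (by omega), h1]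
        exact hroot A.1 A.2 θ hθ
      · rw [Finset.card_image_of_injective _ hinj, Finset.card_univ, ← Nat.card_eq_fintype_card,
          hcard, Polynomial.nthRootsFinset]
        exact (Multiset.toFinset_card_le _).trans (Polynomial.card_nthRoots _ _)
    have hζ : Complex.exp ((k * (Real.pi / n) : ℝ) * Complex.I) ∈ Finset.univ.image χ := by
      rw [himg, Polynomial.mem_nthRootsFinset (by omega), ← Complex.exp_nat_mul,
        Complex.exp_eq_one_iff]
      refine ⟨k, ?_⟩
      have : (n : ℂ) ≠ 0 := by exact_mod_cast hn.ne'
      push_cast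
      field_simp
    obtain ⟨A, -, hA⟩ := Finset.mem_image.1 hζ
    obtain ⟨θ, hθ, h1⟩ := hχ A
    refine ⟨A.1, ((hmem A.1).1 A.2).1, ?_⟩
    rw [hθ, phase_eq_phase_iff, ← h1, hA]

/-! ### Reeb orbits over critical points -/

theorem proj_eq_iff {G : Subgroup SU2} {z w : S3} : proj G z = proj G w ↔ ∃ A ∈ G, A • w = z := by
  rw [proj, proj, Quotient.eq'', MulAction.orbitRel_apply, MulAction.mem_orbit_iff]
  constructor
  · rintro ⟨A, hA⟩
    exact ⟨A.1, A.2, hA⟩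
  · rintro ⟨A, hA, h⟩
    exact ⟨⟨A, hA⟩, h⟩

theorem baseProj_eq_iff {G : Subgroup SU2} {p q : S2} :
    baseProj G p = baseProj G q ↔ ∃ R ∈ G.map cover, R • q = p := by
  rw [baseProj, baseProj, Quotient.eq'', MulAction.orbitRel_apply, MulAction.mem_orbit_iff]
  constructor
  · rintro ⟨A, hA⟩
    exact ⟨A.1, A.2, hA⟩
  · rintro ⟨A, hA, h⟩
    exact ⟨⟨A, hA⟩, h⟩

theorem proj_surjective (G : Subgroup SU2) : Function.Surjective (proj G) :=
  Quotient.mk''_surjective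

theorem seifert_proj (G : Subgroup SU2) (z : S3) : seifert G (proj G z) = baseProj G (hopf z) := rfl

theorem map_comap_cover (K : Subgroup SO3) : (K.comap cover).map cover = K :=
  Subgroup.map_comap_eq_self_of_surjective cover_surjective K

section

variable {G : Subgroup SU2} {f : S2 → ℝ} {ε : ℝ}

namespace ReebOrbit

/-- The lifts to `S³` of the points of `γ` lie over the subset `X` of `S²`. -/
def LiesOver (γ : ReebOrbit G f ε) (X : Set S2) : Prop :=
  ∀ l, γ.IsParam l → ∀ z, proj G z = l.toFun 0 → hopf z ∈ X

theorem exists_param (γ : ReebOrbit G f ε) : ∃ l, γ.IsParam l := Quotient.exists_rep γ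

theorem exists_param_lift (γ : ReebOrbit G f ε) : ∃ l z, γ.IsParam l ∧ proj G z = l.toFun 0 := by
  obtain ⟨l, hl⟩ := γ.exists_param
  obtain ⟨z, hz⟩ := proj_surjective G (l.toFun 0)
  exact ⟨l, z, hl, hz⟩

theorem IsParam.period_eq {γ : ReebOrbit G f ε} {l : ReebLoop G f ε} (h : γ.IsParam l) :
    γ.action = l.period := by
  rw [← h]
  rfl

theorem action_iterate (γ : ReebOrbit G f ε) (k : ℕ+) : (γ.iterate k).action = k * γ.action := by
  obtain ⟨l, rfl⟩ := γ.exists_param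
  rfl

theorem action_pos (γ : ReebOrbit G f ε) : 0 < γ.action := by
  obtain ⟨l, hl⟩ := γ.exists_param
  rw [hl.period_eq]
  exact l.period_pos

theorem iterate_one (γ : ReebOrbit G f ε) : γ.iterate 1 = γ := by
  obtain ⟨l, rfl⟩ := γ.exists_param
  exact Quotient.sound ⟨by simp [ReebLoop.iterate], 0, fun t => by rw [add_zero]; rfl⟩

/-- `LiesOver` looks only at time 0 but quantifies over all parametrizations, so a parametrization
of the iterate is matched by a translate of one of `γ`. -/
theorem LiesOver.iff_of_iterate {γ : ReebOrbit G f ε} {X : Set S2} (k : ℕ+) :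
    (γ.iterate k).LiesOver X ↔ γ.LiesOver X := by
  constructor
  · rintro h l rfl z hz
    exact h (l.iterate k) rfl z hz
  · intro h l hl z hz
    obtain ⟨l₀, rfl⟩ := γ.exists_param
    obtain ⟨-, s, hs⟩ := Quotient.exact hl
    have hper : ∀ t, l₀.toFun t = l.toFun (t + s) := hs
    refine h ⟨l₀.period, l₀.period_pos, fun t => l₀.toFun (t - s), fun t => ?_, ?_⟩ ?_ z ?_
    · simp only
      rw [add_sub_right_comm, l₀.periodic]
    · obtain ⟨c', hc', hlc'⟩ := l.exists_lift
      exact ⟨c', hc', fun t => by rw [hper, sub_add_cancel, hlc']⟩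
    · exact Quotient.sound ⟨rfl, s, fun t => by
        change l₀.toFun t = l₀.toFun (t + s - s)
        rw [add_sub_cancel_right]⟩
    · simp only
      rw [hz, hper, sub_add_cancel]

theorem LiesOver.not_disjoint {γ : ReebOrbit G f ε} {X Y : Set S2} (hX : γ.LiesOver X)
    (hY : γ.LiesOver Y) : ¬ Disjoint X Y := by
  obtain ⟨l, z, hl, hz⟩ := γ.exists_param_lift
  exact Set.not_disjoint_iff.2 ⟨_, hX l hl z hz, hY l hl z hz⟩

theorem HasCZIndex.unique {γ : ReebOrbit G f ε} {μ ν : ℤ} (h : γ.HasCZIndex μ)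
    (h' : γ.HasCZIndex ν) : μ = ν := by
  obtain ⟨l, z, hl, hz⟩ := γ.exists_param_lift
  rw [← h l hl z hz, h' l hl z hz]

end ReebOrbit

/-- The orbit `β` is the simple Reeb orbit over the `K`-orbit `X` of critical points, of action
`T₀`, and the orbits over `X` are its iterates. -/
structure IsSimpleOrbitOver (β : ReebOrbit G f ε) (X : Set S2) (T₀ : ℝ) : Prop where
  action_eq : β.action = T₀
  embedded : β.IsEmbedded
  projectsTo : ∀ p ∈ X, β.ProjectsTo (baseProj G p)
  liesOver : β.LiesOver X
  exists_iterate : ∀ (l : ReebLoop G f ε) (c : ℝ → S3), IsReebTrajectory f ε c →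
    (∀ t, l.toFun t = proj G (c t)) → hopf (c 0) ∈ X →
    ∃ k : ℕ+, (Quotient.mk _ l : ReebOrbit G f ε) = β.iterate k

/-- Closing up in the quotient gives A at time 0; the shifted curve and A•c are both trajectories,
so they agree at all times. -/
theorem ReebLoop.exists_holonomy (h : Admissible f ε) (hG : ∀ A ∈ G, ∀ p, f (cover A • p) = f p)
    (l : ReebLoop G f ε) {c : ℝ → S3} (hc : IsReebTrajectory f ε c)
    (hl : ∀ t, l.toFun t = proj G (c t)) : ∃ A ∈ G, ∀ t, c (t + l.period) = A • c t := by
  have h0 := l.periodic 0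
  rw [hl, hl, proj_eq_iff] at h0
  obtain ⟨A, hA, hAc⟩ := h0
  refine ⟨A, hA, fun t => ?_⟩
  exact congrFun ((hc.comp_add h l.period).unique h (hc.smul h (hG A hA)) (t₀ := 0) hAc.symm) t

/-- The holonomy has order dividing |G|, so the lift closes up after |G| periods and the
short-period argument applies to that multiple. -/
theorem ReebLoop.hopf_mem_criticalPoints (h : Admissible f ε) (hε : 0 < ε) [Finite G]
    (hG : ∀ A ∈ G, ∀ p, f (cover A • p) = f p) {K : NNReal} (hK : LipschitzWith K (baseField f))
    (l : ReebLoop G f ε) (hsmall : 8 * ε * K * (Nat.card G * l.period) < 1)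
    {c : ℝ → S3} (hc : IsReebTrajectory f ε c) (hl : ∀ t, l.toFun t = proj G (c t)) :
    hopf (c 0) ∈ criticalPoints f := by
  obtain ⟨A, hA, hper⟩ := l.exists_holonomy h hG hc hl
  have hpow : ∀ (k : ℕ) t, c (t + k * l.period) = A ^ k • c t := by
    intro k
    induction k with
    | zero => intro t; simp
    | succ k ih =>
      intro t
      rw [pow_succ', mul_smul, ← ih, ← hper]
      push_cast
      ring_nf
  have hA1 : A ^ Nat.card G = 1 := congrArg Subtype.val (pow_card_eq_one' (x := (⟨A, hA⟩ : G)))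
  refine hopf_mem_criticalPoints_of_periodic h hε hK hc (T := Nat.card G * l.period)
    (mul_pos (by exact_mod_cast Nat.card_pos) l.period_pos) (fun t => ?_) hsmall
  simp only
  rw [hpow, hA1, one_smul]

/-- Over X trajectories are Hopf rotations at speed 1/g with g = 1 + εv, and a phase is realised by
the group exactly when it is a multiple of π/n. The projected fibre therefore first closes after
time πg/n, and a closed orbit over X is, up to the group, a translate of it with an integer multiple
of that period. -/
theorem exists_isSimpleOrbitOver (h : Admissible f ε) {K : Subgroup SO3} [Finite K]
    {X : Set S2} {n : ℕ} (hn : 0 < n)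
    (hX : IsIsotropyOrbit K X n) (hcrit : X ⊆ criticalPoints f) {v : ℝ} (hv : ∀ p ∈ X, f p = v) :
    ∃ β : ReebOrbit (K.comap cover) f ε, IsSimpleOrbitOver β X (Real.pi * (1 + ε * v) / n) := by
  obtain ⟨p, hp⟩ := hX.nonempty
  obtain ⟨z, rfl⟩ := hopf_surjective p
  set g := 1 + ε * v with hg
  have hconf : ∀ w : S3, hopf w ∈ X → conf f ε w = g := fun w hw => by
    rw [conf_coe, hv _ hw]
  have hg0 : 0 < g := by
    rw [← hconf z hp]
    have := h.half_le_conf z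
    linarith
  have hn0 : (0 : ℝ) < n := by exact_mod_cast hn
  have hpi := Real.pi_pos
  have hiso := exists_smul_eq_phase_iff hn (hX.card_eq hp)
  have htraj : ∀ w : S3, hopf w ∈ X → IsReebTrajectory f ε fun t => phase (t / g) w := by
    intro w hw
    have := isReebTrajectory_phase h (hcrit hw)
    rwa [hconf w hw] at this
  set T₀ := Real.pi * g / n with hT₀
  have hT₀g : ∀ k : ℝ, k * T₀ / g = k * (Real.pi / n) := fun k => by
    rw [hT₀]
    field_simp
  let l₀ : ReebLoop (K.comap cover) f ε :=
    { period := T₀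
      period_pos := by positivity
      toFun := fun t => proj _ (phase (t / g) z)
      periodic := fun t => by
        obtain ⟨A, hA, hAz⟩ := (hiso (Real.pi / n)).2 ⟨1, by push_cast; ring⟩
        rw [proj_eq_iff]
        refine ⟨A, hA, ?_⟩
        rw [phase_smul, hAz, ← phase_add, add_div, ← one_mul T₀, hT₀g, one_mul]
      exists_lift := ⟨_, htraj z hp, fun t => rfl⟩ }
  have hparam : ∀ l, ReebOrbit.IsParam (Quotient.mk _ l₀ : ReebOrbit (K.comap cover) f ε) l →
      l.period = T₀ ∧ ∃ s, ∀ t, l.toFun t = proj (K.comap cover) (phase ((t + s) / g) z) := by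
    intro l hl
    obtain ⟨h1, s, hs⟩ := Quotient.exact hl.symm
    exact ⟨h1.symm, s, hs⟩
  have hsmulX : ∀ A ∈ K.comap cover, ∀ w, hopf w ∈ X → hopf (A • w) ∈ X := by
    intro A hA w hw
    rw [hopf_smul]
    exact hX.smul_mem hw hA
  refine ⟨Quotient.mk _ l₀, rfl, ?_, ?_, ?_, ?_⟩
  · intro l hl a b hab
    obtain ⟨h1, s, hs⟩ := hparam l hl
    rw [hs, hs, proj_eq_iff] at hab
    obtain ⟨A, hA, h2⟩ := hab
    have h3 : A • z = phase ((a - b) / g) z := by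
      rw [phase_smul] at h2
      have h4 := congrArg (phase (-((b + s) / g))) h2
      rw [← phase_add, ← phase_add, neg_add_cancel, phase_zero] at h4
      rw [h4]
      congr 1
      ring
    obtain ⟨k, hk⟩ := (hiso _).1 ⟨A, hA, h3⟩
    refine ⟨k, ?_⟩
    rw [h1]
    rw [← hT₀g, div_left_inj' hg0.ne'] at hk
    exact hk
  · intro q hq l hl t
    obtain ⟨-, s, hs⟩ := hparam l hl
    rw [hs, seifert_proj, hopf_phase, baseProj_eq_iff, map_comap_cover]
    obtain ⟨R, hR, h1⟩ := hX.exists_smul_eq hq hp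
    exact ⟨R, hR, h1.symm⟩
  · intro l hl w hw
    obtain ⟨-, s, hs⟩ := hparam l hl
    rw [hs, proj_eq_iff] at hw
    obtain ⟨A, hA, rfl⟩ := hw
    exact hsmulX A hA _ (by rwa [hopf_phase])
  · intro l c hc hlc hc0
    obtain ⟨R, hR, h1⟩ := hX.exists_smul_eq hp hc0
    obtain ⟨A, rfl⟩ := cover_surjective R
    have hAG : A ∈ K.comap cover := hR
    rw [← hopf_smul, hopf_eq_iff] at h1
    obtain ⟨θ, hθ⟩ := h1
    have hct : ∀ t, c t = A • phase ((t + θ * g) / g) z := by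
      have h2 := hc.unique h (htraj (c 0) hc0) (t₀ := 0) (by rw [zero_div, phase_zero])
      intro t
      rw [congrFun h2 t, hθ, ← phase_add, ← phase_smul]
      congr 2
      field_simp
    have hlt : ∀ t, l.toFun t = proj (K.comap cover) (phase ((t + θ * g) / g) z) := fun t => by
      rw [hlc, hct, proj_eq_iff]
      exact ⟨A, hAG, rfl⟩
    have hper := l.periodic 0
    rw [hlt, hlt, proj_eq_iff] at hper
    obtain ⟨B, hB, h3⟩ := hper
    have h4 : B • z = phase (l.period / g) z := by
      rw [phase_smul] at h3
      have h5 := congrArg (phase (-((0 + θ * g) / g))) h3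
      rw [← phase_add, ← phase_add, neg_add_cancel, phase_zero] at h5
      rw [h5]
      congr 1
      ring
    obtain ⟨k, hk⟩ := (hiso _).1 ⟨B, hB, h4⟩
    rw [← hT₀g, div_left_inj' hg0.ne'] at hk
    have hkpos : 0 < k := by
      have h6 := l.period_pos
      rw [hk] at h6
      have h7 : (0 : ℝ) < k := (mul_pos_iff_of_pos_right (by positivity)).1 h6
      exact_mod_cast h7
    obtain ⟨j, rfl⟩ := Int.eq_ofNat_of_zero_le hkpos.le
    refine ⟨⟨j, by exact_mod_cast hkpos⟩, ?_⟩
    refine Eq.symm (Quotient.sound ⟨?_, θ * g, hlt⟩)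
    rw [hk]
    rfl

end

/-! ### Indices of the orbits over critical points -/

/-- Unless k/n is an integer it exceeds the integer below it by at least 1/n, so subtracting δ <
1/(2n) lowers the floor only at integers. -/
theorem floor_div_sub {n k : ℕ} (hn : 0 < n) {δ : ℝ} (h0 : 0 < δ) (h1 : 2 * n * δ < 1) :
    ⌊(k : ℝ) / n - δ⌋ = ⌈(k : ℝ) / n⌉ - 1 := by
  have hn' : (0 : ℝ) < n := by exact_mod_cast hn
  set j := ⌈(k : ℝ) / n⌉ with hj
  have h2 : (k : ℝ) / n ≤ j := Int.le_ceil _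
  have h3 : (j : ℝ) < k / n + 1 := Int.ceil_lt_add_one _
  have h4 : (j : ℝ) * n < k + n := by
    have := mul_lt_mul_of_pos_right h3 hn'
    rwa [add_mul, one_mul, div_mul_cancel₀ _ hn'.ne'] at this
  have h5 : j * n + 1 ≤ k + n := by exact_mod_cast h4
  have h6 : (j : ℝ) * n + 1 ≤ k + n := by exact_mod_cast h5
  rw [Int.floor_eq_iff]
  push_cast
  constructor
  · rw [le_sub_iff_add_le, le_div_iff₀ hn']
    nlinarith
  · linarith

theorem floor_div_add {n k : ℕ} (hn : 0 < n) {δ : ℝ} (h0 : 0 < δ) (h1 : 2 * n * δ < 1) :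
    ⌊(k : ℝ) / n + δ⌋ = ⌊(k : ℝ) / n⌋ := by
  have hn' : (0 : ℝ) < n := by exact_mod_cast hn
  set j := ⌊(k : ℝ) / n⌋ with hj
  have h2 : (j : ℝ) ≤ k / n := Int.floor_le _
  have h3 : (k : ℝ) / n < j + 1 := Int.lt_floor_add_one _
  rw [div_lt_iff₀ hn'] at h3
  have h5 : (k : ℤ) + 1 ≤ (j + 1) * n := by exact_mod_cast h3
  have h6 : (k : ℝ) + 1 ≤ (j + 1) * n := by exact_mod_cast h5
  rw [Int.floor_eq_iff]
  constructor
  · linarith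
  · rw [← lt_sub_iff_add_lt, div_lt_iff₀ hn']
    nlinarith

/-- Otherwise 2nδ would be an integer of absolute value less than 1, hence zero. -/
theorem two_mul_div_add_ne_intCast {n k : ℕ} (hn : 0 < n) {δ : ℝ} (h0 : δ ≠ 0)
    (h1 : 2 * n * |δ| < 1) (j : ℤ) : 2 * ((k : ℝ) / n + δ) ≠ j := by
  have hn' : (0 : ℝ) < n := by exact_mod_cast hn
  intro h
  have h2 : 2 * n * δ = ((j * n - 2 * k : ℤ) : ℝ) := by
    push_cast
    rw [← h]
    field_simp
    ring
  have h3 : |((j * n - 2 * k : ℤ) : ℝ)| < 1 := by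
    rw [← h2, abs_mul, abs_of_pos (by positivity : (0 : ℝ) < 2 * n)]
    exact h1
  have h4 : |j * n - 2 * (k : ℤ)| < 1 := by exact_mod_cast h3
  rw [Int.abs_lt_one_iff] at h4
  rw [h4, Int.cast_zero] at h2
  rcases mul_eq_zero.1 h2 with h5 | h5
  · linarith
  · exact h0 h5

theorem sin_ne_zero_of_two_mul_ne {x : ℝ} (h : ∀ j : ℤ, 2 * x ≠ j) :
    Real.sin (2 * Real.pi * x) ≠ 0 := by
  rw [Real.sin_ne_zero_iff]
  intro j hj
  apply h j
  have hpi := Real.pi_pos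
  have : Real.pi * (2 * x) = Real.pi * j := by linarith
  exact mul_left_cancel₀ hpi.ne' this

section

variable {G : Subgroup SU2} {f : S2 → ℝ} {ε : ℝ}

/-- The Floquet data of an orbit over nondegenerate extrema. -/
theorem elliptic_orbit (h : Admissible f ε) {γ : ReebOrbit G f ε} {X : Set S2} (hγ : γ.LiesOver X)
    (hcrit : X ⊆ criticalPoints f) {a c x : ℝ}
    (hq : ∀ p ∈ X, ∃ τ₀ τ₁, HasQuadraticForm f p a a c τ₀ τ₁)
    (hx : (2 / (1 + ε * c) - a * ε / (2 * (1 + ε * c) ^ 2)) * γ.action = 2 * Real.pi * x)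
    (hx2 : ∀ j : ℤ, 2 * x ≠ j) :
    γ.IsNondegenerate ∧ ¬ γ.IsNegativeHyperbolic ∧ γ.HasCZIndex (2 * ⌊x⌋ + 1) := by
  have hpi := Real.pi_pos
  -- As 2x is not an integer, the return map is a rotation by an angle outside πℤ: 1 is not an
  -- eigenvalue and no eigenvalue is real.
  have hsin := sin_ne_zero_of_two_mul_ne hx2
  have key : ∀ l, γ.IsParam l → ∀ z, proj G z = l.toFun 0 → ∀ t, 0 ≤ t → flowMatrix f ε z t
      = rotMat ((2 / (1 + ε * c) - a * ε / (2 * (1 + ε * c) ^ 2)) * t) := by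
    intro l hl z hz t ht
    have hzX := hγ l hl z hz
    obtain ⟨τ₀, τ₁, hτ⟩ := hq _ hzX
    exact flowMatrix_elliptic h (hcrit hzX) hτ ht
  have key' : ∀ l, γ.IsParam l → ∀ z, proj G z = l.toFun 0 →
      flowMatrix f ε z l.period = rotMat (2 * Real.pi * x) := by
    intro l hl z hz
    rw [key l hl z hz _ l.period_pos.le, ← hl.period_eq, hx]
  refine ⟨fun l hl z hz => ?_, fun hneg => ?_, fun l hl z hz => ?_⟩
  · rw [key' l hl z hz]
    exact one_notMem_spectrum_rotMat hsin
  · obtain ⟨l, z, hl, hz⟩ := γ.exists_param_lift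
    have := hneg l hl z hz
    rw [key' l hl z hz] at this
    exact exists_nonreal_mem_spectrum_rotMat hsin this
  · have e : (2 / (1 + ε * c) - a * ε / (2 * (1 + ε * c) ^ 2)) * l.period / (2 * Real.pi) = x := by
      rw [← hl.period_eq, hx]
      field_simp
    rw [czIndex_rotMat l.period_pos.le (key l hl z hz), e]
    rw [e]
    intro j hj
    exact hx2 (2 * j) (by rw [hj]; push_cast; ring)

/-- The Floquet data of an orbit over saddles. -/
theorem hyperbolic_orbit (h : Admissible f ε) (hε : 0 < ε) {γ : ReebOrbit G f ε} {X : Set S2}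
    (hγ : γ.LiesOver X) (hcrit : X ⊆ criticalPoints f)
    (hq : ∀ p ∈ X, ∃ τ₀ τ₁, HasQuadraticForm f p 1 (-1) 0 τ₀ τ₁) {k : ℕ}
    (hk : γ.action = k * Real.pi / 2) :
    γ.IsNondegenerate ∧ (k = 1 → γ.IsNegativeHyperbolic) ∧ γ.HasCZIndex k := by
  have hpi := Real.pi_pos
  have key : ∀ l, γ.IsParam l → ∀ z, proj G z = l.toFun 0 → ∃ q r : ℝ, q ^ 2 + r ^ 2 = 1 ∧
      ∀ t, 0 ≤ t → flowMatrix f ε z t = rotMat (2 * t) * hypMat q r (ε / 2 * t) := by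
    intro l hl z hz
    have hzX := hγ l hl z hz
    obtain ⟨τ₀, τ₁, hτ⟩ := hq _ hzX
    exact flowMatrix_hyperbolic h (hcrit hzX) hτ
  have hper : ∀ l, γ.IsParam l → 2 * l.period = k * Real.pi := by
    intro l hl
    rw [← hl.period_eq, hk]
    ring
  refine ⟨fun l hl z hz => ?_, fun hk1 l hl z hz μ hμ => ?_, fun l hl z hz => ?_⟩
  · obtain ⟨q, r, hqr, hM⟩ := key l hl z hz
    rw [hM _ l.period_pos.le, hper l hl]
    exact one_notMem_spectrum_hyperbolic hqr (mul_pos (by linarith) l.period_pos).ne' k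
  · obtain ⟨q, r, hqr, hM⟩ := key l hl z hz
    rw [hM _ l.period_pos.le, hper l hl, hk1, Nat.cast_one, one_mul] at hμ
    exact negative_of_mem_spectrum_hyperbolic hqr hμ
  · obtain ⟨q, r, hqr, hM⟩ := key l hl z hz
    rw [← hl.period_eq, hk]
    exact czIndex_hyperbolic hqr hM

/-- During the action the leading speed 2/(1 − ε) makes exactly k/n turns, and the Hessian of a
minimum retards this by δ = εk/(4n(1 − ε)). The rotation number is just below k/n, so its floor is
⌈k/n⌉ − 1. -/
theorem minimum_orbit (h : Admissible f ε) (hε : 0 < ε) (hε2 : ε ≤ 1 / 2) {γ : ReebOrbit G f ε}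
    {X : Set S2} (hγ : γ.LiesOver X) (hcrit : X ⊆ criticalPoints f)
    (hq : ∀ p ∈ X, ∃ τ₀ τ₁, HasQuadraticForm f p 1 1 (-1) τ₀ τ₁) {k n : ℕ} (hn : 0 < n)
    (hk0 : 0 < k) (hk : γ.action = k * Real.pi * (1 - ε) / n) (hεk : ε * k < 1) :
    γ.IsNondegenerate ∧ ¬ γ.IsNegativeHyperbolic ∧ γ.HasCZIndex (2 * ⌈(k : ℝ) / n⌉ - 1) := by
  have hn' : (0 : ℝ) < n := by exact_mod_cast hn
  have hk' : (0 : ℝ) < k := by exact_mod_cast hk0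
  have h1 : 0 < 1 - ε := by linarith
  set δ := ε * k / (4 * n * (1 - ε)) with hδ
  have hδ0 : 0 < δ := by positivity
  have hδ1 : 2 * n * δ < 1 := by
    have e : 2 * n * δ = ε * k / (2 * (1 - ε)) := by
      rw [hδ]
      field_simp
      ring
    rw [e, div_lt_one (by positivity)]
    linarith
  have hne := two_mul_div_add_ne_intCast (k := k) hn (δ := -δ) (neg_ne_zero.2 hδ0.ne')
    (by rwa [abs_neg, abs_of_pos hδ0])
  have := elliptic_orbit h hγ hcrit hq (x := (k : ℝ) / n + -δ) (by
    rw [hk, hδ, mul_neg_one, ← sub_eq_add_neg, ← sub_eq_add_neg]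
    field_simp
    ring) hne
  rwa [← sub_eq_add_neg, floor_div_sub hn hδ0 hδ1,
    show 2 * (⌈(k : ℝ) / n⌉ - 1) + 1 = 2 * ⌈(k : ℝ) / n⌉ - 1 by ring] at this

/-- At a maximum the Hessian advances the rotation by δ = εk/(4n(1 + ε)), to just above k/n, which
leaves the floor at ⌊k/n⌋. -/
theorem maximum_orbit (h : Admissible f ε) (hε : 0 < ε) {γ : ReebOrbit G f ε}
    {X : Set S2} (hγ : γ.LiesOver X) (hcrit : X ⊆ criticalPoints f)
    (hq : ∀ p ∈ X, ∃ τ₀ τ₁, HasQuadraticForm f p (-1) (-1) 1 τ₀ τ₁) {k n : ℕ} (hn : 0 < n)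
    (hk0 : 0 < k) (hk : γ.action = k * Real.pi * (1 + ε) / n) (hεk : ε * k < 1) :
    γ.IsNondegenerate ∧ ¬ γ.IsNegativeHyperbolic ∧ γ.HasCZIndex (2 * ⌊(k : ℝ) / n⌋ + 1) := by
  have hn' : (0 : ℝ) < n := by exact_mod_cast hn
  have hk' : (0 : ℝ) < k := by exact_mod_cast hk0
  set δ := ε * k / (4 * n * (1 + ε)) with hδ
  have hδ0 : 0 < δ := by positivity
  have hδ1 : 2 * n * δ < 1 := by
    have e : 2 * n * δ = ε * k / (2 * (1 + ε)) := by
      rw [hδ]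
      field_simp
      ring
    rw [e, div_lt_one (by positivity)]
    linarith
  have hne := two_mul_div_add_ne_intCast (k := k) hn (δ := δ) hδ0.ne'
    (by rwa [abs_of_pos hδ0])
  have := elliptic_orbit h hγ hcrit hq (x := (k : ℝ) / n + δ) (by
    rw [hk, hδ, mul_one]
    field_simp
    ring) hne
  rwa [floor_div_add hn hδ0 hδ1] at this

end

/-! ### Counting -/

theorem encard_pnat_Ioc (a b : ℕ) : {k : ℕ+ | a < (k : ℕ) ∧ (k : ℕ) ≤ b}.encard = (b - a : ℕ) := by
  have h : (fun k : ℕ+ => (k : ℕ)) '' {k : ℕ+ | a < (k : ℕ) ∧ (k : ℕ) ≤ b} = Finset.Ioc a b := by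
    ext x
    simp only [Set.mem_image, Set.mem_ofPred_eq, Finset.coe_Ioc, Set.mem_Ioc]
    constructor
    · rintro ⟨k, hk, rfl⟩
      exact hk
    · intro hx
      exact ⟨⟨x, by omega⟩, hx, rfl⟩
  rw [← Function.Injective.encard_image PNat.coe_injective, h, Set.encard_coe_eq_coe_finsetCard,
    Nat.card_Ioc]

theorem ceil_natCast_div_eq_iff {n k : ℕ} (hn : 0 < n) (j : ℤ) :
    ⌈(k : ℝ) / n⌉ = j ↔ (j - 1) * n < k ∧ (k : ℤ) ≤ j * n := by
  have hn' : (0 : ℝ) < n := by exact_mod_cast hn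
  rw [Int.ceil_eq_iff, lt_div_iff₀ hn', div_le_iff₀ hn']
  exact and_congr (by exact_mod_cast Iff.rfl) (by exact_mod_cast Iff.rfl)

theorem floor_natCast_div_eq_iff {n k : ℕ} (hn : 0 < n) (j : ℤ) :
    ⌊(k : ℝ) / n⌋ = j ↔ j * n ≤ k ∧ (k : ℤ) < (j + 1) * n := by
  have hn' : (0 : ℝ) < n := by exact_mod_cast hn
  rw [Int.floor_eq_iff, le_div_iff₀ hn', div_lt_iff₀ hn']
  exact and_congr (by exact_mod_cast Iff.rfl) (by exact_mod_cast Iff.rfl)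

section

variable {G : Subgroup SU2} {f : S2 → ℝ} {ε : ℝ}

theorem ReebOrbit.iterate_injective (γ : ReebOrbit G f ε) : Function.Injective γ.iterate := by
  intro k l h
  have h1 := congrArg ReebOrbit.action h
  rw [action_iterate, action_iterate] at h1
  exact PNat.coe_injective (by exact_mod_cast mul_right_cancel₀ γ.action_pos.ne' h1)

/-- The Reeb orbits of action less than `L` are the iterates of three orbits lying over disjoint
sets, in the ranges and with the indices of the lemma. -/
structure IsOrbitList (𝒱 ℰ ℱ : ReebOrbit G f ε) (L : ℝ) (N n : ℕ) : Prop where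
  action_lt_iff : ∀ γ : ReebOrbit G f ε, γ.action < L ↔
    (∃ k : ℕ+, (k : ℕ) < 2 * N * n ∧ γ = 𝒱.iterate k) ∨
    (∃ k : ℕ+, (k : ℕ) < 4 * N ∧ γ = ℰ.iterate k) ∨
    (∃ k : ℕ+, (k : ℕ) < 6 * N ∧ γ = ℱ.iterate k)
  ne_VE : ∀ k l : ℕ+, 𝒱.iterate k ≠ ℰ.iterate l
  ne_VF : ∀ k l : ℕ+, 𝒱.iterate k ≠ ℱ.iterate l
  ne_EF : ∀ k l : ℕ+, ℰ.iterate k ≠ ℱ.iterate l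
  index_V : ∀ k : ℕ+, (k : ℕ) < 2 * N * n → (𝒱.iterate k).HasCZIndex (2 * ⌈(k : ℝ) / n⌉ - 1)
  index_E : ∀ k : ℕ+, (k : ℕ) < 4 * N → (ℰ.iterate k).HasCZIndex k
  index_F : ∀ k : ℕ+, (k : ℕ) < 6 * N → (ℱ.iterate k).HasCZIndex (2 * ⌊(k : ℝ) / 3⌋ + 1)

namespace IsOrbitList

variable {𝒱 ℰ ℱ : ReebOrbit G f ε} {L : ℝ} {N n : ℕ}

theorem hasDegree_V_iff (h : IsOrbitList 𝒱 ℰ ℱ L N n) (hn : 0 < n) {k : ℕ+}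
    (hk : (k : ℕ) < 2 * N * n) (i : ℤ) : (𝒱.iterate k).HasDegree i ↔
      ∃ j : ℤ, i = 2 * j ∧ j * n < (k : ℕ) ∧ ((k : ℕ) : ℤ) ≤ j * n + n := by
  have h1 := h.index_V k hk
  constructor
  · intro hd
    have h2 := hd.unique h1
    refine ⟨⌈(k : ℝ) / n⌉ - 1, by omega, ?_⟩
    have h3 := (ceil_natCast_div_eq_iff (k := k) hn ⌈(k : ℝ) / n⌉).1 rfl
    refine ⟨h3.1, h3.2.trans_eq (by ring)⟩
  · rintro ⟨j, rfl, h2, h3⟩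
    have h4 := (ceil_natCast_div_eq_iff (k := k) hn (j + 1)).2
      ⟨by rwa [add_sub_cancel_right], h3.trans_eq (by ring)⟩
    rw [h4] at h1
    rw [ReebOrbit.HasDegree]
    convert h1 using 1
    ring

theorem hasDegree_E_iff (h : IsOrbitList 𝒱 ℰ ℱ L N n) {k : ℕ+}
    (hk : (k : ℕ) < 4 * N) (i : ℤ) : (ℰ.iterate k).HasDegree i ↔ i + 1 = (k : ℕ) := by
  have h1 := h.index_E k hk
  constructor
  · intro hd
    exact hd.unique h1
  · intro hi
    rwa [ReebOrbit.HasDegree, hi]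

theorem hasDegree_F_iff (h : IsOrbitList 𝒱 ℰ ℱ L N n) {k : ℕ+}
    (hk : (k : ℕ) < 6 * N) (i : ℤ) : (ℱ.iterate k).HasDegree i ↔
      ∃ j : ℤ, i = 2 * j ∧ j * 3 ≤ (k : ℕ) ∧ ((k : ℕ) : ℤ) < j * 3 + 3 := by
  have h1 := h.index_F k hk
  have h3 := floor_natCast_div_eq_iff (n := 3) (k := k) (by norm_num)
  push_cast at h3
  constructor
  · intro hd
    have h2 := hd.unique h1
    refine ⟨⌊(k : ℝ) / 3⌋, by omega, ?_⟩
    have h4 := (h3 ⌊(k : ℝ) / 3⌋).1 rfl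
    exact ⟨h4.1, h4.2.trans_eq (by ring)⟩
  · rintro ⟨j, rfl, h2, h4⟩
    have h5 := (h3 j).2 ⟨h2, h4.trans_eq (by ring)⟩
    rwa [ReebOrbit.HasDegree, ← h5]

theorem encard_orbitsOfDegree (h : IsOrbitList 𝒱 ℰ ℱ L N n) (hn : 0 < n) (i : ℤ) :
    (orbitsOfDegree G f ε L i).encard =
      {k : ℕ+ | (k : ℕ) < 2 * N * n ∧
        ∃ j : ℤ, i = 2 * j ∧ j * n < (k : ℕ) ∧ ((k : ℕ) : ℤ) ≤ j * n + n}.encard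
      + {k : ℕ+ | (k : ℕ) < 4 * N ∧ i + 1 = (k : ℕ)}.encard
      + {k : ℕ+ | (k : ℕ) < 6 * N ∧
        ∃ j : ℤ, i = 2 * j ∧ j * 3 ≤ (k : ℕ) ∧ ((k : ℕ) : ℤ) < j * 3 + 3}.encard := by
  rw [← 𝒱.iterate_injective.encard_image, ← ℰ.iterate_injective.encard_image,
    ← ℱ.iterate_injective.encard_image, ← Set.encard_union_eq, ← Set.encard_union_eq]
  · congr 1
    ext γ
    simp only [orbitsOfDegree, Set.mem_ofPred_eq, Set.mem_union, Set.mem_image, h.action_lt_iff]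
    constructor
    · rintro ⟨⟨k, hk, rfl⟩ | ⟨k, hk, rfl⟩ | ⟨k, hk, rfl⟩, hd⟩
      · exact Or.inl (Or.inl ⟨k, ⟨hk, (h.hasDegree_V_iff hn hk i).1 hd⟩, rfl⟩)
      · exact Or.inl (Or.inr ⟨k, ⟨hk, (h.hasDegree_E_iff hk i).1 hd⟩, rfl⟩)
      · exact Or.inr ⟨k, ⟨hk, (h.hasDegree_F_iff hk i).1 hd⟩, rfl⟩
    · rintro ((⟨k, ⟨hk, hd⟩, rfl⟩ | ⟨k, ⟨hk, hd⟩, rfl⟩) | ⟨k, ⟨hk, hd⟩, rfl⟩)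
      · exact ⟨Or.inl ⟨k, hk, rfl⟩, (h.hasDegree_V_iff hn hk i).2 hd⟩
      · exact ⟨Or.inr (Or.inl ⟨k, hk, rfl⟩), (h.hasDegree_E_iff hk i).2 hd⟩
      · exact ⟨Or.inr (Or.inr ⟨k, hk, rfl⟩), (h.hasDegree_F_iff hk i).2 hd⟩
  · rw [Set.disjoint_left]
    rintro _ (⟨k, -, rfl⟩ | ⟨k, -, rfl⟩) ⟨l, -, hl⟩
    · exact h.ne_VF k l hl.symm
    · exact h.ne_EF k l hl.symm
  · rw [Set.disjoint_left]
    rintro _ ⟨k, -, rfl⟩ ⟨l, -, hl⟩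
    exact h.ne_VE k l hl.symm

theorem encard_of_outside (h : IsOrbitList 𝒱 ℰ ℱ L N n) (hn : 0 < n) {i : ℤ}
    (hi : i < 0 ∨ 4 * N - 2 < i) : (orbitsOfDegree G f ε L i).encard = 0 := by
  rw [Set.encard_eq_zero, Set.eq_empty_iff_forall_notMem]
  rintro γ ⟨hγ, hd⟩
  have hn' : (0 : ℤ) < n := by exact_mod_cast hn
  rcases (h.action_lt_iff γ).1 hγ with ⟨k, hk, rfl⟩ | ⟨k, hk, rfl⟩ | ⟨k, hk, rfl⟩
  · obtain ⟨j, rfl, h1, h2⟩ := (h.hasDegree_V_iff hn hk i).1 hd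
    have hk0 : (0 : ℤ) < (k : ℕ) := by exact_mod_cast k.pos
    have h3 : (0 : ℤ) < (j + 1) * n := by linarith
    have h4 : 0 < j + 1 := (mul_pos_iff_of_pos_right hn').1 h3
    have h5 : j * n < 2 * N * n := h1.trans (by exact_mod_cast hk)
    have h6 : j < 2 * N := lt_of_mul_lt_mul_right h5 hn'.le
    omega
  · have := (h.hasDegree_E_iff hk i).1 hd
    have := k.pos
    omega
  · obtain ⟨j, rfl, h1, h2⟩ := (h.hasDegree_F_iff hk i).1 hd
    have := k.pos
    omega

theorem encard_of_odd (h : IsOrbitList 𝒱 ℰ ℱ L N n) (hn : 0 < n) {i : ℤ} (hodd : Odd i)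
    (h0 : 0 < i) (h1 : i < 4 * N - 2) : (orbitsOfDegree G f ε L i).encard = 1 := by
  have hne : ∀ j : ℤ, i ≠ 2 * j := by
    obtain ⟨a, rfl⟩ := hodd
    omega
  rw [h.encard_orbitsOfDegree hn]
  have e : {k : ℕ+ | (k : ℕ) < 4 * N ∧ i + 1 = (k : ℕ)}
      = {k : ℕ+ | i.toNat < (k : ℕ) ∧ (k : ℕ) ≤ i.toNat + 1} := by
    ext k
    simp only [Set.mem_ofPred_eq]
    omega
  rw [e, encard_pnat_Ioc]
  simp [hne]

/-- Degree 2j collects jn < k ≤ jn + n for 𝒱, k = 2j + 1 for ℰ and 3j ≤ k ≤ 3j + 2 for ℱ. The last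
block for 𝒱 loses k = 2Nn, which is outside the action window, and the first block for ℱ loses k =
0. -/
theorem encard_of_even (h : IsOrbitList 𝒱 ℰ ℱ L N n) (hn : 0 < n) {j : ℕ} (hj : j < 2 * N) :
    (orbitsOfDegree G f ε L (2 * j)).encard = ((if j + 1 = 2 * N then n - 1 else n) + 1
      + (if j = 0 then 2 else 3) : ℕ) := by
  rw [h.encard_orbitsOfDegree hn]
  have e1 : {k : ℕ+ | (k : ℕ) < 2 * N * n ∧ ∃ j' : ℤ, (2 * j : ℤ) = 2 * j' ∧ j' * n < (k : ℕ) ∧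
      ((k : ℕ) : ℤ) ≤ j' * n + n}
      = {k : ℕ+ | j * n < (k : ℕ) ∧ (k : ℕ) ≤ min (j * n + n) (2 * N * n - 1)} := by
    ext k
    simp only [Set.mem_ofPred_eq, le_min_iff]
    constructor
    · rintro ⟨h1, j', h2, h3, h4⟩
      have : j' = j := by omega
      subst this
      exact ⟨by exact_mod_cast h3, by exact_mod_cast h4, by omega⟩
    · rintro ⟨h1, h2, h3⟩
      have hk := k.pos
      exact ⟨by omega, j, rfl, by exact_mod_cast h1, by exact_mod_cast h2⟩
  have e2 : {k : ℕ+ | (k : ℕ) < 4 * N ∧ (2 * j : ℤ) + 1 = (k : ℕ)}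
      = {k : ℕ+ | 2 * j < (k : ℕ) ∧ (k : ℕ) ≤ 2 * j + 1} := by
    ext k
    simp only [Set.mem_ofPred_eq]
    omega
  have e3 : {k : ℕ+ | (k : ℕ) < 6 * N ∧ ∃ j' : ℤ, (2 * j : ℤ) = 2 * j' ∧ j' * 3 ≤ (k : ℕ) ∧
      ((k : ℕ) : ℤ) < j' * 3 + 3}
      = {k : ℕ+ | 3 * j - 1 < (k : ℕ) ∧ (k : ℕ) ≤ 3 * j + 2} := by
    ext k
    have hk := k.pos
    simp only [Set.mem_ofPred_eq]
    constructor
    · rintro ⟨h1, j', h2, h3, h4⟩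
      omega
    · rintro ⟨h1, h2⟩
      exact ⟨by omega, j, rfl, by omega, by omega⟩
  rw [e1, e2, e3, encard_pnat_Ioc, encard_pnat_Ioc, encard_pnat_Ioc, ← Nat.cast_add,
    ← Nat.cast_add]
  congr 1
  congr 1
  · congr 1
    · have h1 : j * n + n ≤ 2 * N * n := by
        rw [← Nat.succ_mul]
        exact Nat.mul_le_mul_right n hj
      split_ifs with h2
      · rw [← h2, Nat.add_mul, one_mul] at h1 ⊢
        omega
      · have h3 : j * n + n + n ≤ 2 * N * n := by
          rw [← Nat.succ_mul, ← Nat.succ_mul]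
          exact Nat.mul_le_mul_right n (by omega)
        omega
    · omega
  · split_ifs with h2 <;> omega

end IsOrbitList

/-! ### Hessians at the three kinds of critical points, and bounds on f -/

theorem exists_quadraticForm_of_isPolyhedralMorse {Q : Polyhedron} {ρ : SO3}
    (hf : IsPolyhedralMorse Q ρ f) :
    (∀ p ∈ vertexPoints Q ρ, ∃ τ₀ τ₁, HasQuadraticForm f p 1 1 (-1) τ₀ τ₁) ∧
    (∀ p ∈ edgePoints Q ρ, ∃ τ₀ τ₁, HasQuadraticForm f p 1 (-1) 0 τ₀ τ₁) ∧
    (∀ p ∈ facePoints Q ρ, ∃ τ₀ τ₁, HasQuadraticForm f p (-1) (-1) 1 τ₀ τ₁) := by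
  refine ⟨fun p hp => HasLocalForm.exists_hasQuadraticForm ?_,
    fun p hp => HasLocalForm.exists_hasQuadraticForm ?_,
    fun p hp => HasLocalForm.exists_hasQuadraticForm ?_⟩
  · convert hf.vertex p hp using 3
    ring
  · convert hf.edge p hp using 3
    ring
  · convert hf.face p hp using 3
    ring

theorem exists_abs_smoothExt_le (hf : ContMDiff (𝓡 2) 𝓘(ℝ, ℝ) ∞ f) :
    ∃ M, 0 ≤ M ∧ ∀ x, |smoothExt f x| ≤ M := by
  obtain ⟨M, hM⟩ := (hasCompactSupport_smoothExt f).exists_bound_of_continuous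
    (contDiff_smoothExt hf).continuous
  exact ⟨M, (norm_nonneg _).trans (hM 0), hM⟩

theorem admissible_of_small (hf : ContMDiff (𝓡 2) 𝓘(ℝ, ℝ) ∞ f) (hε : 0 < ε) {M : ℝ}
    (hM : ∀ x, |smoothExt f x| ≤ M) (h : ε * M ≤ 1 / 2) : Admissible f ε := by
  refine ⟨hf, fun x => ?_⟩
  have h1 := (abs_le.1 (hM x)).1
  nlinarith

theorem disjoint_of_value {X Y : Set S2} {v w : ℝ} (hX : ∀ p ∈ X, f p = v) (hY : ∀ p ∈ Y, f p = w)
    (h : v ≠ w) : Disjoint X Y :=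
  Set.disjoint_left.2 fun p hp hq => h ((hX p hp).symm.trans (hY p hq))

end

theorem three_le_vertexOrder (Q : Polyhedron) : 3 ≤ Q.vertexOrder := by
  cases Q <;> simp [Polyhedron.vertexOrder]

theorem vertexOrder_le_five (Q : Polyhedron) : Q.vertexOrder ≤ 5 := by
  cases Q <;> simp [Polyhedron.vertexOrder]

/-! ### Good and bad orbits -/

section

variable {G : Subgroup SU2} {f : S2 → ℝ} {ε : ℝ}

theorem ReebOrbit.iterate_iterate (γ : ReebOrbit G f ε) (k l : ℕ+) :
    (γ.iterate k).iterate l = γ.iterate (k * l) := by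
  obtain ⟨l₀, rfl⟩ := γ.exists_param
  refine Quotient.sound ⟨?_, 0, fun t => by rw [add_zero]; rfl⟩
  simp only [ReebLoop.iterate, PNat.mul_coe, Nat.cast_mul]
  ring

theorem ReebOrbit.ProjectsTo.iterate {γ : ReebOrbit G f ε} {q : BaseQuotient G}
    (h : γ.ProjectsTo q) (k : ℕ+) : (γ.iterate k).ProjectsTo q := by
  intro l hl t
  obtain ⟨l₀, rfl⟩ := γ.exists_param
  obtain ⟨-, s, hs⟩ := Quotient.exact hl.symm
  rw [hs]
  exact h l₀ rfl (t + s)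

theorem ReebOrbit.action_le_iterate (γ : ReebOrbit G f ε) (k : ℕ+) :
    γ.action ≤ (γ.iterate k).action := by
  rw [action_iterate]
  exact le_mul_of_one_le_left γ.action_pos.le (by exact_mod_cast (one_le : 1 ≤ k))

namespace IsOrbitList

variable {𝒱 ℰ ℱ : ReebOrbit G f ε} {L : ℝ} {N n : ℕ}

/-- If the orbit is an even iterate of a negative hyperbolic β, then β has no larger action, so it
is in the list. The extrema are excluded, so β is an iterate of ℰ; the orbit is then an even iterate
of ℰ, of odd degree. -/
theorem isGood_of_even (h : IsOrbitList 𝒱 ℰ ℱ L N n)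
    (hV : ∀ k : ℕ+, (k : ℕ) < 2 * N * n → ¬ (𝒱.iterate k).IsNegativeHyperbolic)
    (hF : ∀ k : ℕ+, (k : ℕ) < 6 * N → ¬ (ℱ.iterate k).IsNegativeHyperbolic) {i : ℤ} (hi : Even i)
    {γ : ReebOrbit G f ε} (hγ : γ ∈ orbitsOfDegree G f ε L i) : γ.IsGood := by
  rintro ⟨β, j, hβ, rfl⟩
  obtain ⟨hL, hd⟩ := hγ
  rcases (h.action_lt_iff β).1 ((β.action_le_iterate _).trans_lt hL) with
    ⟨k, hk, rfl⟩ | ⟨k, hk, rfl⟩ | ⟨k, hk, rfl⟩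
  · exact hV k hk hβ
  · rw [ReebOrbit.iterate_iterate] at hL hd
    rcases (h.action_lt_iff _).1 hL with ⟨k', -, hk'⟩ | ⟨k', hk', he⟩ | ⟨k', -, hk'⟩
    · exact h.ne_VE _ _ hk'.symm
    · rw [← ℰ.iterate_injective he] at hk'
      have h1 := (h.hasDegree_E_iff hk' i).1 hd
      have h2 : ((k * (2 * j) : ℕ+) : ℕ) = 2 * ((k : ℕ) * (j : ℕ)) := by
        simp only [PNat.mul_coe, PNat.val_ofNat]
        ring
      obtain ⟨a, rfl⟩ := hi
      rw [h2] at h1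
      omega
    · exact h.ne_EF _ _ hk'
  · exact hF k hk hβ

/-- Iterates of 𝒱 and ℱ have even degree, and the k-th iterate of ℰ has degree k − 1, so k is even
and the orbit is an even iterate of ℰ. -/
theorem isBad_of_odd (h : IsOrbitList 𝒱 ℰ ℱ L N n) (hn : 0 < n) (hE : ℰ.IsNegativeHyperbolic)
    {i : ℤ} (hi : Odd i) {γ : ReebOrbit G f ε} (hγ : γ ∈ orbitsOfDegree G f ε L i) : γ.IsBad := by
  obtain ⟨a, rfl⟩ := hi
  obtain ⟨hL, hd⟩ := hγ
  rcases (h.action_lt_iff γ).1 hL with ⟨k, hk, rfl⟩ | ⟨k, hk, rfl⟩ | ⟨k, hk, rfl⟩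
  · obtain ⟨j, hj, -⟩ := (h.hasDegree_V_iff hn hk _).1 hd
    omega
  · have h1 := (h.hasDegree_E_iff hk _).1 hd
    have hk0 := k.pos
    refine ⟨ℰ, ⟨(k : ℕ) / 2, by omega⟩, hE, ?_⟩
    congr 1
    apply PNat.eq
    change (k : ℕ) = 2 * ((k : ℕ) / 2)
    omega
  · obtain ⟨j, hj, -⟩ := (h.hasDegree_F_iff hk _).1 hd
    omega

end IsOrbitList

end

/-! ### The iterates inside the action window, and the choice of ε -/

section ActionWindow

variable {ε : ℝ} {N k : ℕ}

/-- The first excluded iterate k = 2Nn has action 2πN(1 − ε), which stays above the bound because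
2εN ≤ 1/10. The last admitted one is at least π/n ≥ π/5 below 2πN, more than the gap π/10. -/
theorem minimum_action_lt_iff (hε : 0 < ε) (hε1 : ε ≤ 1) (hN : 20 * (ε * N) ≤ 1)
    {n : ℕ} (hn0 : 0 < n) (hn : n ≤ 5) : k * Real.pi * (1 - ε) / n < 2 * Real.pi * N - Real.pi / 10 ↔
      k < 2 * N * n := by
  have hpi := Real.pi_pos
  have hn0' : (0 : ℝ) < n := by exact_mod_cast hn0
  have hn' : (n : ℝ) ≤ 5 := by exact_mod_cast hn
  have e : k * Real.pi * (1 - ε) / n < 2 * Real.pi * N - Real.pi / 10 ↔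
      k * (1 - ε) < (2 * N - 1 / 10) * n := by
    rw [div_lt_iff₀ hn0', ← mul_lt_mul_iff_right₀ (b := k * (1 - ε)) hpi]
    constructor <;> intro h <;> linarith
  rw [e]
  constructor
  · intro h
    by_contra! hk
    have hk' : 2 * (N : ℝ) * n ≤ k := by exact_mod_cast hk
    have h1 : ε * N * n ≤ 1 / 20 * n := mul_le_mul_of_nonneg_right (by linarith) hn0'.le
    have h3 := mul_le_mul_of_nonneg_right hk' (sub_nonneg.2 hε1)
    nlinarith
  · intro h
    have h' : (k : ℝ) + 1 ≤ 2 * N * n := by exact_mod_cast h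
    have hk0 : (0 : ℝ) ≤ ε * k := by positivity
    linarith

theorem saddle_action_lt_iff :
    k * Real.pi / 2 < 2 * Real.pi * N - Real.pi / 10 ↔ k < 4 * N := by
  have hpi := Real.pi_pos
  constructor
  · intro h
    by_contra! hk
    have hk' : 4 * (N : ℝ) ≤ k := by exact_mod_cast hk
    nlinarith
  · intro h
    have h' : (k : ℝ) + 1 ≤ 4 * N := by exact_mod_cast h
    nlinarith

/-- The last admitted iterate is k = 6N − 1; the perturbation enlarges (6N − 1)/3 by at most 2Nε ≤
1/10, less than the available 1/3 − 1/10. -/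
theorem maximum_action_lt_iff (hε : 0 < ε) (hN : 20 * (ε * N) ≤ 1) :
    k * Real.pi * (1 + ε) / 3 < 2 * Real.pi * N - Real.pi / 10 ↔ k < 6 * N := by
  have hpi := Real.pi_pos
  have e : k * Real.pi * (1 + ε) / 3 < 2 * Real.pi * N - Real.pi / 10 ↔
      k * (1 + ε) < (2 * N - 1 / 10) * 3 := by
    rw [div_lt_iff₀ (by norm_num), ← mul_lt_mul_iff_right₀ (b := k * (1 + ε)) hpi]
    constructor <;> intro h <;> linarith
  rw [e]
  constructor
  · intro h
    by_contra! hk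
    have hk' : 6 * (N : ℝ) ≤ k := by exact_mod_cast hk
    have hk0 : (0 : ℝ) ≤ k * ε := by positivity
    linarith
  · intro h
    have h' : (k : ℝ) + 1 ≤ 6 * N := by exact_mod_cast h
    have h1 := mul_le_mul_of_nonneg_right h' hε.le
    nlinarith

theorem exists_smallness (M C : ℝ) (hM : 0 ≤ M) (hC : 0 ≤ C) (N : ℕ) :
    ∃ ε₀ : ℝ, 0 < ε₀ ∧ ∀ ε, 0 < ε → ε ≤ ε₀ →
      ε * M ≤ 1 / 2 ∧ ε ≤ 1 / 2 ∧ 20 * (ε * N) ≤ 1 / 2 ∧ ε * C < 1 := by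
  have hN : (0 : ℝ) ≤ N := by positivity
  have hpos : 0 < 2 * M + 40 * N + C + 2 := by positivity
  refine ⟨1 / (2 * M + 40 * N + C + 2), by positivity, fun ε hε h => ?_⟩
  rw [le_div_iff₀ hpos] at h
  have h1 : 0 ≤ ε * M := by positivity
  have h2 : 0 ≤ ε * N := by positivity
  have h3 : 0 ≤ ε * C := by positivity
  refine ⟨?_, ?_, ?_, ?_⟩ <;> nlinarith

end ActionWindow

end PolyhedralReeb

end

/-! ### Assembly of the lemma -/

theorem lemma3p2 (Q : Polyhedron) (ρ : SO3) (f : S2 → ℝ) (hf : IsPolyhedralMorse Q ρ f)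
    (G : Subgroup SU2) (hG : G = binaryGroup Q ρ)
    (m : ℕ) (hm : m = Nat.card (ConjClasses G)) (N : ℕ) (hN : 1 ≤ N)
    (L : ℝ) (hL : L = 2 * Real.pi * N - Real.pi / 10) :
    m = Q.vertexOrder + 2 + 3 - 1 ∧
    ∃ ε₀ : ℝ, 0 < ε₀ ∧ ∀ ε : ℝ, 0 < ε → ε ≤ ε₀ →
      IsContactForm f ε ∧
      -- nondegeneracy and projection to orbifold critical points
      (∀ γ : ReebOrbit G f ε, γ.action < L →
        γ.IsNondegenerate ∧ ∃ p ∈ criticalPoints f, γ.ProjectsTo (baseProj G p)) ∧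
      -- the orbits are iterates of three embedded orbits, with explicit actions and indices
      (∃ 𝒱 ℰ ℱ : ReebOrbit G f ε,
        𝒱.IsEmbedded ∧ ℰ.IsEmbedded ∧ ℱ.IsEmbedded ∧
        (∀ p ∈ vertexPoints Q ρ, 𝒱.ProjectsTo (baseProj G p)) ∧
        (∀ p ∈ edgePoints Q ρ, ℰ.ProjectsTo (baseProj G p)) ∧
        (∀ p ∈ facePoints Q ρ, ℱ.ProjectsTo (baseProj G p)) ∧
        (∀ γ : ReebOrbit G f ε, γ.action < L ↔
          (∃ k : ℕ+, (k : ℕ) < 2 * N * Q.vertexOrder ∧ γ = 𝒱.iterate k) ∨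
          (∃ k : ℕ+, (k : ℕ) < 4 * N ∧ γ = ℰ.iterate k) ∨
          (∃ k : ℕ+, (k : ℕ) < 6 * N ∧ γ = ℱ.iterate k)) ∧
        (∀ k : ℕ+, (𝒱.iterate k).action = k * Real.pi * (1 - ε) / Q.vertexOrder) ∧
        (∀ k : ℕ+, (ℰ.iterate k).action = k * Real.pi / 2) ∧
        (∀ k : ℕ+, (ℱ.iterate k).action = k * Real.pi * (1 + ε) / 3) ∧
        (∀ k : ℕ+, (k : ℕ) < 2 * N * Q.vertexOrder →
          (𝒱.iterate k).HasCZIndex (2 * ⌈(k : ℝ) / Q.vertexOrder⌉ - 1)) ∧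
        (∀ k : ℕ+, (k : ℕ) < 4 * N → (ℰ.iterate k).HasCZIndex k) ∧
        (∀ k : ℕ+, (k : ℕ) < 6 * N →
          (ℱ.iterate k).HasCZIndex (2 * ⌊(k : ℝ) / 3⌋ + 1))) ∧
      -- the number of orbits in each degree
      (∀ i : ℤ, i < 0 ∨ 4 * N - 2 < i → (orbitsOfDegree G f ε L i).encard = 0) ∧
      (∀ i : ℤ, i = 0 ∨ i = 4 * N - 2 → (orbitsOfDegree G f ε L i).encard = (m - 1 : ℕ) ∧
        ∀ γ ∈ orbitsOfDegree G f ε L i, γ.IsGood) ∧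
      (∀ i : ℤ, Even i → 0 < i → i < 4 * N - 2 → (orbitsOfDegree G f ε L i).encard = m ∧
        ∀ γ ∈ orbitsOfDegree G f ε L i, γ.IsGood) ∧
      (∀ i : ℤ, Odd i → 0 < i → i < 4 * N - 2 → (orbitsOfDegree G f ε L i).encard = 1 ∧
        ∀ γ ∈ orbitsOfDegree G f ε L i, γ.IsBad) := by

  have hpi := Real.pi_pos
  obtain ⟨oV, oE, oF, hfin⟩ := polyhedron_orbits Q ρ
  obtain ⟨qV, qE, qF⟩ := exists_quadraticForm_of_isPolyhedralMorse hf
  set n := Q.vertexOrder with hn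
  have hn3 : 3 ≤ n := three_le_vertexOrder Q
  have hn5 : n ≤ 5 := vertexOrder_le_five Q
  have hn0 : 0 < n := by omega
  have vV : ∀ p ∈ vertexPoints Q ρ, f p = -1 := fun p hp => by
    obtain ⟨_, _, h⟩ := qV p hp
    exact h.value
  have vE : ∀ p ∈ edgePoints Q ρ, f p = 0 := fun p hp => by
    obtain ⟨_, _, h⟩ := qE p hp
    exact h.value
  have vF : ∀ p ∈ facePoints Q ρ, f p = 1 := fun p hp => by
    obtain ⟨_, _, h⟩ := qF p hp
    exact h.value
  have dVE := disjoint_of_value vV vE (by norm_num)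
  have dVF := disjoint_of_value vV vF (by norm_num)
  have dEF := disjoint_of_value vE vF (by norm_num)
  have cV : vertexPoints Q ρ ⊆ criticalPoints f := by
    rw [hf.critical]
    exact fun p hp => Or.inl (Or.inl hp)
  have cE : edgePoints Q ρ ⊆ criticalPoints f := by
    rw [hf.critical]
    exact fun p hp => Or.inl (Or.inr hp)
  have cF : facePoints Q ρ ⊆ criticalPoints f := by
    rw [hf.critical]
    exact fun p hp => Or.inr hp
  have hG' : G = (rotationGroup Q ρ).comap cover := hG
  subst hG'
  have hGfin := finite_comap_cover (rotationGroup Q ρ)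
  have hm1 : m = n + 4 := by
    have h := card_conjClasses_comap_cover oV oE oF dVE dVF dEF fun R hR hR1 p hp => by
      rw [← hf.critical]
      exact mem_criticalPoints_of_fixed hf.smooth (hf.invariant R hR) hR1 hp
    omega
  refine ⟨by omega, ?_⟩
  obtain ⟨M, hM0, hM⟩ := exists_abs_smoothExt_le hf.smooth
  obtain ⟨K, hK⟩ := exists_lipschitz_baseField hf.smooth
  set g : ℝ := (Nat.card ((rotationGroup Q ρ).comap cover) : ℝ) with hg
  have hL0 : 0 ≤ L := by
    have : (1 : ℝ) ≤ N := by exact_mod_cast hN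
    rw [hL]
    nlinarith
  -- M keeps 1 + εf at least 1/2, and 8K·|G|·L is the constant in the short-period argument for
  -- lifts closing up after |G| periods of length below L.
  obtain ⟨ε₀, hε₀, hsmall⟩ := exists_smallness M (8 * K * (g * L)) hM0 (by positivity) N
  refine ⟨ε₀, hε₀, fun ε hε hεle => ?_⟩
  obtain ⟨s1, s2, s3, s4⟩ := hsmall ε hε hεle
  have h : Admissible f ε := admissible_of_small hf.smooth hε hM s1
  -- The relevant ranges are k < 2nN with n ≤ 5 and k < 6N, so c ≤ 10 covers both; ε·k < 1 keeps the
  -- defect δ below 1/(2n).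
  have hεk : ∀ {k c : ℕ}, k < c * N → c ≤ 10 → ε * k < 1 := fun {k c} hk hc => by
    have h1 : k ≤ 10 * N := hk.le.trans (Nat.mul_le_mul_right N hc)
    have h2 : (k : ℝ) ≤ 10 * N := by exact_mod_cast h1
    nlinarith
  obtain ⟨𝒱, h𝒱⟩ := exists_isSimpleOrbitOver h hn0 oV cV vV
  obtain ⟨ℰ, hℰ⟩ := exists_isSimpleOrbitOver h two_pos oE cE vE
  obtain ⟨ℱ, hℱ⟩ := exists_isSimpleOrbitOver h three_pos oF cF vF
  have aV : ∀ k : ℕ+, (𝒱.iterate k).action = k * Real.pi * (1 - ε) / n := fun k => by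
    rw [ReebOrbit.action_iterate, h𝒱.action_eq]
    ring
  have aE : ∀ k : ℕ+, (ℰ.iterate k).action = k * Real.pi / 2 := fun k => by
    rw [ReebOrbit.action_iterate, hℰ.action_eq]
    push_cast
    ring
  have aF : ∀ k : ℕ+, (ℱ.iterate k).action = k * Real.pi * (1 + ε) / 3 := fun k => by
    rw [ReebOrbit.action_iterate, hℱ.action_eq]
    push_cast
    ring
  have ltV : ∀ k : ℕ+, (𝒱.iterate k).action < L ↔ (k : ℕ) < 2 * N * n := fun k => by
    rw [aV, hL, minimum_action_lt_iff hε (by linarith) (by linarith) hn0 hn5]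
  have ltE : ∀ k : ℕ+, (ℰ.iterate k).action < L ↔ (k : ℕ) < 4 * N := fun k => by
    rw [aE, hL, saddle_action_lt_iff]
  have ltF : ∀ k : ℕ+, (ℱ.iterate k).action < L ↔ (k : ℕ) < 6 * N := fun k => by
    rw [aF, hL, maximum_action_lt_iff hε (by linarith)]
  have oV' : ∀ k : ℕ+, (𝒱.iterate k).LiesOver (vertexPoints Q ρ) :=
    fun k => (ReebOrbit.LiesOver.iff_of_iterate k).2 h𝒱.liesOver
  have oE' : ∀ k : ℕ+, (ℰ.iterate k).LiesOver (edgePoints Q ρ) :=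
    fun k => (ReebOrbit.LiesOver.iff_of_iterate k).2 hℰ.liesOver
  have oF' : ∀ k : ℕ+, (ℱ.iterate k).LiesOver (facePoints Q ρ) :=
    fun k => (ReebOrbit.LiesOver.iff_of_iterate k).2 hℱ.liesOver
  have rV : ∀ k : ℕ+, (k : ℕ) < 2 * N * n → _ := fun k hk =>
    minimum_orbit h hε s2 (oV' k) cV qV hn0 k.pos (aV k)
      (hεk (c := 2 * n) (by linarith) (by omega))
  have rE : ∀ k : ℕ+, _ := fun k => hyperbolic_orbit h hε (oE' k) cE qE (aE k)
  have rF : ∀ k : ℕ+, (k : ℕ) < 6 * N → _ := fun k hk =>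
    maximum_orbit (n := 3) h hε (oF' k) cF qF three_pos k.pos (by rw [aF k]; push_cast; rfl)
      (hεk hk (by norm_num))
  have hlist : IsOrbitList 𝒱 ℰ ℱ L N n := by
    refine ⟨fun γ => ⟨fun hγ => ?_, ?_⟩, fun k l he => ?_, fun k l he => ?_, fun k l he => ?_,
      fun k hk => (rV k hk).2.2, fun k _ => (rE k).2.2, fun k hk => by
        simpa using (rF k hk).2.2⟩
    · obtain ⟨l, rfl⟩ := γ.exists_param
      obtain ⟨c, hc, hl⟩ := l.exists_lift
      have hcrit := l.hopf_mem_criticalPoints h hε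
        (fun A hA => hf.invariant (cover A) hA) hK (by
          have h1 : g * l.period ≤ g * L :=
            mul_le_mul_of_nonneg_left (le_of_lt hγ) (by positivity)
          have h2 := mul_le_mul_of_nonneg_left h1 (show 0 ≤ 8 * ε * (K : ℝ) by positivity)
          rw [← hg]
          linarith) hc hl
      rw [hf.critical] at hcrit
      rcases hcrit with (hp | hp) | hp
      · obtain ⟨k, hk⟩ := h𝒱.exists_iterate l c hc hl hp
        exact Or.inl ⟨k, (ltV k).1 (hk ▸ hγ), hk⟩
      · obtain ⟨k, hk⟩ := hℰ.exists_iterate l c hc hl hp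
        exact Or.inr (Or.inl ⟨k, (ltE k).1 (hk ▸ hγ), hk⟩)
      · obtain ⟨k, hk⟩ := hℱ.exists_iterate l c hc hl hp
        exact Or.inr (Or.inr ⟨k, (ltF k).1 (hk ▸ hγ), hk⟩)
    · rintro (⟨k, hk, rfl⟩ | ⟨k, hk, rfl⟩ | ⟨k, hk, rfl⟩)
      · exact (ltV k).2 hk
      · exact (ltE k).2 hk
      · exact (ltF k).2 hk
    · exact (oV' k).not_disjoint (he ▸ oE' l) dVE
    · exact (oV' k).not_disjoint (he ▸ oF' l) dVF
    · exact (oE' k).not_disjoint (he ▸ oF' l) dEF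
  have hgood : ∀ i : ℤ, Even i → ∀ γ ∈ orbitsOfDegree _ f ε L i, γ.IsGood := fun i hi γ hγ =>
    hlist.isGood_of_even (fun k hk => (rV k hk).2.1) (fun k hk => (rF k hk).2.1) hi hγ
  have hℰneg : ℰ.IsNegativeHyperbolic := by
    have := (rE 1).2.1 rfl
    rwa [ReebOrbit.iterate_one] at this
  refine ⟨isContactForm hf.smooth fun z => h.conf_ne z, fun γ hγ => ?_,
    ⟨𝒱, ℰ, ℱ, h𝒱.embedded, hℰ.embedded, hℱ.embedded, h𝒱.projectsTo, hℰ.projectsTo, hℱ.projectsTo,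
      hlist.action_lt_iff, aV, aE, aF, hlist.index_V, hlist.index_E, hlist.index_F⟩,
    fun i => hlist.encard_of_outside hn0, fun i hi => ?_, fun i hi h0 h1 => ?_,
    fun i hi h0 h1 => ⟨hlist.encard_of_odd hn0 hi h0 h1,
      fun γ => hlist.isBad_of_odd hn0 hℰneg hi⟩⟩
  · rcases (hlist.action_lt_iff γ).1 hγ with ⟨k, hk, rfl⟩ | ⟨k, hk, rfl⟩ | ⟨k, hk, rfl⟩
    · obtain ⟨p, hp⟩ := oV.nonempty
      exact ⟨(rV k hk).1, p, cV hp, (h𝒱.projectsTo p hp).iterate k⟩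
    · obtain ⟨p, hp⟩ := oE.nonempty
      exact ⟨(rE k).1, p, cE hp, (hℰ.projectsTo p hp).iterate k⟩
    · obtain ⟨p, hp⟩ := oF.nonempty
      exact ⟨(rF k hk).1, p, cF hp, (hℱ.projectsTo p hp).iterate k⟩
  · have hi2 : Even i := by
      rcases hi with rfl | rfl
      · exact Even.zero
      · exact ⟨2 * N - 1, by ring⟩
    refine ⟨?_, hgood i hi2⟩
    rcases hi with rfl | rfl
    · have := hlist.encard_of_even hn0 (j := 0) (by omega)
      rw [if_neg (by omega), if_pos rfl, Nat.cast_zero, mul_zero] at this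
      rw [this, hm1]
      rfl
    -- The top degree 4N − 2 is 2j with j = 2N − 1, the truncated block for 𝒱; it is distinct from
    -- the bottom block j = 0 because N ≥ 1.
    · have := hlist.encard_of_even hn0 (j := 2 * N - 1) (by omega)
      rw [if_pos (by omega), if_neg (by omega)] at this
      rw [show (4 * N - 2 : ℤ) = 2 * ((2 * N - 1 : ℕ) : ℤ) by omega, this]
      congr 1
      omega
  · refine ⟨?_, hgood i hi⟩
    obtain ⟨a, rfl⟩ := hi
    lift a to ℕ using by omega
    have := hlist.encard_of_even hn0 (j := a) (by omega)
    rw [if_neg (by omega), if_neg (by omega)] at this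
    rw [← two_mul, this]
    congr 1
    omega
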